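/- **Conventions.** A scheme $\tau$ in a first-order language $\mathcal L_\tau$ is a sentence $\tau(P)$ of $\mathcal L_\tau\cup\{P\}$, where $P$ is a fresh predicate of some arity. $\tau[\mathcal L_\tau]$ is the $\mathcal L_\tau$-theory of all universal closures of sentences obtained by substituting for $P$ in $\tau(P)$ an $\mathcal L_\tau$-formula, possibly with additional free variables as parameters. Let $M$ be a structure and let $\mathcal X$ be a family of relations, of all arities, on $M$. An internal $\mathcal L$-structure $\mathcal N$ consists of a nonempty domain $N\subseteq M$, an equality relation $=^{\mathcal N}$ on $N$ (not necessarily the identity), and interpretations on $N$ of the symbols of $\mathcal L$ (function symbols are interpreted by graphs) that respect $=^{\mathcal N}$; $\mathcal N\in\mathcal X$ means that all these relations are in $\mathcal X$. $\mathcal N$ is an $\mathcal X$-strong model of $\tau$ if $(\mathcal N,Y)\models\tau(P)$ for every $=^{\mathcal N}$-invariant relation $Y\in\mathcal X$ on $N$. An isomorphism $\mathcal N_0\to\mathcal N_1$ is a binary relation on $M$ that induces an isomorphism of the quotients by $=^{\mathcal N_0}$, $=^{\mathcal N_1}$. $(M,\mathcal X)\models \mathsf{PC}[T]$ means that $M\models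 T$ and $\mathcal X$ contains every relation defined by a formula of the language of $T$ without second-order quantifiers, with first-order parameters from $M$ and second-order parameters from $\mathcal X$. In $\mathsf{sPC}[T]$ only second-order parameters are allowed. $\tau$ is *categorical in $T$* (*standalone categorical in $T$*) if for every $(M,\mathcal X)\models\mathsf{PC}[T]$ (respectively $\mathsf{sPC}[T]$) and all $\mathcal X$-strong models $\mathcal N_0,\mathcal N_1\in\mathcal X$ of $\tau$ there is an isomorphism $F:\mathcal N_0\to\mathcal N_1$ with $F\in\mathcal X$. $\tau$ is *second-order internally categorical* if the same holds for every Henkin model $(M,\mathcal X)$ of pure second-order logic with full comprehension (with parameters). $\mathcal L^{\mathsf{duo}+}$ is $\mathcal L_\tau$ together with a red and a blue copy of $\mathcal L_\tau$, each with its own domain predicate and equality predicate. A model of $\tau^{\mathsf{duo}+}$ is a structure $(M,\mathcal R,\mathcal B)$, where $M$ is a model of $\tau[\mathcal L_\tau]$ and $\mathcal R$, $\mathcal B$ are internal $\mathcal L_\tau$-structures in $M$ that are strong models of $\tau$ with respect to all relations on $M$ definable with parameters in $(M,\mathcal R,\mathcal B)$. $\tau$ is *strongly internally categorical* if there is a single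 parameter-free $\mathcal L^{\mathsf{duo}+}$-formula $\alpha(x,y)$ that defines an isomorphism $\mathcal R\to\mathcal B$ in every model $(M,\mathcal R,\mathcal B)$ of $\tau^{\mathsf{duo}+}$. $\mathsf{AS}$ is adjunctive set theory, in the language $\{\in\}$: $\exists x\forall y\; y\notin x$ and $\forall x\forall y\exists z\forall w\,(w\in z\leftrightarrow w\in x\vee w=y)$. **Theorem.** 1. For every scheme $\tau$: if $\tau$ is strongly internally categorical, then $\tau$ is categorical in $\tau[\mathcal L_\tau]$. 2. Let $\tau$ be the scheme in the language $\{\le\}$, with $P$ unary, that is the conjunction of: "$\le$ is a linear order in which every element has an immediate successor $\mathsf S$ and an immediate predecessor $\mathsf P$"; $\forall x\bigl(P(x)\wedge\forall z\ge x\,(P(z)\to P(\mathsf S(z)))\to\forall z\ge x\,P(z)\bigr)$; and $\forall x\bigl(P(x)\wedge\forall z\le x\,(P(z)\to P(\mathsf P(z)))\to\forall z\le x\,P(z)\bigr)$ (the canonical second-order axiomatization of $(\mathbb Z,\le)$). Then $\tau$ is categorical in $\mathsf{AS}$ and second-order internally categorical, but $\tau$ is not strongly internally categorical. 3. For every scheme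 $\tau$: if $\tau$ is standalone categorical in $\tau[\mathcal L_\tau]$, then $\tau$ is strongly internally categorical. -/

import Mathlib

open FirstOrder FirstOrder.Language

universe u v u' v' w

namespace SchemeCat

/-! ### Schemes and their instances -/

/-- A single `k`-ary predicate symbol. -/
inductive PredSym (k : ℕ) : ℕ → Type
  | pred : PredSym k k

/-- The language whose only symbol is one `k`-ary predicate `P`. -/
def predLang (k : ℕ) : FirstOrder.Language.{0, 0} := ⟨fun _ => Empty, PredSym k⟩

/-- The interpretation of the predicate `P` by a given set of `k`-tuples. -/
abbrev predStructure {k : ℕ} {A : Type w} (S : Set (Fin k → A)) : (predLang k).Structure A where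
  funMap := fun f _ => f.elim
  RelMap := fun {_} R => match R with
    | PredSym.pred => fun x => x ∈ S

/-- An `L`-scheme `τ(P)`: a first-order sentence in the language `L` together with one fresh
predicate `P` (of any arity). -/
structure Scheme (L : FirstOrder.Language.{u, v}) where
  arity : ℕ
  sentence : (L.sum (predLang arity)).Sentence

/-- `(A, S) ⊨ τ(P)`, the predicate `P` being interpreted by `S`. -/
def Scheme.Holds {L : FirstOrder.Language.{u, v}} (τ : Scheme L) (A : Type w) [L.Structure A]
    (S : Set (Fin τ.arity → A)) : Prop :=
  letI := predStructure S
  A ⊨ τ.sentence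

section Substitution

variable {L : FirstOrder.Language.{u, v}} {k : ℕ} {β : Type}

/-- Terms of `L + P` are terms of `L`; the variables are renamed along the way. -/
def eraseTerm {n : ℕ} : (L.sum (predLang k)).Term (Empty ⊕ Fin n) → L.Term (β ⊕ Fin n)
  | Term.var x => Term.var (Sum.map Empty.elim id x)
  | Term.func (Sum.inl f) ts => Term.func f (fun i => eraseTerm (ts i))
  | Term.func (Sum.inr f) _ => Empty.elim f

/-- Substitution, for each atomic formula `P(t₁, …, tₖ)`, of the formula `φ(p, t₁, …, tₖ)`,
where the `p` (indexed by `β`) are parameters. -/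
def substPred (φ : L.Formula (β ⊕ Fin k)) :
    ∀ {n : ℕ}, (L.sum (predLang k)).BoundedFormula Empty n → L.BoundedFormula β n
  | _, BoundedFormula.falsum => BoundedFormula.falsum
  | _, BoundedFormula.equal t₁ t₂ => BoundedFormula.equal (eraseTerm t₁) (eraseTerm t₂)
  | _, BoundedFormula.rel (Sum.inl R) ts => BoundedFormula.rel R (fun i => eraseTerm (ts i))
  | n, BoundedFormula.rel (Sum.inr PredSym.pred) ts =>
      BoundedFormula.relabel (k := 0) (n := n) (id : β ⊕ Fin n → β ⊕ Fin n)
        (BoundedFormula.subst φ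
          (Sum.elim (fun b => Term.var (Sum.inl b)) (fun i => eraseTerm (ts i))))
  | _, BoundedFormula.imp ψ₁ ψ₂ => BoundedFormula.imp (substPred φ ψ₁) (substPred φ ψ₂)
  | _, BoundedFormula.all ψ => BoundedFormula.all (substPred φ ψ)

end Substitution

/-- The `L`-theory `τ[L]` of all instances of the `L`-scheme `τ`: the universal closures of the
results of substituting an `L`-formula, possibly with parameters, for `P` in `τ(P)`. -/
def Scheme.instances {L : FirstOrder.Language.{u, v}} (τ : Scheme L) : L.Theory :=
  {σ | ∃ (m : ℕ) (φ : L.Formula (Fin m ⊕ Fin τ.arity)),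
    σ = Formula.iAlls (Fin m)
      (Formula.relabel (Sum.inr : Fin m → Empty ⊕ Fin m) (substPred φ τ.sentence))}

/-! ### Structures given by relations on another structure -/

/-- An `L`-structure living inside the set `M` (a one-dimensional internal model): a nonempty
domain `dom ⊆ M`, an equality relation on it, which need not be the identity, and interpretations
of the symbols of `L` that respect that equality relation, function symbols being interpreted by
their graphs. Only the restrictions to `dom` of the relations matter. -/
structure InternalStr (L : FirstOrder.Language.{u, v}) (M : Type w) where
  dom : Set (Fin 1 → M)
  eq : Set (Fin 2 → M)
  rel : ∀ {n : ℕ}, L.Relations n → Set (Fin n → M)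
  graph : ∀ {n : ℕ}, L.Functions n → Set (Fin (n + 1) → M)
  nonempty : ∃ a : M, ![a] ∈ dom
  eq_refl : ∀ a, ![a] ∈ dom → ![a, a] ∈ eq
  eq_symm : ∀ a b, ![a] ∈ dom → ![b] ∈ dom → ![a, b] ∈ eq → ![b, a] ∈ eq
  eq_trans : ∀ a b c, ![a] ∈ dom → ![b] ∈ dom → ![c] ∈ dom →
    ![a, b] ∈ eq → ![b, c] ∈ eq → ![a, c] ∈ eq
  rel_congr : ∀ {n : ℕ} (R : L.Relations n) (x y : Fin n → M),
    (∀ i, ![x i] ∈ dom) → (∀ i, ![y i] ∈ dom) → (∀ i, ![x i, y i] ∈ eq) → x ∈ rel R → y ∈ rel R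
  graph_congr : ∀ {n : ℕ} (f : L.Functions n) (x y : Fin (n + 1) → M),
    (∀ i, ![x i] ∈ dom) → (∀ i, ![y i] ∈ dom) → (∀ i, ![x i, y i] ∈ eq) →
      x ∈ graph f → y ∈ graph f
  graph_total : ∀ {n : ℕ} (f : L.Functions n) (x : Fin n → M), (∀ i, ![x i] ∈ dom) →
    ∃ b, ![b] ∈ dom ∧ (Fin.snoc x b : Fin (n + 1) → M) ∈ graph f
  graph_unique : ∀ {n : ℕ} (f : L.Functions n) (x : Fin n → M) (b c : M), (∀ i, ![x i] ∈ dom) →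
    ![b] ∈ dom → ![c] ∈ dom → (Fin.snoc x b : Fin (n + 1) → M) ∈ graph f →
      (Fin.snoc x c : Fin (n + 1) → M) ∈ graph f → ![b, c] ∈ eq

namespace InternalStr

variable {L : FirstOrder.Language.{u, v}} {M : Type w}

/-- The domain of an internal structure, as a type. -/
def Dom (N : InternalStr L M) : Type w := {a : M // ![a] ∈ N.dom}

/-- The equality relation of an internal structure. -/
def setoid (N : InternalStr L M) : Setoid N.Dom where
  r a b := ![a.1, b.1] ∈ N.eq
  iseqv :=
    { refl := fun a => N.eq_refl a.1 a.2
      symm := fun {a b} h => N.eq_symm a.1 b.1 a.2 b.2 h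
      trans := fun {a b c} h h' => N.eq_trans a.1 b.1 c.1 a.2 b.2 c.2 h h' }

/-- The elements of an internal structure: its domain modulo its equality relation. -/
def Elem (N : InternalStr L M) : Type w := Quotient N.setoid

/-- The element named by a member of the domain. -/
def toElem (N : InternalStr L M) (a : N.Dom) : N.Elem := Quotient.mk N.setoid a

theorem exists_value (N : InternalStr L M) {n : ℕ} (f : L.Functions n) (q : Fin n → N.Elem) :
    ∃ (r : N.Elem) (a : Fin n → N.Dom) (b : N.Dom), (∀ i, N.toElem (a i) = q i) ∧ N.toElem b = r ∧
      (Fin.snoc (fun i => (a i).1) b.1 : Fin (n + 1) → M) ∈ N.graph f := by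
  choose a ha using fun i => Quotient.exists_rep (q i)
  obtain ⟨b, hb, hg⟩ := N.graph_total f (fun i => (a i).1) (fun i => (a i).2)
  exact ⟨N.toElem ⟨b, hb⟩, a, ⟨b, hb⟩, ha, rfl, hg⟩

/-- The actual `L`-structure (with true equality) that an internal structure describes. -/
noncomputable instance (N : InternalStr L M) : L.Structure N.Elem where
  funMap := fun f q => Classical.choose (N.exists_value f q)
  RelMap := fun {n} R q =>
    ∃ a : Fin n → N.Dom, (∀ i, N.toElem (a i) = q i) ∧ (fun i => (a i).1) ∈ N.rel R

end InternalStr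

/-! ### Second-order parts and strong models -/

/-- A candidate second-order part of a Henkin model with first-order part `M`: for each `n`, a
family of `n`-ary relations on `M`. -/
abbrev SOPart (M : Type w) := ∀ n : ℕ, Set (Set (Fin n → M))

/-- `N ∈ 𝒳`: all the relations making up `N` belong to `𝒳`. -/
def InternalStr.MemIn {L : FirstOrder.Language.{u, v}} {M : Type w} (N : InternalStr L M)
    (X : SOPart M) : Prop :=
  N.dom ∈ X 1 ∧ N.eq ∈ X 2 ∧ (∀ (n : ℕ) (R : L.Relations n), N.rel R ∈ X n) ∧
    ∀ (n : ℕ) (f : L.Functions n), N.graph f ∈ X (n + 1)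

/-- The relation on `M` (contained in the domain of `N` and invariant under its equality) that
corresponds to a relation `T` on the elements of `N`. -/
def InternalStr.pullback {L : FirstOrder.Language.{u, v}} {M : Type w} (N : InternalStr L M) {k : ℕ}
    (T : Set (Fin k → N.Elem)) : Set (Fin k → M) :=
  {x | ∃ h : ∀ i, ![x i] ∈ N.dom, (fun i => N.toElem ⟨x i, h i⟩) ∈ T}

/-- `N` is an `𝒳`-strong model of `τ`: `N ⊨ τ(P)` for all interpretations of `P` that are given by
relations in `𝒳` (on the domain of `N` and invariant under the equality of `N`). -/
def InternalStr.Strong {L : FirstOrder.Language.{u, v}} {M : Type w} (N : InternalStr L M)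
    (X : SOPart M) (τ : Scheme L) : Prop :=
  ∀ T : Set (Fin τ.arity → N.Elem), N.pullback T ∈ X τ.arity → τ.Holds N.Elem T

/-- The binary relation `F` on `M` induces, modulo the respective equality relations, an
isomorphism from `N₀` to `N₁`. -/
def InternalStr.IsIso {L : FirstOrder.Language.{u, v}} {M : Type w} (N₀ N₁ : InternalStr L M)
    (F : Set (Fin 2 → M)) : Prop :=
  ∃ e : N₀.Elem ≃[L] N₁.Elem,
    F = {z | ∃ (h₀ : ![z 0] ∈ N₀.dom) (h₁ : ![z 1] ∈ N₁.dom),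
      e (N₀.toElem ⟨z 0, h₀⟩) = N₁.toElem ⟨z 1, h₁⟩}

/-! ### Predicative comprehension and (standalone) categoricity in a theory -/

/-- The relational language with a symbol for each relation in `𝒳`. -/
def paramLang {M : Type w} (X : SOPart M) : FirstOrder.Language.{0, w} := ⟨fun _ => Empty, fun n => ↥(X n)⟩

/-- The symbol for a relation in `𝒳` is interpreted by that relation. -/
instance paramStructure {M : Type w} (X : SOPart M) : (paramLang X).Structure M where
  funMap := fun f _ => f.elim
  RelMap := fun {_} S x => x ∈ S.1

/-- Predicative comprehension with both first- and second-order parameters: `𝒳` contains every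
relation defined in `M` by a formula of the language `B` without second-order quantifiers, with
parameters from `M` and `𝒳`. -/
def PredComp (B : FirstOrder.Language.{u, v}) {M : Type w} [B.Structure M] (X : SOPart M) : Prop :=
  ∀ (n : ℕ) (S : Set (Fin n → M)),
    (Set.univ : Set M).Definable (B.sum (paramLang X)) S → S ∈ X n

/-- Standalone predicative comprehension: the same, but only second-order parameters are
allowed. -/
def StandalonePredComp (B : FirstOrder.Language.{u, v}) {M : Type w} [B.Structure M] (X : SOPart M) : Prop :=
  ∀ (n : ℕ) (S : Set (Fin n → M)),
    (∅ : Set M).Definable (B.sum (paramLang X)) S → S ∈ X n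

/-- `τ` is categorical in the theory `T`: in every model `(M, 𝒳)` of `T` with predicative
comprehension, any two `𝒳`-strong models of `τ` in `𝒳` are isomorphic by an isomorphism
in `𝒳`. -/
def Scheme.CategoricalIn {L : FirstOrder.Language.{u, v}} (τ : Scheme L) {B : FirstOrder.Language.{u', v'}}
    (T : B.Theory) : Prop :=
  ∀ (M : Type w) [B.Structure M] (X : SOPart M), M ⊨ T → PredComp B X →
    ∀ N₀ N₁ : InternalStr L M, N₀.MemIn X → N₁.MemIn X → N₀.Strong X τ → N₁.Strong X τ →
      ∃ F ∈ X 2, N₀.IsIso N₁ F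

/-- `τ` is standalone categorical in the theory `T`: the same with standalone predicative
comprehension. -/
def Scheme.StandaloneCategoricalIn {L : FirstOrder.Language.{u, v}} (τ : Scheme L) {B : FirstOrder.Language.{u', v'}}
    (T : B.Theory) : Prop :=
  ∀ (M : Type w) [B.Structure M] (X : SOPart M), M ⊨ T → StandalonePredComp B X →
    ∀ N₀ N₁ : InternalStr L M, N₀.MemIn X → N₁.MemIn X → N₀.Strong X τ → N₁.Strong X τ →
      ∃ F ∈ X 2, N₀.IsIso N₁ F

/-! ### Strong internal categoricity -/

/-- The symbols of a coloured copy of `L`: a domain, an equality relation, and a relation symbol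
for each symbol of `L` (function symbols are represented by their graphs). -/
inductive ColorSym (L : FirstOrder.Language.{u, v}) : ℕ → Type (max u v)
  | dom : ColorSym L 1
  | eq : ColorSym L 2
  | rel {n : ℕ} (R : L.Relations n) : ColorSym L n
  | graph {n : ℕ} (f : L.Functions n) : ColorSym L (n + 1)

/-- A coloured copy of the language `L`. -/
def colorLang (L : FirstOrder.Language.{u, v}) : FirstOrder.Language.{0, max u v} := ⟨fun _ => Empty, ColorSym L⟩

/-- The interpretation of a coloured copy of `L` by an internal structure. -/
abbrev colorStructure {L : FirstOrder.Language.{u, v}} {M : Type w} (N : InternalStr L M) :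
    (colorLang L).Structure M where
  funMap := fun f _ => f.elim
  RelMap := fun {_} S => match S with
    | ColorSym.dom => fun x => x ∈ N.dom
    | ColorSym.eq => fun x => x ∈ N.eq
    | ColorSym.rel R => fun x => x ∈ N.rel R
    | ColorSym.graph f => fun x => x ∈ N.graph f

/-- The language `L^{duo+}`: the language `L` of the background structure, together with a red
copy and a blue copy of `L`. -/
abbrev duoPlus (L : FirstOrder.Language.{u, v}) : FirstOrder.Language.{u, max u v} :=
  L.sum ((colorLang L).sum (colorLang L))

/-- The `L^{duo+}`-structure `(M, R, B)` with background `M`, red model `R` and blue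
model `B`. -/
abbrev duoStructure {L : FirstOrder.Language.{u, v}} {M : Type w} [L.Structure M] (R B : InternalStr L M) :
    (duoPlus L).Structure M :=
  letI : ((colorLang L).sum (colorLang L)).Structure M :=
    @sumStructure (colorLang L) (colorLang L) M (colorStructure R) (colorStructure B)
  inferInstance

/-- The relations that are parametrically definable in the `L^{duo+}`-structure `(M, R, B)`. -/
def duoDef {L : FirstOrder.Language.{u, v}} {M : Type w} [L.Structure M] (R B : InternalStr L M) :
    SOPart M :=
  letI := duoStructure R B
  fun _ => {S | (Set.univ : Set M).Definable (duoPlus L) S}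

/-- `(M, R, B)` is a model of `τ^{duo+}`: the background `M` satisfies all `L`-instances of `τ`,
and the red and the blue model both satisfy all `L^{duo+}`-instances (with parameters) of `τ`. -/
def ModelsDuoPlus {L : FirstOrder.Language.{u, v}} (τ : Scheme L) {M : Type w} [L.Structure M]
    (R B : InternalStr L M) : Prop :=
  M ⊨ τ.instances ∧ R.Strong (duoDef R B) τ ∧ B.Strong (duoDef R B) τ

/-- `τ` is strongly internally categorical: there is one `L^{duo+}`-formula `α(x, y)`, without
parameters, which in every model of `τ^{duo+}` defines an isomorphism between the red and the
blue model. -/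
def Scheme.StronglyInternallyCategorical {L : FirstOrder.Language.{u, v}} (τ : Scheme L) : Prop :=
  ∃ α : (duoPlus L).Formula (Fin 2), ∀ (M : Type w) [L.Structure M] (R B : InternalStr L M),
    ModelsDuoPlus τ R B →
      R.IsIso B {z | @Formula.Realize (duoPlus L) M (duoStructure R B) (Fin 2) α z}

/-! ### Second-order internal categoricity -/

/-- Formulas of pure second-order logic. Object variables are `x₀, x₁, …`, and for each `n` there
are `n`-ary relation variables `Xⁿ₀, Xⁿ₁, …`. -/
inductive SOFormula : Type
  | falsum : SOFormula
  | equal (i j : ℕ) : SOFormula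
  | app (n X : ℕ) (t : Fin n → ℕ) : SOFormula
  | imp (φ ψ : SOFormula) : SOFormula
  | all (i : ℕ) (φ : SOFormula) : SOFormula
  | allRel (n X : ℕ) (φ : SOFormula) : SOFormula

/-- Henkin semantics: relation quantifiers range over `𝒳`. -/
def SOFormula.Realize {M : Type w} (X : SOPart M) :
    SOFormula → (ℕ → M) → (∀ n : ℕ, ℕ → Set (Fin n → M)) → Prop
  | falsum, _, _ => False
  | equal i j, v, _ => v i = v j
  | app n Y t, v, V => (fun i => v (t i)) ∈ V n Y
  | imp φ ψ, v, V => φ.Realize X v V → ψ.Realize X v V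
  | all i φ, v, V => ∀ a : M, φ.Realize X (Function.update v i a) V
  | allRel n Y φ, v, V => ∀ S ∈ X n,
      φ.Realize X v (Function.update V n (Function.update (V n) Y S))

/-- `(M, 𝒳)` is a Henkin model of second-order logic with full comprehension: every relation
defined by a second-order formula in the variables `x₀, …, xₙ₋₁`, with any first- and second-order
parameters, belongs to `𝒳`. -/
def IsHenkin {M : Type w} (X : SOPart M) : Prop :=
  (∀ n, (X n).Nonempty) ∧
  ∀ (φ : SOFormula) (v : ℕ → M) (V : ∀ n : ℕ, ℕ → Set (Fin n → M)), (∀ n i, V n i ∈ X n) →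
    ∀ n : ℕ, {x : Fin n → M |
      φ.Realize X (fun i => if h : i < n then x ⟨i, h⟩ else v i) V} ∈ X n

/-- `τ` is second-order internally categorical: in every Henkin model of second-order logic any two
strong models of `τ` are isomorphic by an isomorphism that belongs to the Henkin model. -/
def Scheme.SecondOrderInternallyCategorical {L : FirstOrder.Language.{u, v}} (τ : Scheme L) : Prop :=
  ∀ (M : Type w) (X : SOPart M), IsHenkin X →
    ∀ N₀ N₁ : InternalStr L M, N₀.MemIn X → N₁.MemIn X → N₀.Strong X τ → N₁.Strong X τ →
      ∃ F ∈ X 2, N₀.IsIso N₁ F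

/-! ### Adjunctive set theory -/

/-- The membership symbol. -/
inductive MemSym : ℕ → Type
  | mem : MemSym 2

/-- The language of set theory. -/
def setLang : FirstOrder.Language.{0, 0} := ⟨fun _ => Empty, MemSym⟩

/-- `x ∈ y`. -/
def memF {n : ℕ} (x y : Fin n) : setLang.BoundedFormula Empty n :=
  Relations.boundedFormula₂ (L := setLang) MemSym.mem (&x) (&y)

/-- Adjunctive set theory `AS`: there is an empty set, and for all `x`, `y` there is a set whose
members are `y` and the members of `x`. (There is no extensionality axiom.) -/
def AS : setLang.Theory :=
  {∃' ∀' ∼(memF 1 0), ∀' ∀' ∃' ∀' ((memF 3 2) ⇔ (memF 3 0 ⊔ (&3 =' &1)))}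

/-! ### The scheme of the ordered integers -/

/-- The language `{≤}` with a unary predicate `P`. -/
abbrev orderP : FirstOrder.Language.{0, 0} := FirstOrder.Language.order.sum (predLang 1)

/-- `x ≤ y`. -/
def leF {n : ℕ} (x y : Fin n) : orderP.BoundedFormula Empty n :=
  Relations.boundedFormula₂ (L := orderP) (Sum.inl orderRel.le) (&x) (&y)

/-- `P(x)`. -/
def predF {n : ℕ} (x : Fin n) : orderP.BoundedFormula Empty n :=
  Relations.boundedFormula₁ (L := orderP) (Sum.inr PredSym.pred) (&x)

/-- `x < y`. -/
def ltF {n : ℕ} (x y : Fin n) : orderP.BoundedFormula Empty n :=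
  leF x y ⊓ ∼(leF y x)

/-- `y` is the immediate successor of `x`. -/
def succF {n : ℕ} (x y : Fin n) : orderP.BoundedFormula Empty n :=
  ltF x y ⊓ ∀' ∼(ltF x.castSucc (Fin.last n) ⊓ ltF (Fin.last n) y.castSucc)

/-- `≤` is a linear order. -/
def linearOrderF : orderP.Sentence :=
  (∀' leF 0 0) ⊓ (∀' ∀' (leF 0 1 ⟹ leF 1 0 ⟹ (&0 =' &1))) ⊓
    (∀' ∀' ∀' (leF 0 1 ⟹ leF 1 2 ⟹ leF 0 2)) ⊓ (∀' ∀' (leF 0 1 ⊔ leF 1 0))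

/-- Every element has an immediate successor and an immediate predecessor. -/
def discreteF : orderP.Sentence :=
  (∀' ∃' succF 0 1) ⊓ (∀' ∃' succF 1 0)

/-- Upward induction: for all `x`, if `P(x)` and, for all `z ≥ x`, `P(z)` implies `P` of the
successor of `z`, then `P(z)` for all `z ≥ x`. -/
def inductionUpF : orderP.Sentence :=
  ∀' ((predF 0 ⊓ ∀' (leF 0 1 ⟹ predF 1 ⟹ ∀' (succF 1 2 ⟹ predF 2))) ⟹
    ∀' (leF 0 1 ⟹ predF 1))

/-- Downward induction: for all `x`, if `P(x)` and, for all `z ≤ x`, `P(z)` implies `P` of the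
predecessor of `z`, then `P(z)` for all `z ≤ x`. -/
def inductionDownF : orderP.Sentence :=
  ∀' ((predF 0 ⊓ ∀' (leF 1 0 ⟹ predF 1 ⟹ ∀' (succF 2 1 ⟹ predF 2))) ⟹
    ∀' (leF 1 0 ⟹ predF 1))

/-- The scheme given by the canonical second-order axiomatization of `(ℤ, ≤)`. -/
def intScheme : Scheme FirstOrder.Language.order where
  arity := 1
  sentence := linearOrderF ⊓ discreteF ⊓ inductionUpF ⊓ inductionDownF

end SchemeCat

/-! All three claims turn on which relations a family `X` is forced to contain.

Strong internal categoricity gives categoricity because predicative comprehension puts every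
relation definable in `(M, N₀, N₁)` into `X` (`duoDef_subset`). So `X`-strong models give a model of
`τ^{duo+}`, and the isomorphism defined there by `α` belongs to `X`.

For the passage from standalone categoricity to strong internal categoricity, take in a model `(M,
R, B)` of `τ^{duo+}` the family of relations definable without parameters. It satisfies standalone
comprehension, so some parameter-free formula defines an isomorphism (`exists_formula_iso`). That
formula may depend on the model. Being an internal structure and being strong are both expressed by
first-order sentences (`exists_interprets`, `exists_holds_formula`), so compactness leaves finitely
many candidate formulas, and these are merged by a case distinction (`exists_uniform_formula`). The
case distinction needs "`β` defines an isomorphism" to be a single sentence, hence a finite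
language. Categoricity provides this: symbols that do not matter for `τ` can be reinterpreted at
will, which destroys isomorphism unless there are hardly any of them
(`finite_symbols_of_nontrivial`). The argument needs a model of `τ[L]` with two elements; if there
is none, `⊤` serves as `α`.

For the ordered integers, an isomorphism is built by choosing points `a`, `b` and matching iterated
successors with iterated successors, and predecessors with predecessors. It is enough that `X` is
closed under first-order definability and contains, for `Base` and `Step` in `X`, some solution of
the corresponding fixed-point equation (`FOClosed`, `HasFix`, `exists_iso_of_strong`). The solution
need not be least, because induction in the two internal orders, applied to the solution itself,
gives totality and monotonicity. A solution is the union of all collections of pairs in which each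
pair is justified by `Base` or by a `Step` from another member. In adjunctive set theory these
collections are coded by sets of Kuratowski pairs; in a Henkin model they are the relations in `X`.
Both kinds are closed under adding a pair.

Strong internal categoricity fails for the integers because an uncountable model of the theory of
`(ℤ, ≤)` has two disjoint galaxies. Each is a copy of `ℤ` and hence strong for every family.
Shifting the red galaxy by one step and fixing all other points is an automorphism of `(M, R, B)`,
and no definable bijection between the galaxies can be invariant under it. -/

namespace SchemeCat

/-! ### Internal structures and their quotients -/

namespace InternalStr

variable {L : FirstOrder.Language.{u, v}} {M : Type w} (N : InternalStr L M)

theorem exists_toElem (q : N.Elem) : ∃ a, N.toElem a = q := Quotient.exists_rep q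

theorem exists_toElem_tuple {n : ℕ} (q : Fin n → N.Elem) :
    ∃ a : Fin n → N.Dom, (fun i => N.toElem (a i)) = q := by
  choose a ha using fun i => N.exists_toElem (q i)
  exact ⟨a, funext ha⟩

theorem toElem_eq {a b : N.Dom} : N.toElem a = N.toElem b ↔ ![a.1, b.1] ∈ N.eq :=
  Quotient.eq

theorem relMap_toElem {n : ℕ} (R : L.Relations n) (a : Fin n → N.Dom) :
    Structure.RelMap R (fun i => N.toElem (a i)) ↔ (fun i => (a i).1) ∈ N.rel R := by
  constructor
  · rintro ⟨b, hb, h⟩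
    exact N.rel_congr R _ _ (fun i => (b i).2) (fun i => (a i).2) (fun i => N.toElem_eq.1 (hb i)) h
  · exact fun h => ⟨a, fun _ => rfl, h⟩

/-- The operation on the quotient is defined by choosing representatives and a value; congruence and
uniqueness of the graph make both choices immaterial. -/
theorem funMap_toElem {n : ℕ} (f : L.Functions n) (a : Fin n → N.Dom) (b : N.Dom) :
    Structure.funMap f (fun i => N.toElem (a i)) = N.toElem b ↔
      (Fin.snoc (fun i => (a i).1) b.1 : Fin (n + 1) → M) ∈ N.graph f := by
  obtain ⟨a', b', ha, hb, hg⟩ :=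
    Classical.choose_spec (N.exists_value f (fun i => N.toElem (a i)))
  have hg' : (Fin.snoc (fun i => (a i).1) b'.1 : Fin (n + 1) → M) ∈ N.graph f := by
    refine N.graph_congr f _ _ (fun i => ?_) (fun i => ?_) (fun i => ?_) hg
    · refine Fin.lastCases ?_ (fun i => ?_) i
      · simpa using b'.2
      · simpa using (a' i).2
    · refine Fin.lastCases ?_ (fun i => ?_) i
      · simpa using b'.2
      · simpa using (a i).2
    · refine Fin.lastCases ?_ (fun i => ?_) i
      · simpa using N.eq_refl _ b'.2
      · simpa using N.toElem_eq.1 (ha i)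
  have hb' : Structure.funMap f (fun i => N.toElem (a i)) = N.toElem b' := hb.symm
  rw [hb', N.toElem_eq]
  constructor
  · intro h
    refine N.graph_congr f _ _ (fun i => ?_) (fun i => ?_) (fun i => ?_) hg'
    · refine Fin.lastCases ?_ (fun i => ?_) i
      · simpa using b'.2
      · simpa using (a i).2
    · refine Fin.lastCases ?_ (fun i => ?_) i
      · simpa using b.2
      · simpa using (a i).2
    · refine Fin.lastCases ?_ (fun i => ?_) i
      · simpa using h
      · simpa using N.eq_refl _ (a i).2
  · intro h
    exact N.graph_unique f _ _ _ (fun i => (a i).2) b'.2 b.2 hg' h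

/-- The first-order conditions on the underlying set which say that `F` induces an isomorphism. -/
structure IsoCond (N₀ N₁ : InternalStr L M) (F : Set (Fin 2 → M)) : Prop where
  dom : ∀ x y, ![x, y] ∈ F → ![x] ∈ N₀.dom ∧ ![y] ∈ N₁.dom
  total : ∀ x, ![x] ∈ N₀.dom → ∃ y, ![x, y] ∈ F
  surj : ∀ y, ![y] ∈ N₁.dom → ∃ x, ![x, y] ∈ F
  eq_iff : ∀ x y x' y', ![x, y] ∈ F → ![x', y'] ∈ F → (![x, x'] ∈ N₀.eq ↔ ![y, y'] ∈ N₁.eq)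
  inv : ∀ x y x' y', ![x, y] ∈ F → ![x'] ∈ N₀.dom → ![y'] ∈ N₁.dom → ![x, x'] ∈ N₀.eq →
    ![y, y'] ∈ N₁.eq → ![x', y'] ∈ F
  rel : ∀ {n : ℕ} (R : L.Relations n) (x y : Fin n → M), (∀ i, ![x i, y i] ∈ F) →
    (x ∈ N₀.rel R ↔ y ∈ N₁.rel R)
  graph : ∀ {n : ℕ} (f : L.Functions n) (x y : Fin (n + 1) → M), (∀ i, ![x i, y i] ∈ F) →
    (x ∈ N₀.graph f ↔ y ∈ N₁.graph f)

theorem snoc_dom_eq {n : ℕ} (a : Fin (n + 1) → N.Dom) :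
    (Fin.snoc (fun i => (a (Fin.castSucc i)).1) (a (Fin.last n)).1 : Fin (n + 1) → M) =
      fun i => (a i).1 := by
  funext i
  refine Fin.lastCases ?_ (fun i => ?_) i <;> simp

/-- The conditions on the right speak of members of `M` and never of the quotients, so they can
later be written as first-order sentences. In the converse direction, `eq_iff` and `inv` make `F`
the graph of a map between the quotients. -/
theorem isIso_iff {N₀ N₁ : InternalStr L M} {F : Set (Fin 2 → M)} :
    N₀.IsIso N₁ F ↔ IsoCond N₀ N₁ F := by
  constructor
  · rintro ⟨e, rfl⟩
    refine ⟨?_, ?_, ?_, ?_, ?_, ?_, ?_⟩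
    · rintro x y ⟨h₀, h₁, -⟩
      exact ⟨h₀, h₁⟩
    · intro x hx
      obtain ⟨b, hb⟩ := N₁.exists_toElem (e (N₀.toElem ⟨x, hx⟩))
      exact ⟨b.1, hx, b.2, hb.symm⟩
    · intro y hy
      obtain ⟨a, ha⟩ := N₀.exists_toElem (e.symm (N₁.toElem ⟨y, hy⟩))
      exact ⟨a.1, a.2, hy, (congrArg e ha).trans (e.apply_symm_apply _)⟩
    · rintro x y x' y' ⟨h₀, h₁, h⟩ ⟨h₀', h₁', h'⟩
      have := N₀.toElem_eq (a := ⟨x, h₀⟩) (b := ⟨x', h₀'⟩)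
      have h2 := N₁.toElem_eq (a := ⟨y, h₁⟩) (b := ⟨y', h₁'⟩)
      refine this.symm.trans (Iff.trans ?_ h2)
      refine Iff.trans e.injective.eq_iff.symm ?_
      exact Eq.congr h h'
    · rintro x y x' y' ⟨h₀, h₁, h⟩ h₀' h₁' hx hy
      refine ⟨h₀', h₁', ?_⟩
      have h1 := (N₀.toElem_eq (a := ⟨x, h₀⟩) (b := ⟨x', h₀'⟩)).2 hx
      have h2 := (N₁.toElem_eq (a := ⟨y, h₁⟩) (b := ⟨y', h₁'⟩)).2 hy
      exact (congrArg e h1.symm).trans (h.trans h2)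
    · intro n R x y h
      choose h₀ h₁ h using h
      refine (N₀.relMap_toElem R (fun i => ⟨x i, h₀ i⟩)).symm.trans
        (Iff.trans ?_ (N₁.relMap_toElem R (fun i => ⟨y i, h₁ i⟩)))
      rw [← e.map_rel]
      exact iff_of_eq (congrArg _ (funext h))
    · intro n f x y h
      choose h₀ h₁ h using h
      have k₀ := N₀.funMap_toElem f (fun i => ⟨x i.castSucc, h₀ _⟩) ⟨x (Fin.last n), h₀ _⟩
      have k₁ := N₁.funMap_toElem f (fun i => ⟨y i.castSucc, h₁ _⟩) ⟨y (Fin.last n), h₁ _⟩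
      have s₀ := N₀.snoc_dom_eq (fun i => ⟨x i, h₀ i⟩)
      have s₁ := N₁.snoc_dom_eq (fun i => ⟨y i, h₁ i⟩)
      dsimp only at s₀ s₁ k₀ k₁
      rw [s₀] at k₀
      rw [s₁] at k₁
      refine k₀.symm.trans (Iff.trans ?_ k₁)
      rw [← e.injective.eq_iff, e.map_fun]
      refine Eq.congr (congrArg _ (funext fun i => h _)) (h _)
  · intro H
    have ex : ∀ q : N₀.Elem, ∃ r : N₁.Elem, ∃ a b, N₀.toElem a = q ∧ N₁.toElem b = r ∧
        ![a.1, b.1] ∈ F := by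
      intro q
      obtain ⟨a, rfl⟩ := N₀.exists_toElem q
      obtain ⟨y, hy⟩ := H.total a.1 a.2
      exact ⟨_, a, ⟨y, (H.dom _ _ hy).2⟩, rfl, rfl, hy⟩
    choose g hg using ex
    have key : ∀ (a : N₀.Dom) (b : N₁.Dom), g (N₀.toElem a) = N₁.toElem b ↔ ![a.1, b.1] ∈ F := by
      intro a b
      obtain ⟨a', b', ha, hb, h⟩ := hg (N₀.toElem a)
      rw [← hb, N₁.toElem_eq]
      constructor
      · intro k
        exact H.inv _ _ _ _ h a.2 b.2 (N₀.toElem_eq.1 ha) k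
      · intro k
        exact (H.eq_iff _ _ _ _ h k).1 (N₀.toElem_eq.1 ha)
    have bij : Function.Bijective g := by
      constructor
      · intro p q h
        obtain ⟨a, b, rfl, hb, hF⟩ := hg p
        obtain ⟨a', b', rfl, hb', hF'⟩ := hg q
        rw [N₀.toElem_eq, H.eq_iff _ _ _ _ hF hF', ← N₁.toElem_eq, hb, hb', h]
      · intro r
        obtain ⟨b, rfl⟩ := N₁.exists_toElem r
        obtain ⟨x, hx⟩ := H.surj b.1 b.2
        exact ⟨N₀.toElem ⟨x, (H.dom _ _ hx).1⟩, (key _ _).2 hx⟩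
    refine ⟨⟨Equiv.ofBijective g bij, ?_, ?_⟩, ?_⟩
    · intro n f q
      obtain ⟨a, rfl⟩ := N₀.exists_toElem_tuple q
      obtain ⟨c, hc⟩ := N₀.exists_toElem (Structure.funMap f fun i => N₀.toElem (a i))
      have h1 := (N₀.funMap_toElem f a c).1 hc.symm
      choose b hb using fun i => N₁.exists_toElem (g (N₀.toElem (a i)))
      obtain ⟨d, hd⟩ := N₁.exists_toElem (g (N₀.toElem c))
      have e1 : ((Equiv.ofBijective g bij).toFun ∘ fun i => N₀.toElem (a i)) = fun i => N₁.toElem (b i) :=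
        funext fun i => (hb i).symm
      change g _ = Structure.funMap f (_ ∘ _)
      rw [e1, ← hc, ← hd]
      refine ((N₁.funMap_toElem f b d).2 ?_).symm
      refine (H.graph f _ _ (fun i => ?_)).1 h1
      refine Fin.lastCases ?_ (fun i => ?_) i
      · simpa using (key c d).1 hd.symm
      · simpa using (key (a i) (b i)).1 (hb i).symm
    · intro n R q
      obtain ⟨a, rfl⟩ := N₀.exists_toElem_tuple q
      choose b hb using fun i => N₁.exists_toElem (g (N₀.toElem (a i)))
      have e1 : ((Equiv.ofBijective g bij).toFun ∘ fun i => N₀.toElem (a i)) = fun i => N₁.toElem (b i) :=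
        funext fun i => (hb i).symm
      change Structure.RelMap R (_ ∘ _) ↔ _
      rw [e1, N₀.relMap_toElem, N₁.relMap_toElem]
      exact (H.rel R _ _ fun i => (key (a i) (b i)).1 (hb i).symm).symm
    · ext z
      have hz : z = ![z 0, z 1] := by
        ext i
        fin_cases i <;> rfl
      constructor
      · intro h
        rw [hz] at h
        exact ⟨(H.dom _ _ h).1, (H.dom _ _ h).2, (key ⟨_, _⟩ ⟨_, _⟩).2 h⟩
      · rintro ⟨h₀, h₁, h⟩
        rw [hz]
        exact (key ⟨_, h₀⟩ ⟨_, h₁⟩).1 h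

theorem Strong.anti {N : InternalStr L M} {X Y : SOPart M} {τ : Scheme L} (h : N.Strong Y τ)
    (hXY : ∀ n, X n ⊆ Y n) : N.Strong X τ :=
  fun T hT => h T (hXY _ hT)

end InternalStr

/-! ### From strong internal categoricity to categoricity -/

section Duo

variable {L : FirstOrder.Language.{u, v}} {M : Type w}

/-- Interpreting the colour symbols by the relations of an internal structure in `X`. -/
def colorToParam {X : SOPart M} (N : InternalStr L M) (h : N.MemIn X) :
    colorLang L →ᴸ paramLang X where
  onFunction := fun {_} f => f.elim
  onRelation := fun {_} S => match S with
    | ColorSym.dom => (⟨N.dom, h.1⟩ : X 1)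
    | ColorSym.eq => (⟨N.eq, h.2.1⟩ : X 2)
    | ColorSym.rel R => (⟨N.rel R, h.2.2.1 _ R⟩ : X _)
    | ColorSym.graph f => (⟨N.graph f, h.2.2.2 _ f⟩ : X _)

/-- Sending the red and blue symbols to the symbols that name the relations of `R` and `B` turns a
parametric definition over `(M, R, B)` into an instance of comprehension for `X`. -/
theorem duoDef_subset {L : FirstOrder.Language.{u, v}} {M : Type w} [L.Structure M]
    {X : SOPart M} (hX : PredComp L X) (R B : InternalStr L M) (hR : R.MemIn X) (hB : B.MemIn X)
    (n : ℕ) : duoDef R B n ⊆ X n := by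
  intro S hS
  refine hX n S ?_
  let := duoStructure R B
  let φ : duoPlus L →ᴸ L.sum (paramLang X) :=
    LHom.sumElim LHom.sumInl
      (LHom.sumElim (LHom.sumInr.comp (colorToParam R hR)) (LHom.sumInr.comp (colorToParam B hB)))
  have : φ.IsExpansionOn M :=
    { map_onFunction := fun f x => by
        rcases f with f | f | f
        · rfl
        · exact f.elim
        · exact f.elim
      map_onRelation := fun {_} S x => by
        rcases S with S | S | S
        · rfl
        · cases S <;> rfl
        · cases S <;> rfl }
  exact Set.Definable.map_expansion hS φ

theorem Scheme.StronglyInternallyCategorical.categoricalIn {L : FirstOrder.Language.{u, v}}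
    {τ : Scheme L} (h : Scheme.StronglyInternallyCategorical.{u, v, w} τ) :
    Scheme.CategoricalIn.{u, v, u, v, w} τ τ.instances := by
  obtain ⟨α, hα⟩ := h
  intro M _ X hM hX N₀ N₁ h₀ h₁ s₀ s₁
  have hsub := duoDef_subset hX N₀ N₁ h₀ h₁
  -- Strength passes down to the smaller family of definable relations, and the isomorphism defined
  -- by `α` passes up into `X`.
  refine ⟨_, hsub 2 ?_, hα M N₀ N₁ ⟨hM, s₀.anti hsub, s₁.anti hsub⟩⟩
  let := duoStructure N₀ N₁
  exact (Set.empty_definable_iff.2 ⟨α, rfl⟩).mono (Set.empty_subset _)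

end Duo

/-! ### Definable sets and instances of a scheme -/

section Definability

variable {Λ : FirstOrder.Language.{u, v}} {M : Type w} [Λ.Structure M] {α : Type}

theorem definable_of_fin_params {m : ℕ} (φ : Λ.Formula (Fin m ⊕ α)) (p : Fin m → M) :
    (Set.univ : Set M).Definable Λ {x : α → M | φ.Realize (Sum.elim p x)} := by
  refine Set.definable_iff_exists_formula_sum.2
    ⟨φ.relabel (Sum.map (fun i => ⟨p i, trivial⟩) id), ?_⟩
  ext x
  simp only [Set.mem_ofPred_eq, Formula.realize_relabel]
  refine iff_of_eq (congrArg _ ?_)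
  funext i
  rcases i with i | i <;> rfl

/-- A formula mentions only finitely many parameters, and these can be numbered; instances of a
scheme take their parameters from `Fin m`. -/
theorem exists_fin_params_of_definable {S : Set (α → M)}
    (h : (Set.univ : Set M).Definable Λ S) :
    ∃ (m : ℕ) (φ : Λ.Formula (Fin m ⊕ α)) (p : Fin m → M),
      S = {x | φ.Realize (Sum.elim p x)} := by
  obtain ⟨A, -, hA⟩ := Set.definable_iff_finitely_definable.1 h
  obtain ⟨φ, rfl⟩ := Set.definable_iff_exists_formula_sum.1 hA
  refine ⟨A.card, φ.relabel (Sum.map A.equivFin id), fun i => (A.equivFin.symm i).1, ?_⟩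
  ext x
  simp only [Set.mem_ofPred_eq, Formula.realize_relabel]
  refine iff_of_eq (congrArg _ ?_)
  funext i
  rcases i with i | i
  · simp
  · rfl

theorem empty_definable_of_realize {S : Set (α → M)} (φ : Λ.Formula α)
    (h : ∀ x, x ∈ S ↔ φ.Realize x) (A : Set M) : A.Definable Λ S :=
  (Set.empty_definable_iff.2 ⟨φ, Set.ext h⟩).mono (Set.empty_subset _)

end Definability

section Instances

variable {L : FirstOrder.Language.{u, v}} {k : ℕ} {β : Type} {A : Type w} [L.Structure A]

theorem realize_eraseTerm (S : Set (Fin k → A)) (p : β → A) {n : ℕ} (xs : Fin n → A)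
    (t : (L.sum (predLang k)).Term (Empty ⊕ Fin n)) :
    (eraseTerm t : L.Term (β ⊕ Fin n)).realize (Sum.elim p xs) =
      letI := predStructure S
      t.realize (Sum.elim default xs) := by
  let _ := predStructure S
  induction t with
  | var x =>
    rcases x with x | x
    · exact x.elim
    · rfl
  | func f ts ih =>
    rcases f with f | f
    · exact congrArg (Structure.funMap f) (funext ih)
    · exact Empty.elim f

theorem realize_substPred (φ : L.Formula (β ⊕ Fin k)) (p : β → A) {n : ℕ}
    (ψ : (L.sum (predLang k)).BoundedFormula Empty n) (xs : Fin n → A) :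
    (substPred φ ψ).Realize p xs ↔
      letI := predStructure {x | φ.Realize (Sum.elim p x)}
      ψ.Realize default xs := by
  let _ := predStructure {x | φ.Realize (Sum.elim p x)}
  have ht := fun (n : ℕ) (xs : Fin n → A) (t : (L.sum (predLang k)).Term (Empty ⊕ Fin n)) =>
    realize_eraseTerm (β := β) (L := L)
    {x | φ.Realize (Sum.elim p x)} p xs t
  induction ψ with
  | falsum => rfl
  | equal t₁ t₂ => exact Eq.congr (ht _ xs t₁) (ht _ xs t₂)
  | rel R ts =>
    rcases R with R | R
    · exact iff_of_eq (congrArg (Structure.RelMap R) (funext fun i => ht _ _ _))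
    · cases R
      rw [substPred, BoundedFormula.realize_relabel, BoundedFormula.realize_subst]
      have key : BoundedFormula.Realize (BoundedFormula.rel (Sum.inr PredSym.pred) ts) default xs ↔
          φ.Realize (Sum.elim p fun i => (ts i).realize (Sum.elim default xs)) := Iff.rfl
      refine Iff.trans ?_ key.symm
      rw [Formula.Realize]
      refine iff_of_eq (congrArg₂ _ (funext fun i => ?_) (Subsingleton.elim _ _))
      rcases i with i | i
      · rfl
      · exact ht _ _ _
  | imp ψ₁ ψ₂ ih₁ ih₂ => exact imp_congr (ih₁ _) (ih₂ _)
  | all ψ ih => exact forall_congr' fun a => ih _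

theorem realize_instance (τ : Scheme L) {m : ℕ} (φ : L.Formula (Fin m ⊕ Fin τ.arity)) :
    A ⊨ (Formula.iAlls (Fin m)
      (Formula.relabel (Sum.inr : Fin m → Empty ⊕ Fin m) (substPred φ τ.sentence)) :
        L.Sentence) ↔
      ∀ p : Fin m → A, τ.Holds A {x | φ.Realize (Sum.elim p x)} := by
  rw [Sentence.Realize, Formula.realize_iAlls]
  refine forall_congr' fun p => ?_
  rw [Formula.realize_relabel]
  exact realize_substPred φ p τ.sentence default

/-- Universal closure over the parameters amounts to quantifying over all parametrically definable
sets. With this, substitution can be forgotten. -/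
theorem models_instances_iff (τ : Scheme L) :
    A ⊨ τ.instances ↔ ∀ S, (Set.univ : Set A).Definable L S → τ.Holds A S := by
  rw [Theory.model_iff]
  constructor
  · intro h S hS
    obtain ⟨m, φ, p, rfl⟩ := exists_fin_params_of_definable hS
    exact (realize_instance τ φ).1 (h _ ⟨m, φ, rfl⟩) p
  · rintro h _ ⟨m, φ, rfl⟩
    exact (realize_instance τ φ).2 fun p => h _ (definable_of_fin_params φ p)

end Instances

/-! ### Eliminating symbols for definable relations -/

section ParamLang

variable {B : FirstOrder.Language.{u, v}} {Λ : FirstOrder.Language.{u', v'}} {M : Type w}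
  [B.Structure M] [Λ.Structure M] {X : SOPart M} {A : Set M}

theorem exists_term_of_paramLang (ι : B →ᴸ Λ) [ι.IsExpansionOn M] {γ : Type*}
    (t : (B.sum (paramLang X)).Term γ) :
    ∃ t' : Λ[[A]].Term γ, ∀ v : γ → M, t'.realize v = t.realize v := by
  induction t with
  | var x => exact ⟨Term.var x, fun _ => rfl⟩
  | func f ts ih =>
    rcases f with f | f
    · choose ts' h using ih
      refine ⟨Term.func (Sum.inl (ι.onFunction f)) ts', fun v => ?_⟩
      have := LHom.map_onFunction (ϕ := ι) (M := M) f (fun i => (ts i).realize v)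
      refine Eq.trans ?_ this
      exact congrArg (Structure.funMap (ι.onFunction f)) (funext fun i => h i v)
    · exact Empty.elim f

/-- Each symbol for a relation in `X` is replaced by a definition of that relation. The parameters
of these definitions are constants of `Λ[[A]]`, so the cases with and without parameters are treated
at once. -/
theorem exists_formula_of_paramLang (ι : B →ᴸ Λ) [ι.IsExpansionOn M]
    (hX : ∀ n, ∀ S ∈ X n, A.Definable Λ S) {γ : Type*} {n : ℕ}
    (φ : (B.sum (paramLang X)).BoundedFormula γ n) :
    ∃ ψ : Λ[[A]].BoundedFormula γ n, ∀ (v : γ → M) (xs : Fin n → M),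
      ψ.Realize v xs ↔ φ.Realize v xs := by
  induction φ with
  | falsum => exact ⟨BoundedFormula.falsum, fun _ _ => Iff.rfl⟩
  | equal t₁ t₂ =>
    obtain ⟨t₁', h₁⟩ := exists_term_of_paramLang (A := A) ι t₁
    obtain ⟨t₂', h₂⟩ := exists_term_of_paramLang (A := A) ι t₂
    exact ⟨BoundedFormula.equal t₁' t₂', fun v xs => Eq.congr (h₁ _) (h₂ _)⟩
  | rel R ts =>
    choose ts' h using fun i => exists_term_of_paramLang (A := A) ι (ts i)
    rcases R with R | R
    · refine ⟨BoundedFormula.rel (Sum.inl (ι.onRelation R)) ts', fun v xs => ?_⟩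
      have := LHom.map_onRelation (ϕ := ι) (M := M) R
        (fun i => (ts i).realize (Sum.elim v xs))
      refine Iff.trans ?_ (iff_of_eq this)
      exact iff_of_eq (congrArg (Structure.RelMap (ι.onRelation R)) (funext fun i => h i _))
    · obtain ⟨θ, hθ⟩ := hX _ R.1 R.2
      refine ⟨BoundedFormula.relabel (k := 0) id (BoundedFormula.subst θ ts'), fun v xs => ?_⟩
      rw [BoundedFormula.realize_relabel, BoundedFormula.realize_subst]
      have key : (fun i => (ts i).realize (Sum.elim v xs)) ∈ R.1 ↔
          θ.Realize fun i => (ts i).realize (Sum.elim v xs) := by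
        rw [hθ]
        rfl
      refine Iff.trans ?_ key.symm
      rw [Formula.Realize]
      refine iff_of_eq (congrArg₂ _ (funext fun i => h i _) (Subsingleton.elim _ _))
  | imp φ₁ φ₂ ih₁ ih₂ =>
    obtain ⟨ψ₁, h₁⟩ := ih₁
    obtain ⟨ψ₂, h₂⟩ := ih₂
    exact ⟨ψ₁.imp ψ₂, fun v xs => imp_congr (h₁ _ _) (h₂ _ _)⟩
  | all φ ih =>
    obtain ⟨ψ, h⟩ := ih
    exact ⟨ψ.all, fun v xs => forall_congr' fun a => h _ _⟩

/-- If all relations in `X` are `A`-definable, then so is every relation that is `A`-definable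
from them. -/
theorem definable_of_paramLang (ι : B →ᴸ Λ) [ι.IsExpansionOn M]
    (hX : ∀ n, ∀ S ∈ X n, A.Definable Λ S) {n : ℕ} {S : Set (Fin n → M)}
    (h : A.Definable (B.sum (paramLang X)) S) : A.Definable Λ S := by
  obtain ⟨φ, rfl⟩ := Set.definable_iff_exists_formula_sum.1 h
  obtain ⟨ψ, hψ⟩ := exists_formula_of_paramLang ι hX φ
  refine ⟨BoundedFormula.subst ψ (Sum.elim (fun a => (Λ.con a).term) Term.var), ?_⟩
  ext x
  change _ ↔ BoundedFormula.Realize _ _ _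
  rw [BoundedFormula.realize_subst]
  change φ.Realize _ ↔ _
  rw [Formula.Realize, ← hψ]
  refine iff_of_eq (congrArg (fun v => ψ.Realize v _) ?_)
  funext i
  rcases i with i | i
  · simp
  · rfl

end ParamLang

/-! ### Definable isomorphisms from standalone categoricity -/

section DuoModels

variable {L : FirstOrder.Language.{u, v}} {M : Type w} [L.Structure M]

omit [L.Structure M] in
theorem color_definable {Λ : FirstOrder.Language.{u', v'}} [Λ.Structure M] (N : InternalStr L M)
    (s : ∀ {n : ℕ}, ColorSym L n → Λ.Relations n)
    (hs : ∀ {n : ℕ} (S : ColorSym L n) (x : Fin n → M),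
      Structure.RelMap (s S) x ↔
        letI := colorStructure N
        Structure.RelMap (L := colorLang L) S x)
    (A : Set M) : N.MemIn fun _ => {S | A.Definable Λ S} := by
  refine ⟨?_, ?_, fun n R => ?_, fun n f => ?_⟩
  · exact empty_definable_of_realize ((s ColorSym.dom).formula Term.var)
      (fun x => (hs ColorSym.dom x).symm) A
  · exact empty_definable_of_realize ((s ColorSym.eq).formula Term.var)
      (fun x => (hs ColorSym.eq x).symm) A
  · exact empty_definable_of_realize ((s (ColorSym.rel R)).formula Term.var)
      (fun x => (hs (ColorSym.rel R) x).symm) A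
  · exact empty_definable_of_realize ((s (ColorSym.graph f)).formula Term.var)
      (fun x => (hs (ColorSym.graph f) x).symm) A

/-- What is defined without parameters from `A`-definable relations is again `A`-definable, so the
`A`-definable relations satisfy standalone comprehension. For `A = ∅`, comprehension with
first-order parameters would in general fail, which is why the standalone notion is the right
hypothesis. -/
theorem exists_definable_iso {τ : Scheme L}
    (hτ : Scheme.StandaloneCategoricalIn.{u, v, u, v, w} τ τ.instances) {R B : InternalStr L M}
    (h : ModelsDuoPlus τ R B) (A : Set M) :
    letI := duoStructure R B
    ∃ F : Set (Fin 2 → M), A.Definable (duoPlus L) F ∧ R.IsIso B F := by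
  let _ := duoStructure R B
  let X : SOPart M := fun n => {S | A.Definable (duoPlus L) S}
  have hX : ∀ n, X n ⊆ duoDef R B n := fun n S hS => Set.Definable.mono hS (Set.subset_univ _)
  have : (LHom.sumInl : L →ᴸ duoPlus L).IsExpansionOn M :=
    { map_onFunction := fun _ _ => rfl
      map_onRelation := fun _ _ => rfl }
  refine hτ M X h.1 (fun n S hS => ?_) R B ?_ ?_ (h.2.1.anti hX) (h.2.2.anti hX)
  · exact definable_of_paramLang (LHom.sumInl : L →ᴸ duoPlus L) (fun _ _ h => h)
      (hS.mono (Set.empty_subset A))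
  · exact color_definable (Λ := duoPlus L) R (fun S => Sum.inr (Sum.inl S)) (fun S x => Iff.rfl) A
  · exact color_definable (Λ := duoPlus L) B (fun S => Sum.inr (Sum.inr S)) (fun S x => Iff.rfl) A

theorem exists_formula_iso {τ : Scheme L}
    (hτ : Scheme.StandaloneCategoricalIn.{u, v, u, v, w} τ τ.instances) {R B : InternalStr L M}
    (h : ModelsDuoPlus τ R B) :
    ∃ α : (duoPlus L).Formula (Fin 2),
      R.IsIso B {z | @Formula.Realize (duoPlus L) M (duoStructure R B) (Fin 2) α z} := by
  let _ := duoStructure R B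
  obtain ⟨F, hF, hi⟩ := exists_definable_iso hτ h ∅
  obtain ⟨α, rfl⟩ := Set.empty_definable_iff.1 hF
  exact ⟨α, hi⟩

/-- On a one-point set the only nonempty binary relation is the full one. This covers the case in
which finiteness of the language cannot be deduced. -/
theorem isIso_top_of_subsingleton [Subsingleton M] {τ : Scheme L}
    (hτ : Scheme.StandaloneCategoricalIn.{u, v, u, v, w} τ τ.instances) {R B : InternalStr L M}
    (h : ModelsDuoPlus τ R B) :
    R.IsIso B {z | @Formula.Realize (duoPlus L) M (duoStructure R B) (Fin 2) ⊤ z} := by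
  let _ := duoStructure R B
  obtain ⟨F, hF, hi⟩ := exists_definable_iso hτ h ∅
  convert hi
  rw [InternalStr.isIso_iff] at hi
  ext z
  obtain ⟨a, ha⟩ := R.nonempty
  obtain ⟨b, hb⟩ := hi.total a ha
  have : z = ![a, b] := Subsingleton.elim _ _
  simp [this, hb]

end DuoModels

/-! ### Finiteness of the language -/

section Invariance

variable {L : FirstOrder.Language.{u, v}}

theorem Scheme.holds_congr (τ : Scheme L) {A : Type w} {B : Type w'} [L.Structure A]
    [L.Structure B] (e : A ≃[L] B) (T : Set (Fin τ.arity → B)) :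
    τ.Holds A {x | e ∘ x ∈ T} ↔ τ.Holds B T := by
  let _ : (predLang τ.arity).Structure A := predStructure {x | e ∘ x ∈ T}
  let _ : (predLang τ.arity).Structure B := predStructure T
  let e' : A ≃[L.sum (predLang τ.arity)] B :=
    { e.toEquiv with
      map_fun' := fun {n} f x => by
        rcases f with f | f
        · exact e.map_fun f x
        · exact Empty.elim f
      map_rel' := fun {n} R x => by
        rcases R with R | R
        · exact e.map_rel R x
        · cases R
          exact Iff.rfl }
  exact StrongHomClass.realize_sentence e' τ.sentence

theorem exists_finite_support_term {k n : ℕ} (t : (L.sum (predLang k)).Term (Empty ⊕ Fin n)) :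
    ∃ Φ : Set (Σ n, L.Functions n), Φ.Finite ∧
      ∀ (A : Type w) (S S' : L.Structure A) (T : Set (Fin k → A)),
        (∀ n f, ⟨n, f⟩ ∈ Φ → S.funMap (n := n) f = S'.funMap f) → ∀ v : Empty ⊕ Fin n → A,
          (@Term.realize _ A (@sumStructure _ _ A S (predStructure T)) _ v t) =
          (@Term.realize _ A (@sumStructure _ _ A S' (predStructure T)) _ v t) := by
  induction t with
  | var x => exact ⟨∅, Set.finite_empty, fun _ _ _ _ _ _ => rfl⟩
  | @func l f ts ih =>
    rcases f with f | f
    · choose Φ hΦ h using ih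
      refine ⟨insert ⟨l, f⟩ (⋃ i, Φ i), (Set.finite_iUnion hΦ).insert _, fun A S S' T hS v => ?_⟩
      have h1 : (fun i => @Term.realize _ A (@sumStructure _ _ A S (predStructure T)) _ v (ts i)) =
          fun i => @Term.realize _ A (@sumStructure _ _ A S' (predStructure T)) _ v (ts i) :=
        funext fun i => h i A S S' T (fun n g hg =>
          hS n g (Set.mem_insert_of_mem _ (Set.mem_iUnion.2 ⟨i, hg⟩))) v
      change S.funMap f _ = S'.funMap f _
      rw [h1, hS l f (Set.mem_insert _ _)]
    · exact Empty.elim f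

/-- Only the finitely many symbols that occur in `φ` matter, so the remaining symbols of `L` may be
reinterpreted without changing whether a scheme holds. -/
theorem exists_finite_support_formula {k n : ℕ}
    (φ : (L.sum (predLang k)).BoundedFormula Empty n) :
    ∃ (Φ : Set (Σ n, L.Functions n)) (P : Set (Σ n, L.Relations n)), Φ.Finite ∧ P.Finite ∧
      ∀ (A : Type w) (S S' : L.Structure A) (T : Set (Fin k → A)),
        (∀ n f, ⟨n, f⟩ ∈ Φ → S.funMap (n := n) f = S'.funMap f) →
        (∀ n R, ⟨n, R⟩ ∈ P → S.RelMap (n := n) R = S'.RelMap R) →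
        ∀ (v : Empty → A) (xs : Fin n → A),
          (@BoundedFormula.Realize _ A (@sumStructure _ _ A S (predStructure T)) _ _ φ v xs) ↔
          (@BoundedFormula.Realize _ A (@sumStructure _ _ A S' (predStructure T)) _ _ φ v xs) := by
  induction φ with
  | falsum => exact ⟨∅, ∅, Set.finite_empty, Set.finite_empty, fun _ _ _ _ _ _ _ _ => Iff.rfl⟩
  | equal t₁ t₂ =>
    obtain ⟨Φ₁, h₁, H₁⟩ := exists_finite_support_term.{u, v, w} t₁
    obtain ⟨Φ₂, h₂, H₂⟩ := exists_finite_support_term.{u, v, w} t₂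
    refine ⟨Φ₁ ∪ Φ₂, ∅, h₁.union h₂, Set.finite_empty, fun A S S' T hf _ v xs => ?_⟩
    exact Eq.congr (H₁ A S S' T (fun n f h => hf n f (Or.inl h)) _)
      (H₂ A S S' T (fun n f h => hf n f (Or.inr h)) _)
  | @rel n l R ts =>
    choose Φ h H using fun i => exists_finite_support_term.{u, v, w} (ts i)
    rcases R with R | R
    · refine ⟨⋃ i, Φ i, {⟨l, R⟩}, Set.finite_iUnion h, Set.finite_singleton _,
        fun A S S' T hf hr v xs => ?_⟩
      have h1 := funext fun i => H i A S S' T (fun n g hg =>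
          hf n g (Set.mem_iUnion.2 ⟨i, hg⟩)) (Sum.elim v xs)
      change S.RelMap R _ ↔ S'.RelMap R _
      rw [h1, hr l R rfl]
    · refine ⟨⋃ i, Φ i, ∅, Set.finite_iUnion h, Set.finite_empty,
        fun A S S' T hf hr v xs => ?_⟩
      have h1 := funext fun i => H i A S S' T (fun n g hg =>
          hf n g (Set.mem_iUnion.2 ⟨i, hg⟩)) (Sum.elim v xs)
      cases R
      change _ ∈ T ↔ _ ∈ T
      rw [h1]
  | imp φ₁ φ₂ ih₁ ih₂ =>
    obtain ⟨Φ₁, P₁, h₁, k₁, H₁⟩ := ih₁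
    obtain ⟨Φ₂, P₂, h₂, k₂, H₂⟩ := ih₂
    refine ⟨Φ₁ ∪ Φ₂, P₁ ∪ P₂, h₁.union h₂, k₁.union k₂, fun A S S' T hf hr v xs => ?_⟩
    exact imp_congr (H₁ A S S' T (fun n f h => hf n f (Or.inl h)) (fun n f h => hr n f (Or.inl h)) _ _)
      (H₂ A S S' T (fun n f h => hf n f (Or.inr h)) (fun n f h => hr n f (Or.inr h)) _ _)
  | all φ ih =>
    obtain ⟨Φ, P, h, k, H⟩ := ih
    exact ⟨Φ, P, h, k, fun A S S' T hf hr v xs => forall_congr' fun a => H A S S' T hf hr _ _⟩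

end Invariance

section OfStructure

variable {L : FirstOrder.Language.{u, v}} {M : Type w}

variable [Nonempty M]

/-- A structure on the whole of `M`, as an internal structure with the identity as equality. -/
def InternalStr.ofStructure (S : L.Structure M) : InternalStr L M where
  dom := Set.univ
  eq := {x | x 0 = x 1}
  rel := fun R => {x | S.RelMap R x}
  graph := fun {n} f => {x | S.funMap f (fun i => x (Fin.castSucc i)) = x (Fin.last n)}
  nonempty := ⟨Classical.arbitrary M, trivial⟩
  eq_refl := fun _ _ => rfl
  eq_symm := fun _ _ _ _ h => Eq.symm h
  eq_trans := fun _ _ _ _ _ _ h h' => Eq.trans h h'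
  rel_congr := fun R x y _ _ h hx => by
    have : x = y := funext h
    rwa [← this]
  graph_congr := fun f x y _ _ h hx => by
    have : x = y := funext h
    rwa [← this]
  graph_total := fun f x _ => ⟨S.funMap f x, trivial, by simp⟩
  graph_unique := fun f x b c _ _ _ hb hc => by
    simp only [Set.mem_ofPred_eq, Fin.snoc_castSucc, Fin.snoc_last] at hb hc
    exact hb.symm.trans hc

/-- The elements of `ofStructure S` are the elements of `M`. -/
noncomputable def InternalStr.ofStructureEquiv (S : L.Structure M) :
    @Language.Equiv L M (InternalStr.ofStructure S).Elem S _ :=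
  letI N := InternalStr.ofStructure S
  letI f : M → N.Elem := fun a => N.toElem ⟨a, trivial⟩
  { Equiv.ofBijective f
      ⟨fun a b h => N.toElem_eq.1 h, fun q => by
        obtain ⟨a, rfl⟩ := N.exists_toElem q
        exact ⟨a.1, rfl⟩⟩ with
    map_fun' := fun {n} g x => by
      refine ((N.funMap_toElem g (fun i => ⟨x i, trivial⟩) ⟨S.funMap g x, trivial⟩).2 ?_).symm
      change S.funMap g _ = _
      simp
    map_rel' := fun {n} R x => N.relMap_toElem R (fun i => ⟨x i, trivial⟩) }

theorem InternalStr.pullback_ofStructure (S : L.Structure M) {k : ℕ}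
    (T : Set (Fin k → (ofStructure S).Elem)) :
    (ofStructure S).pullback T = {x | ofStructureEquiv S ∘ x ∈ T} := by
  ext x
  exact ⟨fun ⟨_, h⟩ => h, fun h => ⟨fun _ => trivial, h⟩⟩

end OfStructure

section Finiteness

variable {L : FirstOrder.Language.{u, v}} {M : Type w}

theorem exists_equiv_of_language_equiv (S : Bool → L.Structure M)
    (e : @Language.Equiv L M M (S false) (S true)) :
    ∃ e : M ≃ M, (∀ {n : ℕ} (f : L.Functions n) (x : Fin n → M),
        e ((S false).funMap f x) = (S true).funMap f (e ∘ x)) ∧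
      ∀ {n : ℕ} (R : L.Relations n) (x : Fin n → M),
        (S true).RelMap R (e ∘ x) ↔ (S false).RelMap R x :=
  ⟨@Language.Equiv.toEquiv L M M (S false) (S true) e,
    @Language.Equiv.map_fun' L M M (S false) (S true) e,
    @Language.Equiv.map_rel' L M M (S false) (S true) e⟩

/-- Two structures on a model of all instances of `τ` that are definable in it and agree with it
on the symbols of `τ` are isomorphic if `τ` is standalone categorical. -/
theorem nonempty_equiv_of_definable [Nonempty M] [L.Structure M] {τ : Scheme L}
    (hτ : Scheme.StandaloneCategoricalIn.{u, v, u, v, w} τ τ.instances)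
    (hM : M ⊨ τ.instances) (S : Bool → L.Structure M)
    (hrel : ∀ b (n : ℕ) (R : L.Relations n), (Set.univ : Set M).Definable L {x | (S b).RelMap R x})
    (hgraph : ∀ b (n : ℕ) (f : L.Functions n), (Set.univ : Set M).Definable L
        {x : Fin (n + 1) → M | (S b).funMap f (fun i => x (Fin.castSucc i)) = x (Fin.last n)})
    (hS : ∀ b T, τ.Holds M T → @Scheme.Holds L τ M (S b) T) :
    Nonempty (@Language.Equiv L M M (S false) (S true)) := by
  -- The new structures are strong for the definable relations of `M`, because `M` itself satisfies
  -- `τ` for each of these relations.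
  let X : SOPart M := fun n => {Y | (Set.univ : Set M).Definable L Y}
  have hd : (Set.univ : Set M).Definable L {x : Fin 2 → M | x 0 = x 1} :=
    empty_definable_of_realize ((Term.var 0).equal (Term.var 1)) (fun x => by simp) _
  have hmem : ∀ b, (InternalStr.ofStructure (S b)).MemIn X :=
    fun b => ⟨Set.definable_univ, hd, hrel b, hgraph b⟩
  have hstr : ∀ b, (InternalStr.ofStructure (S b)).Strong X τ := by
    intro b T hT
    rw [InternalStr.pullback_ofStructure] at hT
    refine (@Scheme.holds_congr L τ M _ (S b) _ (InternalStr.ofStructureEquiv (S b)) T).1 ?_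
    exact hS b _ ((models_instances_iff τ).1 hM _ hT)
  have : (LHom.id L).IsExpansionOn M :=
    { map_onFunction := fun _ _ => rfl
      map_onRelation := fun _ _ => rfl }
  obtain ⟨F, -, e, -⟩ := hτ M X hM (fun n Y hY => definable_of_paramLang (LHom.id L)
    (fun _ _ h => h) (hY.mono (Set.empty_subset _))) _ _ (hmem false) (hmem true)
    (hstr false) (hstr true)
  have e₀ := InternalStr.ofStructureEquiv (S false)
  have e₁ := InternalStr.ofStructureEquiv (S true)
  exact ⟨@Language.Equiv.comp L M _ (S false) _ M (S true) (@Language.Equiv.symm L M _ (S true) _ e₁)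
    (@Language.Equiv.comp L M _ (S false) _ _ _ e e₀)⟩

/-- Symbols outside a finite support of `τ` are interpreted in two ways: relations as empty or full,
functions as the first projection (the constant `a` in arity zero) or as constants with prescribed
values. Categoricity makes the two structures isomorphic. So no relation lies outside the support;
no function of positive arity does, since a bijection would be constant; and no two constants do,
since they are equal in one structure and can be made different in the other. -/
theorem finite_symbols_of_nontrivial [Nontrivial M] [L.Structure M] {τ : Scheme L}
    (hτ : Scheme.StandaloneCategoricalIn.{u, v, u, v, w} τ τ.instances)
    (hM : M ⊨ τ.instances) : Finite (Σ n, L.Functions n) ∧ Finite (Σ n, L.Relations n) := by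
  classical
  obtain ⟨Φ, P, hΦ, hP, H⟩ := exists_finite_support_formula.{u, v, w} τ.sentence
  obtain ⟨a, b, hab⟩ := exists_pair_ne M
  -- The clause ending in `False` records that an isomorphism cannot carry an empty relation to a
  -- full one.
  have key : ∀ g : (Σ n, L.Functions n) → M,
      ∃ e : M ≃ M, (∀ s ∈ Pᶜ, False) ∧ ∀ s ∈ Φᶜ, ∀ x : Fin s.1 → M,
        e (if h : s.1 = 0 then a else x ⟨0, Nat.pos_of_ne_zero h⟩) = g s := by
    intro g
    let S : Bool → L.Structure M := fun c =>
      { funMap := fun {n} f x => if ⟨n, f⟩ ∈ Φ then Structure.funMap f x else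
          match c with
          | false => if h : n = 0 then a else x ⟨0, Nat.pos_of_ne_zero h⟩
          | true => g ⟨n, f⟩
        RelMap := fun {n} R x => if ⟨n, R⟩ ∈ P then Structure.RelMap R x else
          match c with
          | false => False
          | true => True }
    have hSf : ∀ c {n : ℕ} (f : L.Functions n) x, (S c).funMap f x =
        if ⟨n, f⟩ ∈ Φ then Structure.funMap f x else
          match c with
          | false => if h : n = 0 then a else x ⟨0, Nat.pos_of_ne_zero h⟩
          | true => g ⟨n, f⟩ := fun _ _ _ _ => rfl
    have hSr : ∀ c {n : ℕ} (R : L.Relations n) x, (S c).RelMap R x =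
        if ⟨n, R⟩ ∈ P then Structure.RelMap R x else
          match c with
          | false => False
          | true => True := fun _ _ _ _ => rfl
    have he : Nonempty (@Language.Equiv L M M (S false) (S true)) := by
      refine nonempty_equiv_of_definable hτ hM S ?_ ?_ ?_
      · intro c n R
        by_cases h : (⟨n, R⟩ : Σ n, L.Relations n) ∈ P
        · simp only [hSr, if_pos h]
          exact empty_definable_of_realize (R.formula Term.var) (fun x => Iff.rfl) _
        · simp only [hSr, if_neg h]
          cases c
          · exact Set.definable_empty
          · exact Set.definable_univ
      · intro c n f
        by_cases h : (⟨n, f⟩ : Σ n, L.Functions n) ∈ Φ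
        · simp only [hSf, if_pos h]
          exact empty_definable_of_realize ((Term.func f fun i => Term.var (Fin.castSucc i)).equal
            (Term.var (Fin.last n))) (fun x => by simp) _
        · simp only [hSf, if_neg h]
          have hc : ∀ d : M, (Set.univ : Set M).Definable L
              {x : Fin (n + 1) → M | d = x (Fin.last n)} := fun d => by
            have := definable_of_fin_params (α := Fin (n + 1)) (Λ := L) (m := 1)
              ((Term.var (Sum.inl 0)).equal (Term.var (Sum.inr (Fin.last n)))) (fun _ => d)
            simpa using this
          cases c
          · by_cases hn : n = 0
            · simp only [hn, dif_pos]
              subst hn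
              exact hc a
            · simp only [hn]
              exact empty_definable_of_realize
                ((Term.var (Fin.castSucc ⟨0, Nat.pos_of_ne_zero hn⟩)).equal
                (Term.var (Fin.last n))) (fun x => by simp) _
          · exact hc _
      · intro c T hT
        refine (H M _ (S c) T (fun n f h => ?_) (fun n R h => ?_) _ _).1 hT
        · funext x
          simp only [hSf, if_pos h]
        · funext x
          simp only [hSr, if_pos h]
    obtain ⟨e, hf, hr⟩ := exists_equiv_of_language_equiv S he.some
    refine ⟨e, fun s hs => ?_, fun s hs x => ?_⟩
    · have := ((iff_of_eq (hSr true s.2 _)).symm.trans (hr s.2 (fun _ => a))).trans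
        (iff_of_eq (hSr false s.2 _))
      rw [if_neg hs, if_neg hs] at this
      exact this.1 trivial
    · have := ((congrArg e (hSf false s.2 x)).symm.trans (hf s.2 x)).trans (hSf true s.2 _)
      rw [if_neg hs, if_neg hs] at this
      exact this
  have hP' : Pᶜ = ∅ := by
    obtain ⟨e, h, -⟩ := key fun _ => a
    exact Set.eq_empty_iff_forall_notMem.2 h
  have hΦ' : Φᶜ.Subsingleton := by
    intro s hs t ht
    by_contra hst
    obtain ⟨e, -, h⟩ := key fun r => if r = s then a else b
    have h1 : ∀ r ∈ Φᶜ, r.1 = 0 := by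
      intro r hr
      by_contra h0
      have k1 := h r hr (fun _ => a)
      have k2 := h r hr (fun _ => b)
      simp only [h0, dif_neg, not_false_eq_true] at k1 k2
      exact hab (e.injective (k1.trans k2.symm))
    have k1 := h s hs (fun _ => a)
    have k2 := h t ht (fun _ => a)
    rw [dif_pos (h1 _ ‹_›)] at k1 k2
    rw [k1] at k2
    rw [if_pos rfl, if_neg (Ne.symm hst)] at k2
    exact hab k2
  constructor
  · rw [← Set.finite_univ_iff, ← Set.union_compl_self Φ]
    exact hΦ.union hΦ'.finite
  · rw [← Set.finite_univ_iff, ← Set.union_compl_self P, hP', Set.union_empty]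
    exact hP

end Finiteness

theorem comp_vec₁ {α β : Type*} (f : α → β) (a : α) : f ∘ ![a] = ![f a] := by
  funext i
  fin_cases i
  rfl

theorem comp_vec₂ {α β : Type*} (f : α → β) (a b : α) : f ∘ ![a, b] = ![f a, f b] := by
  funext i
  fin_cases i <;> rfl

/-! ### First-order descriptions of internal structures -/

section Closure

variable {Λ : FirstOrder.Language.{u, v}} {A : Type w} [Λ.Structure A]

/-- The universal closure of a formula. -/
noncomputable def closeF {α : Type} [Finite α] (φ : Λ.Formula α) : Λ.Sentence :=
  Formula.iAlls α (φ.relabel (Sum.inr : α → Empty ⊕ α))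

theorem realize_closeF {α : Type} [Finite α] (φ : Λ.Formula α) :
    A ⊨ closeF φ ↔ ∀ v : α → A, φ.Realize v := by
  rw [closeF, Sentence.Realize, Formula.realize_iAlls]
  refine forall_congr' fun v => ?_
  rw [Formula.realize_relabel]
  rfl

end Closure

section Interprets

variable {L : FirstOrder.Language.{u, v}} {Λ : FirstOrder.Language.{u', v'}}
  (s : ∀ n : ℕ, ColorSym L n → Λ.Relations n)

/-- The symbols `s` of a `Λ`-structure are interpreted by the relations of `N`. -/
def Interprets {A : Type w} [Λ.Structure A] (N : InternalStr L A) : Prop :=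
  ∀ (n : ℕ) (S : ColorSym L n) (x : Fin n → A),
    Structure.RelMap (s n S) x ↔
      letI := colorStructure N
      Structure.RelMap (L := colorLang L) S x

variable {s}

namespace Interprets

variable {A : Type w} [Λ.Structure A] {N : InternalStr L A} (h : Interprets s N)

include h

theorem dom (x : Fin 1 → A) : Structure.RelMap (s _ ColorSym.dom) x ↔ x ∈ N.dom :=
  h _ ColorSym.dom x

theorem eq (x : Fin 2 → A) : Structure.RelMap (s _ ColorSym.eq) x ↔ x ∈ N.eq :=
  h _ ColorSym.eq x

theorem rel {n : ℕ} (R : L.Relations n) (x : Fin n → A) :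
    Structure.RelMap (s _ (ColorSym.rel R)) x ↔ x ∈ N.rel R :=
  h _ (ColorSym.rel R) x

theorem graph {n : ℕ} (f : L.Functions n) (x : Fin (n + 1) → A) :
    Structure.RelMap (s _ (ColorSym.graph f)) x ↔ x ∈ N.graph f :=
  h _ (ColorSym.graph f) x

end Interprets

variable (s)

/-- The formula expressing that a variable lies in the domain. -/
def domF {α : Type} (a : α) : Λ.Formula α := (s 1 ColorSym.dom).formula₁ (Term.var a)

/-- The formula expressing that two variables are equal in the internal structure. -/
def eqF {α : Type} (a b : α) : Λ.Formula α :=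
  (s 2 ColorSym.eq).formula₂ (Term.var a) (Term.var b)

variable {s}

theorem Interprets.realize_domF {A : Type w} [Λ.Structure A] {N : InternalStr L A}
    (h : Interprets s N) {α : Type} (a : α) (v : α → A) :
    (domF s a).Realize v ↔ ![v a] ∈ N.dom := by
  rw [domF, Formula.realize_rel₁, ← h.dom]
  rfl

theorem Interprets.realize_eqF {A : Type w} [Λ.Structure A] {N : InternalStr L A}
    (h : Interprets s N) {α : Type} (a b : α) (v : α → A) :
    (eqF s a b).Realize v ↔ ![v a, v b] ∈ N.eq := by
  rw [eqF, Formula.realize_rel₂, ← h.eq]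
  rfl

/-- Functions of `N` are given by graphs, so a term becomes a formula saying that its value is named
by `b`, with the intermediate values quantified over the domain. -/
theorem exists_term_translation {k n : ℕ} (t : (L.sum (predLang k)).Term (Empty ⊕ Fin n)) :
    ∃ θ : Λ.Formula (Fin n ⊕ Unit), ∀ (A : Type w) [Λ.Structure A] (N : InternalStr L A),
      Interprets s N → ∀ (T : Set (Fin k → N.Elem)) (a : Fin n → N.Dom) (b : N.Dom),
        θ.Realize (Sum.elim (fun i => (a i).1) (fun _ => b.1)) ↔
          (letI := predStructure T
           t.realize (Sum.elim default (fun i => N.toElem (a i)))) = N.toElem b := by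
  induction t with
  | var x =>
    rcases x with x | x
    · exact x.elim
    · refine ⟨eqF s (Sum.inl x) (Sum.inr ()), fun A _ N h T a b => ?_⟩
      rw [h.realize_eqF]
      exact N.toElem_eq.symm
  | @func l f ts ih =>
    rcases f with f | f
    · choose θ hθ using ih
      refine ⟨Formula.iExs (Fin l) ((Formula.iInf fun i =>
        domF s (Sum.inr i) ⊓ (θ i).relabel (Sum.elim (fun j => Sum.inl (Sum.inl j))
          (fun _ => Sum.inr i))) ⊓ (s _ (ColorSym.graph f)).formula
            (fun j => Term.var (Fin.lastCases (Sum.inl (Sum.inr ())) (fun i => Sum.inr i) j))),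
        fun A _ N h T a b => ?_⟩
      let _ := predStructure T
      simp only [Formula.realize_iExs, Formula.realize_inf, Formula.realize_iInf, h.realize_domF,
        Formula.realize_relabel, Formula.realize_rel, h.graph, Sum.elim_inr]
      have e : ∀ c : Fin l → A, (fun j => (Term.var (L := Λ)
          (Fin.lastCases (motive := fun _ => (Fin n ⊕ Unit) ⊕ Fin l)
            (Sum.inl (Sum.inr ())) (fun i => Sum.inr i) j)).realize
          (Sum.elim (Sum.elim (fun i => (a i).1) (fun _ => b.1)) c)) =
            (Fin.snoc c b.1 : Fin (l + 1) → A) := by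
        intro c
        funext j
        refine Fin.lastCases ?_ (fun j => ?_) j <;> simp
      have e' : ∀ (c : Fin l → A) i, (Sum.elim (Sum.elim (fun i => (a i).1) (fun _ : Unit => b.1)) c) ∘
          (Sum.elim (fun j => Sum.inl (Sum.inl j)) (fun _ => Sum.inr i)) =
            Sum.elim (fun i => (a i).1) (fun _ : Unit => c i) := by
        intro c i
        funext j
        rcases j with j | j <;> rfl
      simp only [e, e']
      obtain ⟨c, hc⟩ := N.exists_toElem_tuple
        (fun i => (ts i).realize (Sum.elim default (fun i => N.toElem (a i))))
      have hf : (Term.func (Sum.inl f) ts).realize (Sum.elim default (fun i => N.toElem (a i))) =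
          Structure.funMap f (fun i => N.toElem (c i)) := by
        rw [hc]
        rfl
      rw [hf, N.funMap_toElem]
      constructor
      · rintro ⟨d, hd, hg⟩
        have key : ∀ i, ![d i, (c i).1] ∈ N.eq := by
          intro i
          have := (hθ i A N h T a ⟨d i, (hd i).1⟩).1 (hd i).2
          exact N.toElem_eq.1 (this.symm.trans (congrFun hc i).symm)
        refine N.graph_congr f _ _ (fun i => ?_) (fun i => ?_) (fun i => ?_) hg
        · refine Fin.lastCases ?_ (fun i => ?_) i
          · simpa using b.2
          · simpa using (hd i).1
        · refine Fin.lastCases ?_ (fun i => ?_) i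
          · simpa using b.2
          · simpa using (c i).2
        · refine Fin.lastCases ?_ (fun i => ?_) i
          · simpa using N.eq_refl _ b.2
          · simpa using key i
      · intro hg
        exact ⟨fun i => (c i).1, fun i => ⟨(c i).2,
          (hθ i A N h T a (c i)).2 (congrFun hc i).symm⟩, hg⟩
    · exact Empty.elim f

theorem InternalStr.mem_pullback_dom {A : Type w} (N : InternalStr L A) {k : ℕ}
    (T : Set (Fin k → N.Elem)) (a : Fin k → N.Dom) :
    (fun i => (a i).1) ∈ N.pullback T ↔ (fun i => N.toElem (a i)) ∈ T :=
  ⟨fun ⟨_, h⟩ => h, fun h => ⟨fun i => (a i).2, h⟩⟩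

theorem InternalStr.pullback_congr {A : Type w} (N : InternalStr L A) {k : ℕ}
    (T : Set (Fin k → N.Elem)) (x y : Fin k → A) (hy : ∀ i, ![y i] ∈ N.dom)
    (h : ∀ i, ![x i, y i] ∈ N.eq) (hx : x ∈ N.pullback T) : y ∈ N.pullback T := by
  obtain ⟨hd, hx⟩ := hx
  refine ⟨hy, ?_⟩
  convert hx using 2 with i
  exact (N.toElem_eq.2 (h i)).symm

theorem InternalStr.exists_pullback {A : Type w} (N : InternalStr L A) {k : ℕ}
    (S : Set (Fin k → A)) (hS : ∀ x ∈ S, ∀ i, ![x i] ∈ N.dom)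
    (hS' : ∀ x y, (∀ i, ![y i] ∈ N.dom) → (∀ i, ![x i, y i] ∈ N.eq) → x ∈ S → y ∈ S) :
    ∃ T : Set (Fin k → N.Elem), N.pullback T = S := by
  refine ⟨{q | ∃ a : Fin k → N.Dom, (fun i => N.toElem (a i)) = q ∧ (fun i => (a i).1) ∈ S}, ?_⟩
  ext x
  constructor
  · rintro ⟨hx, a, ha, haS⟩
    exact hS' _ _ hx (fun i => N.toElem_eq.1 (congrFun ha i)) haS
  · intro hx
    exact ⟨hS x hx, fun i => ⟨x i, hS x hx i⟩, rfl, hx⟩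

/-- Quantifiers are relativised to the domain and `P` is replaced by `φ`. An atom is read as saying
that some representatives of the values of its terms satisfy it; by invariance the choice of
representatives does not matter. -/
theorem exists_formula_translation {k n : ℕ} {β : Type} (φ : Λ.Formula (β ⊕ Fin k))
    (ψ : (L.sum (predLang k)).BoundedFormula Empty n) :
    ∃ χ : Λ.Formula (β ⊕ Fin n), ∀ (A : Type w) [Λ.Structure A] (N : InternalStr L A),
      Interprets s N → ∀ (T : Set (Fin k → N.Elem)) (p : β → A),
        N.pullback T = {x | φ.Realize (Sum.elim p x)} → ∀ a : Fin n → N.Dom,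
          χ.Realize (Sum.elim p fun i => (a i).1) ↔
            letI := predStructure T
            ψ.Realize default (fun i => N.toElem (a i)) := by
  induction ψ with
  | falsum => exact ⟨⊥, fun _ _ _ _ _ _ _ _ => Iff.rfl⟩
  | @equal n t₁ t₂ =>
    obtain ⟨θ₁, h₁⟩ := exists_term_translation.{u, v, u', v', w} (s := s) t₁
    obtain ⟨θ₂, h₂⟩ := exists_term_translation.{u, v, u', v', w} (s := s) t₂
    refine ⟨Formula.iExs Unit (domF s (Sum.inr ()) ⊓ (θ₁.relabel (Sum.map Sum.inr id) ⊓
      θ₂.relabel (Sum.map Sum.inr id))), fun A _ N h T p hT a => ?_⟩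
    let _ := predStructure T
    simp only [Formula.realize_iExs, Formula.realize_inf, h.realize_domF,
      Formula.realize_relabel, Sum.elim_inr]
    have e : ∀ c : Unit → A, (Sum.elim (Sum.elim p fun i => (a i).1) c) ∘
        (Sum.map Sum.inr id) = Sum.elim (fun i => (a i).1) (fun _ => c ()) := by
      intro c
      funext j
      rcases j with j | j <;> rfl
    simp only [e]
    obtain ⟨b, hb⟩ := N.exists_toElem (t₁.realize (Sum.elim default (fun i => N.toElem (a i))))
    constructor
    · rintro ⟨c, hc, k₁, k₂⟩
      exact ((h₁ A N h T a ⟨_, hc⟩).1 k₁).trans ((h₂ A N h T a ⟨_, hc⟩).1 k₂).symm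
    · intro heq
      exact ⟨fun _ => b.1, b.2, (h₁ A N h T a b).2 hb.symm,
        (h₂ A N h T a b).2 (heq.symm.trans hb.symm)⟩
  | @rel n l R ts =>
    choose θ hθ using fun i => exists_term_translation.{u, v, u', v', w} (s := s) (ts i)
    have main : ∀ ρ : Λ.Formula (β ⊕ Fin l), ∃ χ : Λ.Formula (β ⊕ Fin n),
        ∀ (A : Type w) [Λ.Structure A] (N : InternalStr L A),
        Interprets s N → ∀ (T : Set (Fin k → N.Elem)) (p : β → A) (a : Fin n → N.Dom),
          χ.Realize (Sum.elim p fun i => (a i).1) ↔ ∃ c : Fin l → N.Dom,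
            (∀ i, (letI := predStructure T
              (ts i).realize (Sum.elim default (fun i => N.toElem (a i)))) = N.toElem (c i)) ∧
            ρ.Realize (Sum.elim p fun i => (c i).1) := by
      intro ρ
      refine ⟨Formula.iExs (Fin l) ((Formula.iInf fun i =>
        domF s (Sum.inr i) ⊓ (θ i).relabel (Sum.elim (fun j => Sum.inl (Sum.inr j))
          (fun _ => Sum.inr i))) ⊓ ρ.relabel (Sum.map Sum.inl id)),
        fun A _ N h T p a => ?_⟩
      simp only [Formula.realize_iExs, Formula.realize_inf, Formula.realize_iInf, h.realize_domF,
        Formula.realize_relabel, Sum.elim_inr]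
      have e : ∀ c : Fin l → A, (Sum.elim (Sum.elim p fun i => (a i).1) c) ∘
          (Sum.map Sum.inl id) = Sum.elim p c := by
        intro c
        funext j
        rcases j with j | j <;> rfl
      have e' : ∀ (c : Fin l → A) i, (Sum.elim (Sum.elim p fun i => (a i).1) c) ∘
          (Sum.elim (fun j => Sum.inl (Sum.inr j)) (fun _ => Sum.inr i)) =
            Sum.elim (fun i => (a i).1) (fun _ : Unit => c i) := by
        intro c i
        funext j
        rcases j with j | j <;> rfl
      simp only [e, e']
      constructor
      · rintro ⟨c, hc, hρ⟩
        exact ⟨fun i => ⟨c i, (hc i).1⟩, fun i => (hθ i A N h T a _).1 (hc i).2, hρ⟩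
      · rintro ⟨c, hc, hρ⟩
        exact ⟨fun i => (c i).1, fun i => ⟨(c i).2, (hθ i A N h T a _).2 (hc i)⟩, hρ⟩
    rcases R with R | R
    · obtain ⟨χ, hχ⟩ := main ((s _ (ColorSym.rel R)).formula fun i => Term.var (Sum.inr i))
      refine ⟨χ, fun A _ N h T p hT a => ?_⟩
      rw [hχ A N h T p a]
      let _ := predStructure T
      obtain ⟨c, hc⟩ := N.exists_toElem_tuple
        (fun i => (ts i).realize (Sum.elim default (fun i => N.toElem (a i))))
      change _ ↔ Structure.RelMap R
        (fun i => (ts i).realize (Sum.elim default (fun i => N.toElem (a i))))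
      constructor
      · rintro ⟨d, hd, hr⟩
        rw [funext hd, N.relMap_toElem]
        rwa [Formula.realize_rel, h.rel] at hr
      · rw [← hc, N.relMap_toElem]
        intro hr
        refine ⟨c, fun i => (congrFun hc i).symm, ?_⟩
        rwa [Formula.realize_rel, h.rel]
    · cases R
      obtain ⟨χ, hχ⟩ := main φ
      refine ⟨χ, fun A _ N h T p hT a => ?_⟩
      rw [hχ A N h T p a]
      let _ := predStructure T
      obtain ⟨c, hc⟩ := N.exists_toElem_tuple
        (fun i => (ts i).realize (Sum.elim default (fun i => N.toElem (a i))))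
      have hT' : ∀ c : Fin _ → N.Dom, φ.Realize (Sum.elim p fun i => (c i).1) ↔
          (fun i => N.toElem (c i)) ∈ T := fun c => by
        rw [← N.mem_pullback_dom, hT]
        rfl
      change _ ↔ (fun i => (ts i).realize (Sum.elim default (fun i => N.toElem (a i)))) ∈ T
      constructor
      · rintro ⟨d, hd, hr⟩
        rw [funext hd]
        exact (hT' d).1 hr
      · rw [← hc]
        intro hr
        exact ⟨c, fun i => (congrFun hc i).symm, (hT' c).2 hr⟩
  | imp ψ₁ ψ₂ ih₁ ih₂ =>
    obtain ⟨χ₁, h₁⟩ := ih₁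
    obtain ⟨χ₂, h₂⟩ := ih₂
    refine ⟨χ₁.imp χ₂, fun A _ N h T p hT a => ?_⟩
    rw [Formula.realize_imp]
    exact imp_congr (h₁ A N h T p hT a) (h₂ A N h T p hT a)
  | @all n ψ ih =>
    obtain ⟨χ, hχ⟩ := ih
    refine ⟨Formula.iAlls Unit ((domF s (Sum.inr ())).imp (χ.relabel (Sum.elim
      (fun j => Sum.inl (Sum.inl j)) (fun j => Fin.lastCases (Sum.inr ())
        (fun i => Sum.inl (Sum.inr i)) j)))), fun A _ N h T p hT a => ?_⟩
    let _ := predStructure T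
    simp only [Formula.realize_iAlls, Formula.realize_imp, h.realize_domF,
      Formula.realize_relabel, Sum.elim_inr]
    have e : ∀ (c : Unit → A) (b : N.Dom), c () = b.1 →
        (Sum.elim (Sum.elim p fun i => (a i).1) c) ∘ (Sum.elim
        (fun j => Sum.inl (Sum.inl j)) (fun j => Fin.lastCases (Sum.inr ())
        (fun i => Sum.inl (Sum.inr i)) j)) =
        Sum.elim p (fun i => ((Fin.snoc a b : Fin (n + 1) → N.Dom) i).1) := by
      intro c b hc
      funext j
      rcases j with j | j
      · rfl
      · refine Fin.lastCases ?_ (fun j => ?_) j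
        · simp only [Function.comp_apply, Sum.elim_inr, Fin.lastCases_last, Fin.snoc_last, hc]
        · simp only [Function.comp_apply, Sum.elim_inr, Fin.lastCases_castSucc, Sum.elim_inl,
            Fin.snoc_castSucc]
    have e' : ∀ b : N.Dom, (fun i => N.toElem ((Fin.snoc a b : Fin (n + 1) → N.Dom) i)) =
        Fin.snoc (fun i => N.toElem (a i)) (N.toElem b) := by
      intro b
      funext j
      refine Fin.lastCases ?_ (fun j => ?_) j <;> simp
    constructor
    · intro H q
      obtain ⟨b, rfl⟩ := N.exists_toElem q
      have := H (fun _ => b.1) b.2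
      rw [e _ b rfl, hχ A N h T p hT, e'] at this
      exact this
    · intro H c hc
      obtain ⟨b, hb⟩ : ∃ b : N.Dom, c () = b.1 := ⟨⟨_, hc⟩, rfl⟩
      rw [e c b hb, hχ A N h T p hT, e']
      exact H _

end Interprets

section Sentences

variable {L : FirstOrder.Language.{u, v}} {Λ : FirstOrder.Language.{u', v'}}
  {s s₀ s₁ : ∀ n : ℕ, ColorSym L n → Λ.Relations n}

/-- A set `T` as on the right exists exactly when `φ(p, ·)` is an invariant relation on the domain,
which is a first-order condition. So `χ` is the implication from this condition to the translation
of `τ`, and strength for definable relations becomes a set of sentences. -/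
theorem exists_holds_formula (τ : Scheme L) {m : ℕ} (φ : Λ.Formula (Fin m ⊕ Fin τ.arity)) :
    ∃ χ : Λ.Formula (Fin m), ∀ (A : Type w) [Λ.Structure A] (N : InternalStr L A),
      Interprets s N → ∀ p : Fin m → A, χ.Realize p ↔
        ∀ T, N.pullback T = {x | φ.Realize (Sum.elim p x)} → τ.Holds N.Elem T := by
  obtain ⟨χ, hχ⟩ := exists_formula_translation.{u, v, u', v', w} (s := s) φ τ.sentence
  refine ⟨(Formula.iAlls (Fin τ.arity) (φ.imp (Formula.iInf fun i => domF s (Sum.inr i))) ⊓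
    Formula.iAlls (Fin τ.arity ⊕ Fin τ.arity) ((Formula.iInf fun i => domF s (Sum.inr (Sum.inr i))).imp
      ((Formula.iInf fun i => eqF s (Sum.inr (Sum.inl i)) (Sum.inr (Sum.inr i))).imp
        ((φ.relabel (Sum.map id Sum.inl)).imp (φ.relabel (Sum.map id Sum.inr)))))).imp
    (χ.relabel (Sum.elim id Fin.elim0)), fun A _ N h p => ?_⟩
  have e₁ : ∀ w : Fin τ.arity ⊕ Fin τ.arity → A,
      Sum.elim p w ∘ Sum.map id Sum.inl = Sum.elim p (w ∘ Sum.inl) := by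
    intro w
    funext i
    rcases i with i | i <;> rfl
  have e₂ : ∀ w : Fin τ.arity ⊕ Fin τ.arity → A,
      Sum.elim p w ∘ Sum.map id Sum.inr = Sum.elim p (w ∘ Sum.inr) := by
    intro w
    funext i
    rcases i with i | i <;> rfl
  have e₃ : p ∘ Sum.elim id Fin.elim0 =
      Sum.elim p fun i => ((Fin.elim0 i : N.Dom)).1 := by
    funext i
    rcases i with i | i
    · rfl
    · exact i.elim0
  simp only [Formula.realize_imp, Formula.realize_inf, Formula.realize_iAlls,
    Formula.realize_iInf, h.realize_domF, h.realize_eqF, Formula.realize_relabel, Sum.elim_inr]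
  have key : ∀ T, N.pullback T = {x | φ.Realize (Sum.elim p x)} →
      (χ.Realize (p ∘ Sum.elim id Fin.elim0) ↔ τ.Holds N.Elem T) := by
    intro T hT
    rw [e₃, hχ A N h T p hT]
    rw [Subsingleton.elim (fun i : Fin 0 => N.toElem i.elim0) default]
    rfl
  constructor
  · intro H T hT
    refine (key T hT).1 (H ⟨fun x hx => ?_, fun w hw hw' hx => ?_⟩)
    · have : x ∈ N.pullback T := by
        rw [hT]
        exact hx
      exact this.1
    · have : w ∘ Sum.inl ∈ N.pullback T := by
        rw [hT]
        exact (iff_of_eq (congrArg _ (e₁ w))).1 hx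
      have := N.pullback_congr T _ _ hw hw' this
      rw [hT] at this
      exact (iff_of_eq (congrArg _ (e₂ w))).2 this
  · rintro H ⟨h₁, h₂⟩
    obtain ⟨T, hT⟩ := N.exists_pullback {x | φ.Realize (Sum.elim p x)} h₁ (fun x y hy hxy hx => by
      have := h₂ (Sum.elim x y) hy hxy
      exact (iff_of_eq (congrArg _ (e₂ _))).1 (this ((iff_of_eq (congrArg _ (e₁ _))).2 hx)))
    exact (key T hT).2 (H T hT)

theorem forall_fin_one {A : Type*} {P : A → Prop} :
    (∀ v : Fin 1 → A, P (v 0)) ↔ ∀ x, P x :=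
  ⟨fun h x => h ![x], fun h _ => h _⟩

theorem forall_fin_two {A : Type*} {P : A → A → Prop} :
    (∀ v : Fin 2 → A, P (v 0) (v 1)) ↔ ∀ x y, P x y :=
  ⟨fun h x y => h ![x, y], fun h _ => h _ _⟩

theorem forall_fin_four {A : Type*} {P : A → A → A → A → Prop} :
    (∀ v : Fin 4 → A, P (v 0) (v 1) (v 2) (v 3)) ↔ ∀ x y z t, P x y z t :=
  ⟨fun h x y z t => h ![x, y, z, t], fun h _ => h _ _ _ _⟩

theorem exists_unit {A : Type*} {P : A → Prop} : (∃ v : Unit → A, P (v ())) ↔ ∃ x, P x :=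
  ⟨fun ⟨_, h⟩ => ⟨_, h⟩, fun ⟨x, h⟩ => ⟨fun _ => x, h⟩⟩

theorem realize_sentence_iInf {A : Type w} [Λ.Structure A] {ι : Type*} [Finite ι]
    (f : ι → Λ.Sentence) : A ⊨ (Formula.iInf f : Λ.Sentence) ↔ ∀ i, A ⊨ f i :=
  Formula.realize_iInf

/-- The conditions for all symbols of `L` are combined into one conjunction; this is where the
language has to be finite. -/
theorem exists_iso_sentence [Finite (Σ n, L.Functions n)] [Finite (Σ n, L.Relations n)]
    (α : Λ.Formula (Fin 2)) :
    ∃ σ : Λ.Sentence, ∀ (A : Type w) [Λ.Structure A] (N₀ N₁ : InternalStr L A),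
      Interprets s₀ N₀ → Interprets s₁ N₁ → (A ⊨ σ ↔ N₀.IsIso N₁ {z | α.Realize z}) := by
  let ap : ∀ {β : Type}, β → β → Λ.Formula β := fun a b => α.relabel ![a, b]
  have hap : ∀ {A : Type w} [Λ.Structure A] {β : Type} (a b : β) (v : β → A),
      (ap a b).Realize v ↔ α.Realize ![v a, v b] := by
    intro A _ β a b v
    rw [Formula.realize_relabel, comp_vec₂]
  let σ₁ : Λ.Sentence := closeF ((ap (0 : Fin 2) 1).imp (domF s₀ 0 ⊓ domF s₁ 1))
  let σ₂ : Λ.Sentence := closeF ((domF s₀ (0 : Fin 1)).imp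
    (Formula.iExs Unit (ap (Sum.inl 0) (Sum.inr ()))))
  let σ₃ : Λ.Sentence := closeF ((domF s₁ (0 : Fin 1)).imp
    (Formula.iExs Unit (ap (Sum.inr ()) (Sum.inl 0))))
  let σ₄ : Λ.Sentence := closeF ((ap (0 : Fin 4) 1).imp ((ap 2 3).imp
    ((eqF s₀ 0 2).iff (eqF s₁ 1 3))))
  let σ₅ : Λ.Sentence := closeF ((ap (0 : Fin 4) 1).imp ((domF s₀ 2).imp ((domF s₁ 3).imp
    ((eqF s₀ 0 2).imp ((eqF s₁ 1 3).imp (ap 2 3))))))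
  let σ₆ : Λ.Sentence := Formula.iInf fun r : Σ n, L.Relations n =>
    closeF ((Formula.iInf fun i : Fin r.1 => ap (Sum.inl i) (Sum.inr i)).imp
      (((s₀ _ (ColorSym.rel r.2)).formula fun i => Term.var (Sum.inl i)).iff
        ((s₁ _ (ColorSym.rel r.2)).formula fun i => Term.var (Sum.inr i))))
  let σ₇ : Λ.Sentence := Formula.iInf fun r : Σ n, L.Functions n =>
    closeF ((Formula.iInf fun i : Fin (r.1 + 1) => ap (Sum.inl i) (Sum.inr i)).imp
      (((s₀ _ (ColorSym.graph r.2)).formula fun i => Term.var (Sum.inl i)).iff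
        ((s₁ _ (ColorSym.graph r.2)).formula fun i => Term.var (Sum.inr i))))
  refine ⟨σ₁ ⊓ (σ₂ ⊓ (σ₃ ⊓ (σ₄ ⊓ (σ₅ ⊓ (σ₆ ⊓ σ₇))))), fun A _ N₀ N₁ h₀ h₁ => ?_⟩
  rw [InternalStr.isIso_iff]
  simp only [Sentence.realize_inf]
  have k₁ : A ⊨ σ₁ ↔ ∀ x y, α.Realize ![x, y] → ![x] ∈ N₀.dom ∧ ![y] ∈ N₁.dom := by
    simp only [σ₁, realize_closeF, Formula.realize_imp, Formula.realize_inf, hap,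
      h₀.realize_domF, h₁.realize_domF]
    exact forall_fin_two (P := fun x y => α.Realize ![x, y] → ![x] ∈ N₀.dom ∧ ![y] ∈ N₁.dom)
  have k₂ : A ⊨ σ₂ ↔ ∀ x, ![x] ∈ N₀.dom → ∃ y, α.Realize ![x, y] := by
    simp only [σ₂, realize_closeF, Formula.realize_imp, Formula.realize_iExs, hap,
      h₀.realize_domF, Sum.elim_inl, Sum.elim_inr]
    refine Iff.trans ?_ (forall_fin_one (P := fun x => ![x] ∈ N₀.dom → ∃ y, α.Realize ![x, y]))
    exact forall_congr' fun v => imp_congr_right fun _ =>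
      exists_unit (P := fun y => α.Realize ![v 0, y])
  have k₃ : A ⊨ σ₃ ↔ ∀ y, ![y] ∈ N₁.dom → ∃ x, α.Realize ![x, y] := by
    simp only [σ₃, realize_closeF, Formula.realize_imp, Formula.realize_iExs, hap,
      h₁.realize_domF, Sum.elim_inl, Sum.elim_inr]
    refine Iff.trans ?_ (forall_fin_one (P := fun y => ![y] ∈ N₁.dom → ∃ x, α.Realize ![x, y]))
    exact forall_congr' fun v => imp_congr_right fun _ =>
      exists_unit (P := fun x => α.Realize ![x, v 0])
  have k₄ : A ⊨ σ₄ ↔ ∀ x y x' y', α.Realize ![x, y] → α.Realize ![x', y'] →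
      (![x, x'] ∈ N₀.eq ↔ ![y, y'] ∈ N₁.eq) := by
    simp only [σ₄, realize_closeF, Formula.realize_imp, Formula.realize_iff, hap,
      h₀.realize_eqF, h₁.realize_eqF]
    exact forall_fin_four (P := fun x y x' y' => α.Realize ![x, y] → α.Realize ![x', y'] →
      (![x, x'] ∈ N₀.eq ↔ ![y, y'] ∈ N₁.eq))
  have k₅ : A ⊨ σ₅ ↔ ∀ x y x' y', α.Realize ![x, y] → ![x'] ∈ N₀.dom → ![y'] ∈ N₁.dom →
      ![x, x'] ∈ N₀.eq → ![y, y'] ∈ N₁.eq → α.Realize ![x', y'] := by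
    simp only [σ₅, realize_closeF, Formula.realize_imp, hap, h₀.realize_domF, h₁.realize_domF,
      h₀.realize_eqF, h₁.realize_eqF]
    exact forall_fin_four (P := fun x y x' y' => α.Realize ![x, y] → ![x'] ∈ N₀.dom →
      ![y'] ∈ N₁.dom → ![x, x'] ∈ N₀.eq → ![y, y'] ∈ N₁.eq → α.Realize ![x', y'])
  have k₆ : A ⊨ σ₆ ↔ ∀ (n : ℕ) (R : L.Relations n) (x y : Fin n → A),
      (∀ i, α.Realize ![x i, y i]) → (x ∈ N₀.rel R ↔ y ∈ N₁.rel R) := by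
    refine (realize_sentence_iInf _).trans ?_
    simp only [realize_closeF, Formula.realize_imp, Formula.realize_iInf, hap,
      Formula.realize_iff, Formula.realize_rel, h₀.rel, h₁.rel, Term.realize_var]
    exact ⟨fun H n R x y h => H ⟨n, R⟩ (Sum.elim x y) h, fun H r v h => H r.1 r.2 _ _ h⟩
  have k₇ : A ⊨ σ₇ ↔ ∀ (n : ℕ) (f : L.Functions n) (x y : Fin (n + 1) → A),
      (∀ i, α.Realize ![x i, y i]) → (x ∈ N₀.graph f ↔ y ∈ N₁.graph f) := by
    refine (realize_sentence_iInf _).trans ?_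
    simp only [realize_closeF, Formula.realize_imp, Formula.realize_iInf, hap,
      Formula.realize_iff, Formula.realize_rel, h₀.graph, h₁.graph, Term.realize_var]
    exact ⟨fun H n R x y h => H ⟨n, R⟩ (Sum.elim x y) h, fun H r v h => H r.1 r.2 _ _ h⟩
  rw [k₁, k₂, k₃, k₄, k₅, k₆, k₇]
  exact ⟨fun ⟨c₁, c₂, c₃, c₄, c₅, c₆, c₇⟩ => ⟨c₁, c₂, c₃, c₄, c₅, @c₆, @c₇⟩,
    fun ⟨c₁, c₂, c₃, c₄, c₅, c₆, c₇⟩ => ⟨c₁, c₂, c₃, c₄, c₅, @c₆, @c₇⟩⟩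

/-- A structure satisfying all sentences that hold whenever `s` is interpreted by an internal
structure interprets `s` by an internal structure. -/
theorem exists_interprets {A : Type w} [Λ.Structure A]
    (hA : ∀ σ : Λ.Sentence, (∀ (M : Type w) [Λ.Structure M] (N : InternalStr L M),
      Interprets s N → M ⊨ σ) → A ⊨ σ) :
    ∃ N : InternalStr L A, Interprets s N := by
  have hd : ∀ {β : Type} (a : β) (v : β → A), (domF s a).Realize v ↔
      Structure.RelMap (s _ ColorSym.dom) ![v a] := by
    intro β a v
    rw [domF, Formula.realize_rel₁]
    rfl
  have he : ∀ {β : Type} (a b : β) (v : β → A), (eqF s a b).Realize v ↔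
      Structure.RelMap (s _ ColorSym.eq) ![v a, v b] := by
    intro β a b v
    rw [eqF, Formula.realize_rel₂]
    rfl
  -- Each axiom of internal structures is the universal closure of a formula that is valid whenever
  -- `s` is so interpreted, and hence is inherited by `A`.
  have key : ∀ {β : Type} [Finite β] (φ : Λ.Formula β), (∀ (M : Type w) [Λ.Structure M]
      (N : InternalStr L M), Interprets s N → ∀ v : β → M, φ.Realize v) →
      ∀ v : β → A, φ.Realize v := fun φ h =>
    (realize_closeF φ).1 (hA _ fun M _ N hN => (realize_closeF φ).2 (h M N hN))
  have hcongr : ∀ {n : ℕ} (R : Λ.Relations n), (∀ (M : Type w) [Λ.Structure M]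
      (N : InternalStr L M), Interprets s N → ∀ x y : Fin n → M, (∀ i, ![x i] ∈ N.dom) →
        (∀ i, ![y i] ∈ N.dom) → (∀ i, ![x i, y i] ∈ N.eq) → Structure.RelMap R x →
        Structure.RelMap R y) → ∀ x y : Fin n → A,
        (∀ i, Structure.RelMap (s _ ColorSym.dom) ![x i]) →
        (∀ i, Structure.RelMap (s _ ColorSym.dom) ![y i]) →
        (∀ i, Structure.RelMap (s _ ColorSym.eq) ![x i, y i]) → Structure.RelMap R x →
        Structure.RelMap R y := by
    intro n R hR x y hx hy hxy h
    have := key (β := Fin n ⊕ Fin n) ((Formula.iInf fun i => domF s (Sum.inl i)).imp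
      ((Formula.iInf fun i => domF s (Sum.inr i)).imp
      ((Formula.iInf fun i => eqF s (Sum.inl i) (Sum.inr i)).imp
        ((R.formula fun i => Term.var (Sum.inl i)).imp
          (R.formula fun i => Term.var (Sum.inr i)))))) (fun M _ N hN v => by
        simp only [Formula.realize_imp, Formula.realize_iInf, hN.realize_domF, hN.realize_eqF,
          Formula.realize_rel, Term.realize_var]
        exact hR M N hN _ _) (Sum.elim x y)
    simp only [Formula.realize_imp, Formula.realize_iInf, hd, he, Formula.realize_rel,
      Term.realize_var, Sum.elim_inl, Sum.elim_inr] at this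
    exact this hx hy hxy h
  refine ⟨⟨{x | Structure.RelMap (s _ ColorSym.dom) x}, {x | Structure.RelMap (s _ ColorSym.eq) x},
    fun R => {x | Structure.RelMap (s _ (ColorSym.rel R)) x},
    fun f => {x | Structure.RelMap (s _ (ColorSym.graph f)) x},
    ?_, ?_, ?_, ?_, ?_, ?_, ?_, ?_⟩, fun n S x => by cases S <;> rfl⟩
  · have := key (β := Empty) (Formula.iExs Unit (domF s (Sum.inr ()))) (fun M _ N hN v => by
      simp only [Formula.realize_iExs, hN.realize_domF, Sum.elim_inr]
      obtain ⟨a, ha⟩ := N.nonempty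
      exact ⟨fun _ => a, ha⟩) default
    simp only [Formula.realize_iExs, hd, Sum.elim_inr] at this
    obtain ⟨a, ha⟩ := this
    exact ⟨a (), ha⟩
  · intro a ha
    have := key (β := Fin 1) ((domF s 0).imp (eqF s 0 0)) (fun M _ N hN v => by
      simp only [Formula.realize_imp, hN.realize_domF, hN.realize_eqF]
      exact N.eq_refl _) ![a]
    simp only [Formula.realize_imp, hd, he] at this
    exact this ha
  · intro a b ha hb h
    have := key (β := Fin 2) ((domF s 0).imp ((domF s 1).imp ((eqF s 0 1).imp (eqF s 1 0))))
      (fun M _ N hN v => by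
        simp only [Formula.realize_imp, hN.realize_domF, hN.realize_eqF]
        exact N.eq_symm _ _) ![a, b]
    simp only [Formula.realize_imp, hd, he] at this
    exact this ha hb h
  · intro a b c ha hb hc h h'
    have := key (β := Fin 3) ((domF s 0).imp ((domF s 1).imp ((domF s 2).imp
      ((eqF s 0 1).imp ((eqF s 1 2).imp (eqF s 0 2))))))
      (fun M _ N hN v => by
        simp only [Formula.realize_imp, hN.realize_domF, hN.realize_eqF]
        exact N.eq_trans _ _ _) ![a, b, c]
    simp only [Formula.realize_imp, hd, he] at this
    exact this ha hb hc h h'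
  · intro n R
    refine hcongr (s _ (ColorSym.rel R)) fun M _ N hN x y hx hy hxy => ?_
    rw [hN.rel, hN.rel]
    exact N.rel_congr R x y hx hy hxy
  · intro n f
    refine hcongr (s _ (ColorSym.graph f)) fun M _ N hN x y hx hy hxy => ?_
    rw [hN.graph, hN.graph]
    exact N.graph_congr f x y hx hy hxy
  · intro n f x hx
    have e : ∀ {M : Type w} [Λ.Structure M] (x : Fin n → M) (b : Unit → M),
        (fun i => ((Fin.snoc (fun j => Term.var (Sum.inl j)) (Term.var (Sum.inr ())) :
          Fin (n + 1) → Λ.Term (Fin n ⊕ Unit)) i).realize (Sum.elim x b)) = Fin.snoc x (b ()) := by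
      intro M _ x b
      funext i
      refine Fin.lastCases ?_ (fun i => ?_) i <;> simp
    have := key (β := Fin n) ((Formula.iInf fun i => domF s i).imp (Formula.iExs Unit
      (domF s (Sum.inr ()) ⊓ (s _ (ColorSym.graph f)).formula
        (Fin.snoc (fun j => Term.var (Sum.inl j)) (Term.var (Sum.inr ())))))) (fun M _ N hN v => by
        simp only [Formula.realize_imp, Formula.realize_iInf, Formula.realize_iExs,
          Formula.realize_inf, hN.realize_domF, Formula.realize_rel, e, hN.graph, Sum.elim_inr]
        intro hv
        obtain ⟨b, hb⟩ := N.graph_total f v hv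
        exact ⟨fun _ => b, hb⟩) x
    simp only [Formula.realize_imp, Formula.realize_iInf, Formula.realize_iExs,
      Formula.realize_inf, hd, Formula.realize_rel, e, Sum.elim_inr] at this
    obtain ⟨b, hb⟩ := this hx
    exact ⟨b (), hb⟩
  · intro n f x b c hx hb hc h h'
    have e : ∀ {M : Type w} [Λ.Structure M] (k : Fin 2) (x : Fin n → M) (b : Fin 2 → M),
        (fun i => ((Fin.snoc (fun j => Term.var (Sum.inl j)) (Term.var (Sum.inr k)) :
          Fin (n + 1) → Λ.Term (Fin n ⊕ Fin 2)) i).realize (Sum.elim x b)) =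
            Fin.snoc x (b k) := by
      intro M _ k x b
      funext i
      refine Fin.lastCases ?_ (fun i => ?_) i <;> simp
    have := key (β := Fin n ⊕ Fin 2) ((Formula.iInf fun i => domF s (Sum.inl i)).imp
      ((domF s (Sum.inr 0)).imp ((domF s (Sum.inr 1)).imp (((s _ (ColorSym.graph f)).formula
        (Fin.snoc (fun j => Term.var (Sum.inl j)) (Term.var (Sum.inr 0)))).imp
        (((s _ (ColorSym.graph f)).formula
        (Fin.snoc (fun j => Term.var (Sum.inl j)) (Term.var (Sum.inr 1)))).imp
          (eqF s (Sum.inr 0) (Sum.inr 1))))))) (fun M _ N hN v => by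
        rw [← Sum.elim_comp_inl_inr v]
        simp only [Formula.realize_imp, Formula.realize_iInf, hN.realize_domF, hN.realize_eqF,
          Formula.realize_rel, e, hN.graph, Sum.elim_inr, Sum.elim_inl]
        exact N.graph_unique f _ _ _) (Sum.elim x ![b, c])
    simp only [Formula.realize_imp, Formula.realize_iInf, hd, he, Formula.realize_rel, e,
      Sum.elim_inr, Sum.elim_inl] at this
    exact this hx hb hc h h'

end Sentences

/-! ### Compactness: one formula for all models -/

section Compactness

variable {L : FirstOrder.Language.{u, v}}

/-- The red symbols. -/
def redSym (L : FirstOrder.Language.{u, v}) (n : ℕ) (S : ColorSym L n) :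
    (duoPlus L).Relations n := Sum.inr (Sum.inl S)

/-- The blue symbols. -/
def blueSym (L : FirstOrder.Language.{u, v}) (n : ℕ) (S : ColorSym L n) :
    (duoPlus L).Relations n := Sum.inr (Sum.inr S)

theorem interprets_red {M : Type w} [L.Structure M] (R B : InternalStr L M) :
    @Interprets L (duoPlus L) (redSym L) M (duoStructure R B) R :=
  fun _ _ _ => Iff.rfl

theorem interprets_blue {M : Type w} [L.Structure M] (R B : InternalStr L M) :
    @Interprets L (duoPlus L) (blueSym L) M (duoStructure R B) B :=
  fun _ _ _ => Iff.rfl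

/-- The sentences true in all models of `τ^{duo+}` of a given universe. -/
def duoTheory (τ : Scheme L) : (duoPlus L).Theory :=
  {σ | ∀ (M : Type w) [L.Structure M] (R B : InternalStr L M), ModelsDuoPlus τ R B →
    @Sentence.Realize (duoPlus L) M (duoStructure R B) σ}

/-- For each `φ`, the closure of the formula expressing `τ` for the relation defined by `φ` is one
of the sentences of `duoTheory`. The selector `sel` handles red and blue together. -/
theorem strong_of_models_duoTheory {τ : Scheme L} {A : Type w} [L.Structure A]
    (R B : InternalStr L A)
    (h : letI := duoStructure R B; A ⊨ duoTheory.{u, v, w} τ)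
    (s : ∀ n, ColorSym L n → (duoPlus L).Relations n)
    (sel : ∀ {M : Type w}, InternalStr L M → InternalStr L M → InternalStr L M)
    (hs : ∀ (M : Type w) [L.Structure M] (R B : InternalStr L M),
      @Interprets L (duoPlus L) s M (duoStructure R B) (sel R B))
    (hsel : ∀ (M : Type w) [L.Structure M] (R B : InternalStr L M), ModelsDuoPlus τ R B →
      (sel R B).Strong (duoDef R B) τ) : (sel R B).Strong (duoDef R B) τ := by
  let i := duoStructure R B
  intro T hT
  obtain ⟨m, φ, p, hp⟩ := exists_fin_params_of_definable hT
  obtain ⟨χ, hχ⟩ := exists_holds_formula.{u, v, u, max u v, w} (s := s) τ φ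
  have hmem : closeF χ ∈ duoTheory.{u, v, w} τ := by
    intro M _ R B hRB
    let _ := duoStructure R B
    refine (realize_closeF χ).2 fun p => (hχ M (sel R B) (hs M R B) p).2 fun T hT => ?_
    refine hsel M R B hRB T ?_
    rw [hT]
    exact definable_of_fin_params φ p
  exact (hχ A (sel R B) (hs A R B) p).1
    ((realize_closeF χ).1 (Theory.realize_sentence_of_mem _ hmem) p) T hp

/-- The models of `τ^{duo+}` form an elementary class: a structure produced by compactness is again
one of them. -/
theorem exists_duo_of_models_duoTheory {τ : Scheme L} {A : Type w} [i : (duoPlus L).Structure A]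
    (h : A ⊨ duoTheory.{u, v, w} τ) :
    ∃ (_ : L.Structure A) (R B : InternalStr L A), i = duoStructure R B ∧
      ModelsDuoPlus τ R B := by
  obtain ⟨R, hR⟩ := exists_interprets (s := redSym L) (A := A) fun σ hσ =>
    Theory.realize_sentence_of_mem (duoTheory.{u, v, w} τ) (show σ ∈ duoTheory τ from
      fun M _ R B _ => @hσ M (duoStructure R B) R (interprets_red R B))
  obtain ⟨B, hB⟩ := exists_interprets (s := blueSym L) (A := A) fun σ hσ =>
    Theory.realize_sentence_of_mem (duoTheory.{u, v, w} τ) (show σ ∈ duoTheory τ from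
      fun M _ R B _ => @hσ M (duoStructure R B) B (interprets_blue R B))
  let iL : L.Structure A :=
    ⟨fun f x => i.funMap (Sum.inl f) x, fun R x => i.RelMap (Sum.inl R) x⟩
  have hi : i = duoStructure R B := by
    ext n f x
    · rcases f with f | f | f
      · rfl
      · exact Empty.elim f
      · exact Empty.elim f
    · rcases f with f | f | f
      · rfl
      · exact hR n f x
      · exact hB n f x
  have h' : @Theory.Model (duoPlus L) A (duoStructure R B) (duoTheory.{u, v, w} τ) := by
    rw [← hi]
    exact h
  refine ⟨iL, R, B, hi, ?_, ?_, ?_⟩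
  · refine ⟨fun σ hσ => ?_⟩
    have : (LHom.sumInl : L →ᴸ duoPlus L).IsExpansionOn A :=
      { map_onFunction := fun _ _ => rfl
        map_onRelation := fun _ _ => rfl }
    rw [← LHom.realize_onSentence A (LHom.sumInl : L →ᴸ duoPlus L)]
    refine Theory.realize_sentence_of_mem (duoTheory.{u, v, w} τ) ?_
    intro M _ R B hRB
    let _ := duoStructure R B
    have : (LHom.sumInl : L →ᴸ duoPlus L).IsExpansionOn M :=
      { map_onFunction := fun _ _ => rfl
        map_onRelation := fun _ _ => rfl }
    rw [LHom.realize_onSentence]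
    have := hRB.1
    exact Theory.realize_sentence_of_mem τ.instances hσ
  · exact strong_of_models_duoTheory R B h' (redSym L) (fun R _ => R)
      (fun _ _ R B => interprets_red R B) (fun _ _ _ _ h => h.2.1)
  · exact strong_of_models_duoTheory R B h' (blueSym L) (fun _ B => B)
      (fun _ _ R B => interprets_blue R B) (fun _ _ _ _ h => h.2.2)

/-- If the sentence `σ` says that `β` defines an isomorphism, then `(σ ∧ β) ∨ (¬σ ∧ α)` uses `β`
where it works and falls back on `α` elsewhere. -/
theorem exists_uniform_formula {τ : Scheme L} [Finite (Σ n, L.Functions n)]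
    [Finite (Σ n, L.Relations n)] (F : Set ((duoPlus L).Formula (Fin 2))) (hF : F.Finite) :
    ∃ α : (duoPlus L).Formula (Fin 2), ∀ (M : Type w) [L.Structure M] (R B : InternalStr L M),
      ModelsDuoPlus τ R B →
      (∃ β ∈ F, R.IsIso B {z | @Formula.Realize (duoPlus L) M (duoStructure R B) (Fin 2) β z}) →
      R.IsIso B {z | @Formula.Realize (duoPlus L) M (duoStructure R B) (Fin 2) α z} := by
  induction F, hF using Set.Finite.induction_on with
  | empty => exact ⟨⊤, fun M _ R B _ ⟨β, h, _⟩ => h.elim⟩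
  | @insert β F _ _ ih =>
    obtain ⟨α, hα⟩ := ih
    obtain ⟨σ, hσ⟩ := exists_iso_sentence.{u, v, u, max u v, w} (s₀ := redSym L)
      (s₁ := blueSym L) β
    let σ' : (duoPlus L).Formula (Fin 2) := Formula.relabel Empty.elim σ
    refine ⟨(σ' ⊓ β) ⊔ (∼σ' ⊓ α), fun M _ R B hRB h => ?_⟩
    let _ := duoStructure R B
    have hσ' : ∀ z : Fin 2 → M, σ'.Realize z ↔ M ⊨ σ := by
      intro z
      rw [Formula.realize_relabel, Subsingleton.elim (z ∘ Empty.elim) default]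
      rfl
    have hσM := hσ M R B (interprets_red R B) (interprets_blue R B)
    simp only [Formula.realize_sup, Formula.realize_inf, Formula.realize_not, hσ']
    by_cases hc : M ⊨ σ
    · simpa [hc] using hσM.1 hc
    · simp only [hc, false_and, not_false_eq_true, true_and, false_or]
      refine hα M R B hRB ?_
      obtain ⟨γ, hγ, hi⟩ := h
      rcases hγ with rfl | hγ
      · exact absurd (hσM.2 hi) hc
      · exact ⟨γ, hγ, hi⟩

/-- If no finite set of formulas sufficed, compactness would produce a model of `τ^{duo+}` in which
no formula defines an isomorphism, against `exists_formula_iso`. The universe `max u v` is the one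
in which `IsSatisfiable` provides models. -/
theorem Scheme.StandaloneCategoricalIn.stronglyInternallyCategorical {τ : Scheme L}
    (hτ : Scheme.StandaloneCategoricalIn.{u, v, u, v, max u v} τ τ.instances) :
    Scheme.StronglyInternallyCategorical.{u, v, max u v} τ := by
  by_cases hsub : ∀ (M : Type (max u v)) [L.Structure M], M ⊨ τ.instances → Subsingleton M
  · refine ⟨⊤, fun M _ R B h => ?_⟩
    have := hsub M h.1
    exact isIso_top_of_subsingleton hτ h
  push Not at hsub
  obtain ⟨M, _, hM, _⟩ := hsub
  obtain ⟨_, _⟩ := finite_symbols_of_nontrivial hτ hM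
  choose σ hσ using fun β => exists_iso_sentence.{u, v, u, max u v, max u v} (s₀ := redSym L)
      (s₁ := blueSym L) β
  have hunsat : ¬ (duoTheory.{u, v, max u v} τ ∪ Set.range fun β => ∼(σ β)).IsSatisfiable := by
    rintro ⟨A⟩
    have hA : A ⊨ duoTheory.{u, v, max u v} τ := A.is_model.mono Set.subset_union_left
    obtain ⟨iL, R, B, hi, hRB⟩ := exists_duo_of_models_duoTheory hA
    obtain ⟨α, hα⟩ := exists_formula_iso hτ hRB
    have h1 : A ⊨ ∼(σ α) := Theory.realize_sentence_of_mem
      (duoTheory.{u, v, max u v} τ ∪ Set.range fun β => ∼(σ β)) (Or.inr ⟨α, rfl⟩)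
    rw [Sentence.realize_not] at h1
    refine h1 ?_
    rw [hi]
    exact (@hσ α A (duoStructure R B) R B (interprets_red R B) (interprets_blue R B)).2 hα
  rw [Theory.isSatisfiable_iff_isFinitelySatisfiable, Theory.IsFinitelySatisfiable] at hunsat
  push Not at hunsat
  obtain ⟨T₀, hT₀, hT⟩ := hunsat
  -- `Function.invFun` recovers a formula `β` from the sentence denying that it works. On other
  -- members of `T₀` it returns an arbitrary formula, which does no harm.
  obtain ⟨α, hα⟩ := exists_uniform_formula.{u, v, max u v} (τ := τ)
    (Function.invFun (fun β => ∼(σ β)) '' (T₀ : Set (duoPlus L).Sentence))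
    (T₀.finite_toSet.image _)
  refine ⟨α, fun M _ R B hRB => hα M R B hRB ?_⟩
  by_contra hcon
  push Not at hcon
  apply hT
  let _ := duoStructure R B
  have : Nonempty M := ⟨R.nonempty.choose⟩
  have : M ⊨ (T₀ : (duoPlus L).Theory) := by
    refine ⟨fun ρ hρ => ?_⟩
    rcases hT₀ hρ with h | h
    · exact h M R B hRB
    · have hinv : ∼(σ (Function.invFun (fun β => ∼(σ β)) ρ)) = ρ := Function.invFun_eq h
      rw [← hinv, Sentence.realize_not]
      intro hc
      exact hcon _ ⟨ρ, hρ, rfl⟩ ((hσ _ M R B (interprets_red R B) (interprets_blue R B)).1 hc)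
  exact Theory.Model.isSatisfiable M

end Compactness

/-! ### The scheme of the ordered integers -/

section IntScheme

/-- The order relation of a structure for the language of orders. -/
def leR {A : Type w} [FirstOrder.Language.order.Structure A] (x y : A) : Prop :=
  Structure.RelMap (L := FirstOrder.Language.order) orderRel.le ![x, y]

/-- `x < y` for a relation `le`. -/
def Lt' {A : Type w} (le : A → A → Prop) (x y : A) : Prop := le x y ∧ ¬ le y x

/-- `y` is an immediate successor of `x`. -/
def Succ' {A : Type w} (le : A → A → Prop) (x y : A) : Prop :=
  Lt' le x y ∧ ∀ z, ¬ (Lt' le x z ∧ Lt' le z y)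

/-- Upward induction along `le` for `P`. -/
def UpInd {A : Type w} (le : A → A → Prop) (P : A → Prop) : Prop :=
  ∀ x, P x → (∀ z, le x z → P z → ∀ w, Succ' le z w → P w) → ∀ z, le x z → P z

/-- Downward induction along `le` for `P`. -/
def DownInd {A : Type w} (le : A → A → Prop) (P : A → Prop) : Prop :=
  ∀ x, P x → (∀ z, le z x → P z → ∀ w, Succ' le w z → P w) → ∀ z, le z x → P z

/-- A linear order in which every element has an immediate successor and an immediate
predecessor. -/
structure DiscreteOrder {A : Type w} (le : A → A → Prop) : Prop where
  refl : ∀ x, le x x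
  antisymm : ∀ x y, le x y → le y x → x = y
  trans : ∀ x y z, le x y → le y z → le x z
  total : ∀ x y, le x y ∨ le y x
  exists_succ : ∀ x, ∃ y, Succ' le x y
  exists_pred : ∀ x, ∃ y, Succ' le y x

variable {A : Type w} [FirstOrder.Language.order.Structure A]

theorem intScheme_holds_iff (T : Set (Fin intScheme.arity → A)) :
    intScheme.Holds A T ↔ DiscreteOrder (leR (A := A)) ∧
      UpInd (leR (A := A)) (fun x => (fun _ => x) ∈ T) ∧
      DownInd (leR (A := A)) (fun x => (fun _ => x) ∈ T) := by
  let _ : (predLang 1).Structure A := predStructure T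
  have hle : ∀ {n : ℕ} (x y : Fin n) (v : Empty → A) (xs : Fin n → A),
      (leF x y).Realize v xs ↔ leR (xs x) (xs y) := by
    intro n x y v xs
    exact BoundedFormula.realize_rel₂.trans Iff.rfl
  have hP : ∀ {n : ℕ} (x : Fin n) (v : Empty → A) (xs : Fin n → A),
      (predF x).Realize v xs ↔ (fun _ => xs x) ∈ T := by
    intro n x v xs
    refine BoundedFormula.realize_rel₁.trans ?_
    have : (fun _ => xs x) = ![xs x] := by
      funext i
      fin_cases i
      rfl
    exact iff_of_eq (congrArg (fun x : Fin 1 → A => x ∈ T) this.symm)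
  have hlt : ∀ {n : ℕ} (x y : Fin n) (v : Empty → A) (xs : Fin n → A),
      (ltF x y).Realize v xs ↔ Lt' leR (xs x) (xs y) := by
    intro n x y v xs
    rw [ltF, BoundedFormula.realize_inf, BoundedFormula.realize_not, hle, hle]
    rfl
  have hs : ∀ {n : ℕ} (x y : Fin n) (v : Empty → A) (xs : Fin n → A),
      (succF x y).Realize v xs ↔ Succ' leR (xs x) (xs y) := by
    intro n x y v xs
    rw [succF, BoundedFormula.realize_inf, BoundedFormula.realize_all, hlt]
    simp only [BoundedFormula.realize_not, BoundedFormula.realize_inf, hlt, Fin.snoc_castSucc,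
      Fin.snoc_last]
    rfl
  have s0 : ∀ a : A, (Fin.snoc (default : Fin 0 → A) a : Fin 1 → A) 0 = a := fun a => rfl
  have s10 : ∀ a b : A, (Fin.snoc (Fin.snoc (default : Fin 0 → A) a : Fin 1 → A) b : Fin 2 → A) 0
    = a := fun a b => rfl
  have s11 : ∀ a b : A, (Fin.snoc (Fin.snoc (default : Fin 0 → A) a : Fin 1 → A) b : Fin 2 → A) 1
    = b := fun a b => rfl
  have s20 : ∀ a b c : A, (Fin.snoc (Fin.snoc (Fin.snoc (default : Fin 0 → A) a : Fin 1 → A) b :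
    Fin 2 → A) c : Fin 3 → A) 0 = a := fun a b c => rfl
  have s21 : ∀ a b c : A, (Fin.snoc (Fin.snoc (Fin.snoc (default : Fin 0 → A) a : Fin 1 → A) b :
    Fin 2 → A) c : Fin 3 → A) 1 = b := fun a b c => rfl
  have s22 : ∀ a b c : A, (Fin.snoc (Fin.snoc (Fin.snoc (default : Fin 0 → A) a : Fin 1 → A) b :
    Fin 2 → A) c : Fin 3 → A) 2 = c := fun a b c => rfl
  have heq : ∀ (v : Empty → A) (xs : Fin 2 → A),
      ((&0 =' &1) : orderP.BoundedFormula Empty 2).Realize v xs ↔ xs 0 = xs 1 := by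
    intro v xs
    rw [BoundedFormula.realize_bdEqual]
    rfl
  have key : intScheme.Holds A T ↔ A ⊨ (linearOrderF ⊓ discreteF ⊓ inductionUpF ⊓ inductionDownF :
    orderP.Sentence) := Iff.rfl
  rw [key]
  simp only [Sentence.Realize, Formula.Realize, linearOrderF, discreteF, inductionUpF,
    inductionDownF, BoundedFormula.realize_inf, BoundedFormula.realize_all,
    BoundedFormula.realize_ex, BoundedFormula.realize_imp, BoundedFormula.realize_sup,
    hle, hP, hs, heq, s0, s10, s11, s20, s21, s22]
  constructor
  · rintro ⟨⟨⟨⟨⟨⟨h1, h2⟩, h3⟩, h4⟩, h5, h6⟩, h7⟩, h8⟩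
    exact ⟨⟨h1, h2, h3, h4, h5, h6⟩, fun x hx h => h7 x ⟨hx, h⟩, fun x hx h => h8 x ⟨hx, h⟩⟩
  · rintro ⟨⟨h1, h2, h3, h4, h5, h6⟩, h7, h8⟩
    exact ⟨⟨⟨⟨⟨⟨h1, h2⟩, h3⟩, h4⟩, h5, h6⟩, fun x hx => h7 x hx.1 hx.2⟩,
      fun x hx => h8 x hx.1 hx.2⟩

end IntScheme

/-! ### Galaxies of a discrete order -/

section Galaxies

/-- The linear order given by a discrete order relation. -/
noncomputable abbrev DiscreteOrder.toLinearOrder {A : Type w} {le : A → A → Prop}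
    (h : DiscreteOrder le) : LinearOrder A where
  le := le
  le_refl := h.refl
  le_trans := h.trans
  le_antisymm := h.antisymm
  le_total := h.total
  toDecidableLE := Classical.decRel _

theorem succ'_iff_covBy {A : Type w} [Preorder A] {x y : A} :
    Succ' (fun x y : A => x ≤ y) x y ↔ x ⋖ y := by
  simp only [Succ', Lt', ← lt_iff_le_not_ge, CovBy, not_and]

/-- Immediate successors and predecessors in a linear order are unique, so the chosen ones give
mutually inverse maps. -/
theorem exists_shift {A : Type w} {le : A → A → Prop} (h : DiscreteOrder le) :
    letI := h.toLinearOrder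
    ∃ S : Equiv.Perm A, ∀ x, x ⋖ S x := by
  let _ := h.toLinearOrder
  have hs : ∀ x : A, ∃ y, x ⋖ y := fun x =>
    (h.exists_succ x).imp fun y => succ'_iff_covBy.1
  have hp : ∀ x : A, ∃ y, y ⋖ x := fun x =>
    (h.exists_pred x).imp fun y => succ'_iff_covBy.1
  choose s hs using hs
  choose p hp using hp
  exact ⟨⟨s, p, fun x => (hp (s x)).unique_left (hs x), fun x => (hs (p x)).unique_right (hp x)⟩, hs⟩

theorem zpow_strictMono {A : Type w} [LinearOrder A] {S : Equiv.Perm A} (hS : ∀ x, x ⋖ S x)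
    (c : A) : StrictMono fun k : ℤ => (S ^ k) c := by
  refine strictMono_int_of_lt_succ fun k => ?_
  rw [add_comm, zpow_add, zpow_one]
  exact (hS _).lt

theorem int_holds (T : Set (Fin intScheme.arity → ℤ)) :
    letI : FirstOrder.Language.order.Structure ℤ := orderStructure ℤ
    intScheme.Holds ℤ T := by
  let _ : FirstOrder.Language.order.Structure ℤ := orderStructure ℤ
  rw [intScheme_holds_iff]
  have hle : leR (A := ℤ) = fun x y => x ≤ y := rfl
  simp only [hle]
  have hs : ∀ {x y : ℤ}, Succ' (fun x y => x ≤ y) x y ↔ y = x + 1 := by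
    intro x y
    rw [succ'_iff_covBy, Order.covBy_iff_add_one_eq]
    exact eq_comm
  refine ⟨⟨le_refl, fun _ _ => le_antisymm, fun _ _ _ => le_trans, le_total, fun x => ⟨x + 1, hs.2 rfl⟩,
    fun x => ⟨x - 1, hs.2 (by ring)⟩⟩, ?_, ?_⟩
  · intro x hx hstep z hz
    induction z, hz using Int.leInduction with
    | base => exact hx
    | succ z hz ih => exact hstep z hz ih _ (hs.2 rfl)
  · intro x hx hstep z hz
    induction z, hz using Int.leInductionDown with
    | base => exact hx
    | pred z hz ih => exact hstep z hz ih _ (hs.2 (by ring))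

variable {A : Type w} [FirstOrder.Language.order.Structure A]

/-- The internal structure for the language of orders on a nonempty subset of an order. -/
def internalSuborder (D : Set A) (hD : D.Nonempty) :
    InternalStr FirstOrder.Language.order A where
  dom := {x | x 0 ∈ D}
  eq := {x | x 0 = x 1}
  rel := fun R => {x | Structure.RelMap R x}
  graph := fun f => isEmptyElim f
  nonempty := hD
  eq_refl := fun _ _ => rfl
  eq_symm := fun _ _ _ _ h => Eq.symm h
  eq_trans := fun _ _ _ _ _ _ h h' => Eq.trans h h'
  rel_congr := fun R x y _ _ h hx => by
    have : x = y := funext h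
    rwa [← this]
  graph_congr := fun f => isEmptyElim f
  graph_total := fun f => isEmptyElim f
  graph_unique := fun f => isEmptyElim f

/-- A copy of `ℤ` satisfies induction for all sets, whatever relations the ambient family contains.
-/
theorem strong_galaxy (g : ℤ → A) (hg : ∀ j k, leR (g j) (g k) ↔ j ≤ k)
    (hinj : Function.Injective g) (X : SOPart A) :
    (internalSuborder (Set.range g) (Set.range_nonempty g)).Strong X intScheme := by
  let _ : FirstOrder.Language.order.Structure ℤ := orderStructure ℤ
  intro T _
  let N := internalSuborder (Set.range g) (Set.range_nonempty g)
  let f : ℤ → N.Elem := fun k => N.toElem ⟨g k, k, rfl⟩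
  have hf : Function.Bijective f := by
    constructor
    · intro j k h
      exact hinj (N.toElem_eq.1 h)
    · intro q
      obtain ⟨⟨a, k, hk⟩, rfl⟩ := N.exists_toElem q
      exact ⟨k, N.toElem_eq.2 hk⟩
  let e : ℤ ≃[FirstOrder.Language.order] N.Elem :=
    { Equiv.ofBijective f hf with
      map_fun' := fun f => isEmptyElim f
      map_rel' := fun {n} R x => by
        refine (N.relMap_toElem R (fun i => ⟨g (x i), x i, rfl⟩)).trans ?_
        cases R
        have : (fun i => g (x i)) = ![g (x 0), g (x 1)] := by
          funext i
          fin_cases i <;> rfl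
        change Structure.RelMap (L := FirstOrder.Language.order) orderRel.le (fun i => g (x i)) ↔ _
        refine (iff_of_eq (congrArg _ this)).trans ((hg _ _).trans ?_)
        rfl }
  exact (intScheme.holds_congr e T).1 (int_holds _)

end Galaxies

/-! ### Failure of strong internal categoricity -/

section NotStrong

/-- Upward Löwenheim–Skolem applied to `ℤ`. A single galaxy is countable, so an uncountable model
has at least two. -/
theorem exists_uncountable_model : ∃ (M : Type w) (_ : FirstOrder.Language.order.Structure M),
    M ⊨ intScheme.instances ∧ Uncountable M := by
  let _ : FirstOrder.Language.order.Structure ℤ := orderStructure ℤ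
  obtain ⟨M, hM, hc⟩ := exists_elementarilyEquivalent_card_eq FirstOrder.Language.order ℤ
    (Order.succ Cardinal.aleph0.{w}) (Order.le_succ _) (by
      rw [FirstOrder.Language.order.card_eq_one]
      simpa using Cardinal.aleph0_le_aleph 1 |>.trans' Cardinal.one_le_aleph0)
  have : ℤ ⊨ intScheme.instances := (models_instances_iff _).2 fun S _ => int_holds S
  refine ⟨M, inferInstance, hM.theory_model, ?_⟩
  rw [← Cardinal.aleph0_lt_mk_iff, hc]
  exact Order.lt_succ _

theorem intScheme_not_stronglyInternallyCategorical :
    ¬ Scheme.StronglyInternallyCategorical.{0, 0, w} intScheme := by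
  classical
  rintro ⟨α, hα⟩
  obtain ⟨M, _, hM, _⟩ := exists_uncountable_model.{w}
  have hD : DiscreteOrder (leR (A := M)) :=
    ((intScheme_holds_iff _).1 ((models_instances_iff _).1 hM _ Set.definable_empty)).1
  let _ := hD.toLinearOrder
  have hle : ∀ x y : M, leR x y ↔ x ≤ y := fun _ _ => Iff.rfl
  obtain ⟨S, hS⟩ := exists_shift hD
  obtain ⟨c⟩ : Nonempty M := inferInstance
  have hmono := zpow_strictMono hS
  obtain ⟨d, hd⟩ : ∃ d, d ∉ Set.range fun k : ℤ => (S ^ k) c := by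
    by_contra hcon
    push Not at hcon
    exact Set.not_countable_univ ((Set.countable_range fun k : ℤ => (S ^ k) c).mono
      fun d _ => hcon d)
  have hdisj : ∀ y, (y ∈ Set.range fun k : ℤ => (S ^ k) d) → y ∉ Set.range fun k : ℤ => (S ^ k) c := by
    rintro _ ⟨k, rfl⟩ ⟨j, hj⟩
    refine hd ⟨-k + j, ?_⟩
    simp only at hj ⊢
    rw [zpow_add, Equiv.Perm.mul_apply, hj, ← Equiv.Perm.mul_apply, ← zpow_add]
    simp
  let G : Set M := Set.range fun k : ℤ => (S ^ k) c
  have hG : ∀ x, S x ∈ G ↔ x ∈ G := by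
    intro x
    constructor
    · rintro ⟨k, hk⟩
      refine ⟨-1 + k, ?_⟩
      simp only at hk ⊢
      rw [zpow_add, Equiv.Perm.mul_apply, hk]
      simp
    · rintro ⟨k, hk⟩
      refine ⟨1 + k, ?_⟩
      simp only at hk ⊢
      rw [zpow_add, Equiv.Perm.mul_apply, hk]
      simp
  let R := internalSuborder G (Set.range_nonempty _)
  let B := internalSuborder (Set.range fun k : ℤ => (S ^ k) d) (Set.range_nonempty _)
  have hR : ∀ X, R.Strong X intScheme := strong_galaxy _ (fun j k => (hmono c).le_iff_le)
    (hmono c).injective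
  have hB : ∀ X, B.Strong X intScheme := strong_galaxy _ (fun j k => (hmono d).le_iff_le)
    (hmono d).injective
  have hiso := hα M R B ⟨hM, hR _, hB _⟩
  rw [InternalStr.isIso_iff] at hiso
  -- Shift the red galaxy by one step and fix everything else. Nothing lies strictly between `x` and
  -- `S x`, so the order is preserved.
  let σ : Equiv.Perm M :=
    { toFun := fun x => if x ∈ G then S x else x
      invFun := fun x => if x ∈ G then S.symm x else x
      left_inv := fun x => by
        by_cases hx : x ∈ G
        · simp [hx, hG]
        · simp [hx]
      right_inv := fun x => by
        by_cases hx : x ∈ G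
        · have : S.symm x ∈ G := by
            rw [← hG]
            simpa using hx
          simp [hx, this]
        · simp [hx] }
  have hσ : StrictMono σ := by
    intro x y hxy
    change (if x ∈ G then S x else x) < (if y ∈ G then S y else y)
    by_cases hx : x ∈ G <;> by_cases hy : y ∈ G <;> simp only [hx, hy, if_true, if_false]
    · exact ((hS x).ge_of_gt hxy).trans_lt (hS y).lt
    · refine lt_of_le_of_ne ((hS x).ge_of_gt hxy) ?_
      rintro rfl
      exact hy ((hG x).2 hx)
    · exact hxy.trans (hS y).lt
    · exact hxy
  have hσG : ∀ x, σ x ∈ G ↔ x ∈ G := by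
    intro x
    change (if x ∈ G then S x else x) ∈ G ↔ x ∈ G
    by_cases hx : x ∈ G <;> simp [hx, hG]
  have hσB : ∀ x, (x ∈ Set.range fun k : ℤ => (S ^ k) d) → σ x = x := fun x hx =>
    if_neg (hdisj x hx)
  have hσB' : ∀ x, σ x ∈ (Set.range fun k : ℤ => (S ^ k) d) ↔
      x ∈ Set.range fun k : ℤ => (S ^ k) d := by
    intro x
    refine ⟨fun h => ?_, fun h => by rwa [hσB x h]⟩
    have := hσB _ h
    rwa [σ.injective this] at h
  have hσle : ∀ {n : ℕ} (r : FirstOrder.Language.order.Relations n) (x : Fin n → M),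
      Structure.RelMap r (σ ∘ x) ↔ Structure.RelMap r x := by
    intro n r x
    cases r
    have : ∀ x : Fin 2 → M, x = ![x 0, x 1] := fun x => by
      funext i
      fin_cases i <;> rfl
    refine (iff_of_eq (congrArg _ (this _))).trans (Iff.trans ?_ (iff_of_eq (congrArg _ (this x).symm)))
    exact hσ.le_iff_le
  let _ := duoStructure R B
  let e : M ≃[duoPlus FirstOrder.Language.order] M :=
    { σ with
      map_fun' := fun {n} f x => by
        rcases f with f | f | f
        · exact isEmptyElim f
        · exact Empty.elim f
        · exact Empty.elim f
      map_rel' := fun {n} r x => by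
        rcases r with r | r | r
        · exact hσle r x
        · cases r with
          | dom => exact hσG _
          | eq => exact σ.injective.eq_iff
          | rel r => exact hσle r x
          | graph f => exact isEmptyElim f
        · cases r with
          | dom => exact hσB' _
          | eq => exact σ.injective.eq_iff
          | rel r => exact hσle r x
          | graph f => exact isEmptyElim f }
  -- `α` relates `c` to some blue `y`. The automorphism moves `c` to `S c` and fixes `y`, so `α`
  -- relates `S c` to `y` as well, and injectivity gives `c = S c`.
  have hc : ![c] ∈ R.dom := ⟨0, rfl⟩
  obtain ⟨y, hy⟩ := hiso.total c hc
  have hy' := (StrongHomClass.realize_formula e α).2 hy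
  rw [comp_vec₂] at hy'
  have e₁ : e c = S c := if_pos ⟨0, rfl⟩
  have e₂ : e y = y := hσB y (hiso.dom _ _ hy).2
  rw [e₁, e₂] at hy'
  have : c = S c := (hiso.eq_iff _ _ _ _ hy hy').2 rfl
  exact (hS c).lt.ne this

end NotStrong

/-! ### Matching iterated successors -/

section Chains

variable {A : Type u} {B : Type v} [Preorder A] [Preorder B]

/-- Induction from `a` upwards for `P`. -/
def Ind (a : A) (P : A → Prop) : Prop :=
  P a → (∀ z, a ≤ z → P z → ∀ w, z ⋖ w → P w) → ∀ z, a ≤ z → P z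

/-- A relation that relates exactly the iterated successors of `a` with those of `b`. -/
structure Chain (a : A) (b : B) (F : A → B → Prop) : Prop where
  base : F a b
  step : ∀ p q p' q', F p q → p ⋖ p' → q ⋖ q' → F p' q'
  cases : ∀ p q, F p q → (p ≤ a ∧ a ≤ p ∧ q ≤ b ∧ b ≤ q) ∨
    ∃ p' q', a ≤ p' ∧ b ≤ q' ∧ F p' q' ∧ p' ⋖ p ∧ q' ⋖ q
  inv : ∀ p q p' q', F p q → p ≤ p' → p' ≤ p → q ≤ q' → q' ≤ q → F p' q'

namespace Chain

variable {a : A} {b : B} {F : A → B → Prop} (h : Chain a b F)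

include h

theorem swap : Chain b a (fun q p => F p q) where
  base := h.base
  step := fun _ _ _ _ hF hq hp => h.step _ _ _ _ hF hp hq
  cases := fun q p hF => (h.cases p q hF).imp (fun ⟨h₁, h₂, h₃, h₄⟩ => ⟨h₃, h₄, h₁, h₂⟩)
    (fun ⟨p', q', h₁, h₂, h₃, h₄, h₅⟩ => ⟨q', p', h₂, h₁, h₃, h₅, h₄⟩)
  inv := fun _ _ _ _ hF h₁ h₂ h₃ h₄ => h.inv _ _ _ _ hF h₃ h₄ h₁ h₂

theorem left_le {p : A} {q : B} (hF : F p q) : a ≤ p := by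
  rcases h.cases p q hF with ⟨_, h₂, _⟩ | ⟨p', q', h₁, _, _, h₄, _⟩
  · exact h₂
  · exact h₁.trans h₄.lt.le

theorem total (hi : Ind a fun p => ∃ q, F p q) (hB : ∀ q : B, ∃ q', q ⋖ q') :
    ∀ p, a ≤ p → ∃ q, F p q :=
  hi ⟨b, h.base⟩ fun _ _ ⟨q, hq⟩ _ hw => (hB q).imp fun _ hq' => h.step _ _ _ _ hq hw hq'

/-- Induction on `p`, for all `p₁ ≤ p` at once. At a cover `z ⋖ w` either `p₁ ≤ z`, or `p₁` is
equivalent to `w`. In the second case the predecessors of `q₁` and `q` both correspond to `z` and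
are compared by the induction hypothesis; were `q < q₁`, something would lie strictly between `q₁`
and its predecessor. -/
theorem mono (hA : ∀ p q : A, p ≤ q ∨ q ≤ p) (hB : ∀ p q : B, p ≤ q ∨ q ≤ p)
    (hi : Ind a fun p => ∀ p₁ q₁ q, p₁ ≤ p → F p₁ q₁ → F p q → q₁ ≤ q) {p₁ p : A} {q₁ q : B}
    (h₁ : F p₁ q₁) (hF : F p q) (hp : p₁ ≤ p) : q₁ ≤ q := by
  refine hi ?_ ?_ p (h.left_le hF) p₁ q₁ q hp h₁ hF
  · intro p₁ q₁ q hp h₁ hF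
    have hb : ∀ p q, p ≤ a → F p q → q ≤ b := by
      intro p q hp hF
      rcases h.cases p q hF with ⟨-, -, h₃, -⟩ | ⟨p', q', k₁, _, _, k₄, _⟩
      · exact h₃
      · exact absurd (hp.trans k₁) k₄.lt.not_ge
    exact (hb _ _ hp h₁).trans (h.swap.left_le hF)
  · intro z haz ih w hzw p₁ q₁ q hp h₁ hF
    -- The element covered by `w` that `cases` provides is equivalent to `z` but possibly different
    -- from it, as `≤` is only a preorder.
    have pred : ∀ q, F w q → ∃ q', F z q' ∧ q' ⋖ q := by
      intro q hq
      rcases h.cases w q hq with ⟨h₁, -⟩ | ⟨p', q', -, -, k₃, k₄, k₅⟩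
      · exact absurd (h₁.trans haz) hzw.lt.not_ge
      · refine ⟨q', h.inv _ _ _ _ k₃ ?_ ?_ le_rfl le_rfl, k₅⟩
        · rcases hA p' z with hc | hc
          · exact hc
          · by_contra hn
            exact hzw.2 (lt_of_le_not_ge hc hn) k₄.lt
        · rcases hA z p' with hc | hc
          · exact hc
          · by_contra hn
            exact k₄.2 (lt_of_le_not_ge hc hn) hzw.lt
    obtain ⟨q', hq', hcov⟩ := pred q hF
    by_cases hz : p₁ ≤ z
    · exact (ih p₁ q₁ q' hz h₁ hq').trans hcov.lt.le
    · have hlt : z < p₁ := lt_of_le_not_ge ((hA p₁ z).resolve_left hz) hz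
      have hw : w ≤ p₁ := by
        by_contra hn
        exact hzw.2 hlt (lt_of_le_not_ge hp hn)
      obtain ⟨q₂, hq₂, hcov₂⟩ := pred q₁ (h.inv _ _ _ _ h₁ hp hw le_rfl le_rfl)
      have := ih z q₂ q' le_rfl hq₂ hq'
      by_contra hn
      exact hcov₂.2 (this.trans_lt hcov.lt) (lt_of_le_not_ge ((hB q₁ q).resolve_left hn) hn)

end Chain

/-- The induction instances needed for a chain. -/
structure ChainInd (a : A) (b : B) (F : A → B → Prop) : Prop where
  total : Ind a fun p => ∃ q, F p q
  mono : Ind a fun p => ∀ p₁ q₁ q, p₁ ≤ p → F p₁ q₁ → F p q → q₁ ≤ q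

/-- Gluing an upward and a downward chain. -/
theorem glue_chains (hA : ∀ p q : A, p ≤ q ∨ q ≤ p) (hB : ∀ p q : B, p ≤ q ∨ q ≤ p)
    (sA : ∀ p : A, ∃ p', p ⋖ p') (sB : ∀ q : B, ∃ q', q ⋖ q')
    (pA : ∀ p : A, ∃ p', p' ⋖ p) (pB : ∀ q : B, ∃ q', q' ⋖ q) {a : A} {b : B}
    {F : A → B → Prop} {G : Aᵒᵈ → Bᵒᵈ → Prop} (hF : Chain a b F)
    (hG : Chain (OrderDual.toDual a) (OrderDual.toDual b) G) (iF : ChainInd a b F)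
    (iF' : ChainInd b a fun q p => F p q)
    (iG : ChainInd (OrderDual.toDual a) (OrderDual.toDual b) G)
    (iG' : ChainInd (OrderDual.toDual b) (OrderDual.toDual a) fun q p => G p q) :
    (∀ p : A, ∃ q : B, F p q ∨ G p q) ∧ (∀ q : B, ∃ p : A, F p q ∨ G p q) ∧
      ∀ (p p' : A) (q q' : B), (F p q ∨ G p q) → (F p' q' ∨ G p' q') → (p ≤ p' ↔ q ≤ q') := by
  have hA' : ∀ p q : Aᵒᵈ, p ≤ q ∨ q ≤ p := fun p q => hA q p
  have hB' : ∀ p q : Bᵒᵈ, p ≤ q ∨ q ≤ p := fun p q => hB q p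
  have sA' : ∀ p : Aᵒᵈ, ∃ p', p ⋖ p' := fun p =>
    (pA (OrderDual.ofDual p)).imp fun _ h => h.toDual
  have sB' : ∀ p : Bᵒᵈ, ∃ p', p ⋖ p' := fun p =>
    (pB (OrderDual.ofDual p)).imp fun _ h => h.toDual
  have mF : ∀ {p₁ p : A} {q₁ q : B}, F p₁ q₁ → F p q → (p₁ ≤ p ↔ q₁ ≤ q) := fun h₁ h =>
    ⟨hF.mono hA hB iF.mono h₁ h, hF.swap.mono hB hA iF'.mono h₁ h⟩
  have mG : ∀ {p₁ p : A} {q₁ q : B}, G p₁ q₁ → G p q → (p₁ ≤ p ↔ q₁ ≤ q) := fun h₁ h =>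
    ⟨hG.mono hA' hB' iG.mono h h₁, hG.swap.mono hB' hA' iG'.mono h h₁⟩
  have lF : ∀ {p : A} {q : B}, F p q → a ≤ p := hF.left_le
  have lF' : ∀ {p : A} {q : B}, F p q → b ≤ q := hF.swap.left_le
  have lG : ∀ {p : A} {q : B}, G p q → p ≤ a := hG.left_le
  have lG' : ∀ {p : A} {q : B}, G p q → q ≤ b := hG.swap.left_le
  refine ⟨fun p => ?_, fun q => ?_, ?_⟩
  · rcases hA a p with h | h
    · exact (hF.total iF.total sB p h).imp fun _ => Or.inl
    · exact (hG.total iG.total sB' p h).imp fun _ => Or.inr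
  · rcases hB b q with h | h
    · exact (hF.swap.total iF'.total sA q h).imp fun _ => Or.inl
    · exact (hG.swap.total iG'.total sA' q h).imp fun _ => Or.inr
  · rintro p p' q q' (h | h) (h' | h')
    · exact mF h h'
    -- With one pair from each chain, both are compared with the base pair `(a, b)`, which belongs
    -- to both chains.
    · constructor
      · intro hp
        exact ((mF h hF.base).1 (hp.trans (lG h'))).trans
          ((mG hG.base h').1 ((lF h).trans hp))
      · intro hq
        exact ((mF h hF.base).2 (hq.trans (lG' h'))).trans
          ((mG hG.base h').2 ((lF' h).trans hq))
    · exact iff_of_true ((lG h).trans (lF h')) ((lG' h).trans (lF' h'))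
    · exact mG h h'

end Chains

/-! ### Families closed under definability and inductive definitions -/

section FOClosed

variable {M : Type w}

/-- Closure of a family of relations under first-order definability. -/
structure FOClosed (X : SOPart M) : Prop where
  empty : ∀ n, ∅ ∈ X n
  atom : ∀ {m n : ℕ} {S : Set (Fin m → M)}, S ∈ X m → ∀ t : Fin m → Fin n,
    {v | (fun i => v (t i)) ∈ S} ∈ X n
  imp : ∀ {n : ℕ} {P Q : (Fin n → M) → Prop}, {v | P v} ∈ X n → {v | Q v} ∈ X n →
    {v | P v → Q v} ∈ X n
  all : ∀ {n : ℕ} {P : (Fin n → M) → M → Prop},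
    {v : Fin (n + 1) → M | P (Fin.tail v) (v 0)} ∈ X (n + 1) → {v | ∀ a, P v a} ∈ X n
  inst : ∀ {n : ℕ} {P : (Fin n → M) → M → Prop} (a : M),
    {v : Fin (n + 1) → M | P (Fin.tail v) (v 0)} ∈ X (n + 1) → {v | P v a} ∈ X n

/-- Closure of a family of relations under inductive definitions of binary relations. -/
def HasFix (X : SOPart M) : Prop :=
  ∀ Base ∈ X 2, ∀ Step ∈ X 4, ∃ F ∈ X 2, ∀ x y, ![x, y] ∈ F ↔
    ![x, y] ∈ Base ∨ ∃ x' y', ![x', y'] ∈ F ∧ ![x', y', x, y] ∈ Step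

namespace FOClosed

variable {X : SOPart M} (h : FOClosed X) {n : ℕ}

include h

theorem not {P : (Fin n → M) → Prop} (hP : {v | P v} ∈ X n) : {v | ¬ P v} ∈ X n :=
  h.imp hP (h.empty n)

theorem and {P Q : (Fin n → M) → Prop} (hP : {v | P v} ∈ X n) (hQ : {v | Q v} ∈ X n) :
    {v | P v ∧ Q v} ∈ X n := by
  convert h.not (h.imp hP (h.not hQ)) using 3
  tauto

theorem or {P Q : (Fin n → M) → Prop} (hP : {v | P v} ∈ X n) (hQ : {v | Q v} ∈ X n) :
    {v | P v ∨ Q v} ∈ X n := by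
  convert h.imp (h.not hP) hQ using 3
  tauto

theorem ex {P : (Fin n → M) → M → Prop}
    (hP : {v : Fin (n + 1) → M | P (Fin.tail v) (v 0)} ∈ X (n + 1)) :
    {v | ∃ a, P v a} ∈ X n := by
  have := h.not (h.all (P := fun v a => ¬ P v a) (h.not hP))
  convert this using 3
  simp

theorem atom₁ {S : Set (Fin 1 → M)} (hS : S ∈ X 1) (i : Fin n) : {v | ![v i] ∈ S} ∈ X n := by
  convert h.atom hS ![i] using 4
  exact (comp_vec₁ _ _).symm

theorem atom₂ {S : Set (Fin 2 → M)} (hS : S ∈ X 2) (i j : Fin n) :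
    {v | ![v i, v j] ∈ S} ∈ X n := by
  convert h.atom hS ![i, j] using 4
  exact (comp_vec₂ _ _ _).symm

theorem atom₄ {S : Set (Fin 4 → M)} (hS : S ∈ X 4) (i j k l : Fin n) :
    {v | ![v i, v j, v k, v l] ∈ S} ∈ X n := by
  convert h.atom hS ![i, j, k, l] using 4 with v
  funext l
  fin_cases l <;> rfl

theorem union {S T : Set (Fin n → M)} (hS : S ∈ X n) (hT : T ∈ X n) : S ∪ T ∈ X n :=
  h.or (P := fun v => v ∈ S) (Q := fun v => v ∈ T) hS hT

omit h in
/-- Parametric fixpoints given by a family of relations closed under adding pairs. -/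
theorem fix_of_family (𝓔 : Set (Set (Fin 2 → M))) (hemp : ∅ ∈ 𝓔)
    (hadj : ∀ E ∈ 𝓔, ∀ z, insert z E ∈ 𝓔) (Base : Set (Fin 2 → M)) (Step : Set (Fin 4 → M))
    {F : Set (Fin 2 → M)} (hF : ∀ z, z ∈ F ↔ ∃ E ∈ 𝓔, (∀ x y, ![x, y] ∈ E →
      ![x, y] ∈ Base ∨ ∃ x' y', ![x', y'] ∈ E ∧ ![x', y', x, y] ∈ Step) ∧ z ∈ E) (x y : M) :
    ![x, y] ∈ F ↔ ![x, y] ∈ Base ∨ ∃ x' y', ![x', y'] ∈ F ∧ ![x', y', x, y] ∈ Step := by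
  have hv : ∀ {x y x' y' : M}, ![x, y] = ![x', y'] → x = x' ∧ y = y' := fun h =>
    ⟨congrFun h 0, congrFun h 1⟩
  constructor
  · intro h
    obtain ⟨E, hE, hg, hz⟩ := (hF _).1 h
    refine (hg x y hz).imp_right ?_
    rintro ⟨x', y', hE', hS⟩
    exact ⟨x', y', (hF _).2 ⟨E, hE, hg, hE'⟩, hS⟩
  -- A pair in `Base` is justified on its own; a pair reached by `Step` can be added to any
  -- justified collection that contains its predecessor.
  · rintro (hB | ⟨x', y', hF', hS⟩)
    · refine (hF _).2 ⟨insert ![x, y] ∅, hadj _ hemp _, ?_, Set.mem_insert _ _⟩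
      rintro u v (huv | huv)
      · obtain ⟨rfl, rfl⟩ := hv huv
        exact Or.inl hB
      · exact huv.elim
    · obtain ⟨E, hE, hg, hz⟩ := (hF _).1 hF'
      refine (hF _).2 ⟨insert ![x, y] E, hadj _ hE _, ?_, Set.mem_insert _ _⟩
      rintro u v (huv | huv)
      · obtain ⟨rfl, rfl⟩ := hv huv
        exact Or.inr ⟨x', y', Set.mem_insert_of_mem _ hz, hS⟩
      · refine (hg u v huv).imp_right ?_
        rintro ⟨u', v', hE', hS⟩
        exact ⟨u', v', Set.mem_insert_of_mem _ hE', hS⟩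

end FOClosed

end FOClosed

/-! ### Existence of chains in the family -/

section ChainExistence

variable {M : Type w} {X : SOPart M} {A : Type u} {B : Type v} [Preorder A] [Preorder B]

/-- A preorder whose elements are named by elements of `M`, and whose order is in `X`. -/
structure Named (X : SOPart M) (π : A → M) (D : Set (Fin 1 → M)) (R : Set (Fin 2 → M)) : Prop where
  dom_mem : D ∈ X 1
  rel_mem : R ∈ X 2
  mem_dom : ∀ x, ![x] ∈ D ↔ ∃ p, π p = x
  le_iff : ∀ p q, p ≤ q ↔ ![π p, π q] ∈ R
  inj : Function.Injective π

/-- The covering relation of a named preorder. -/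
def covSet (D : Set (Fin 1 → M)) (R : Set (Fin 2 → M)) : Set (Fin 2 → M) :=
  {v | ![v 0] ∈ D ∧ ![v 1] ∈ D ∧ ![v 0, v 1] ∈ R ∧ ¬ ![v 1, v 0] ∈ R ∧ ∀ w, ![w] ∈ D →
    ![v 0, w] ∈ R → ¬ ![w, v 0] ∈ R → ![w, v 1] ∈ R → ![v 1, w] ∈ R}

theorem covSet_mem (h : FOClosed X) {D : Set (Fin 1 → M)} {R : Set (Fin 2 → M)} (hD : D ∈ X 1)
    (hR : R ∈ X 2) : covSet D R ∈ X 2 := by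
  refine h.and (h.atom₁ hD _) (h.and (h.atom₁ hD _) (h.and (h.atom₂ hR _ _)
    (h.and (h.not (h.atom₂ hR _ _)) (h.all ?_))))
  -- The bound variable `w` is coordinate `0`; the former coordinates `0` and `1` have become `1`
  -- and `2`. The same shift occurs at each use of `all`, `ex` and `inst`.
  exact h.imp (h.atom₁ hD _) (h.imp (h.atom₂ hR 1 0) (h.imp (h.not (h.atom₂ hR 0 1))
    (h.imp (h.atom₂ hR 0 2) (h.atom₂ hR 2 0))))

theorem Named.mem_covSet {π : A → M} {D : Set (Fin 1 → M)} {R : Set (Fin 2 → M)}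
    (h : Named X π D R) (p q : A) : ![π p, π q] ∈ covSet D R ↔ p ⋖ q := by
  have hd : ∀ p, ![π p] ∈ D := fun p => (h.mem_dom _).2 ⟨p, rfl⟩
  constructor
  · rintro ⟨-, -, h₁, h₂, h₃⟩
    refine ⟨lt_of_le_not_ge ((h.le_iff _ _).2 h₁) fun hn => h₂ ((h.le_iff _ _).1 hn), ?_⟩
    intro c hpc hcq
    have := h₃ (π c) (hd c) ((h.le_iff _ _).1 hpc.le) (fun hn => hpc.not_ge ((h.le_iff _ _).2 hn))
      ((h.le_iff _ _).1 hcq.le)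
    exact hcq.not_ge ((h.le_iff _ _).2 this)
  · intro hpq
    refine ⟨hd p, hd q, (h.le_iff _ _).1 hpq.lt.le, fun hn => hpq.lt.not_ge ((h.le_iff _ _).2 hn), ?_⟩
    intro w hw h₁ h₂ h₃
    obtain ⟨c, rfl⟩ := (h.mem_dom w).1 hw
    by_contra hn
    refine hpq.2 (c := c) (lt_of_le_not_ge ((h.le_iff _ _).2 h₁) fun k => h₂ ((h.le_iff _ _).1 k))
      (lt_of_le_not_ge ((h.le_iff _ _).2 h₃) fun k => hn ((h.le_iff _ _).1 k))

/-- The fixed-point equation alone yields the chain conditions; leastness plays no role. The guards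
in `Step`, which let steps start only at or above `a` and `b`, keep all of `F` above the base pair.
-/
theorem exists_chain (hX : FOClosed X) (hfix : HasFix X) {π₀ : A → M} {π₁ : B → M}
    {D₀ D₁ : Set (Fin 1 → M)} {R₀ R₁ : Set (Fin 2 → M)} (h₀ : Named X π₀ D₀ R₀)
    (h₁ : Named X π₁ D₁ R₁) (a : A) (b : B) :
    ∃ F ∈ X 2, (∀ x y, ![x, y] ∈ F → ![x] ∈ D₀ ∧ ![y] ∈ D₁) ∧
      Chain a b fun p q => ![π₀ p, π₁ q] ∈ F := by
  let Base : Set (Fin 2 → M) := {v | ![v 0] ∈ D₀ ∧ ![v 1] ∈ D₁ ∧ ![v 0, π₀ a] ∈ R₀ ∧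
    ![π₀ a, v 0] ∈ R₀ ∧ ![v 1, π₁ b] ∈ R₁ ∧ ![π₁ b, v 1] ∈ R₁}
  let Step : Set (Fin 4 → M) := {v | ![π₀ a, v 0] ∈ R₀ ∧ ![π₁ b, v 1] ∈ R₁ ∧
    ![v 0, v 2] ∈ covSet D₀ R₀ ∧ ![v 1, v 3] ∈ covSet D₁ R₁}
  have hB : Base ∈ X 2 :=
    hX.and (hX.atom₁ h₀.dom_mem _) (hX.and (hX.atom₁ h₁.dom_mem _)
      (hX.and (hX.inst (P := fun v c => ![v 0, c] ∈ R₀) (π₀ a) (hX.atom₂ h₀.rel_mem 1 0))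
      (hX.and (hX.inst (P := fun v c => ![c, v 0] ∈ R₀) (π₀ a) (hX.atom₂ h₀.rel_mem 0 1))
      (hX.and (hX.inst (P := fun v c => ![v 1, c] ∈ R₁) (π₁ b) (hX.atom₂ h₁.rel_mem 2 0))
      (hX.inst (P := fun v c => ![c, v 1] ∈ R₁) (π₁ b) (hX.atom₂ h₁.rel_mem 0 2))))))
  have hS : Step ∈ X 4 :=
    hX.and (hX.inst (P := fun v c => ![c, v 0] ∈ R₀) (π₀ a) (hX.atom₂ h₀.rel_mem 0 1))
      (hX.and (hX.inst (P := fun v c => ![c, v 1] ∈ R₁) (π₁ b) (hX.atom₂ h₁.rel_mem 0 2))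
      (hX.and (hX.atom₂ (covSet_mem hX h₀.dom_mem h₀.rel_mem) _ _)
      (hX.atom₂ (covSet_mem hX h₁.dom_mem h₁.rel_mem) _ _)))
  have mB : ∀ p q, ![π₀ p, π₁ q] ∈ Base ↔ p ≤ a ∧ a ≤ p ∧ q ≤ b ∧ b ≤ q := by
    intro p q
    rw [h₀.le_iff, h₀.le_iff, h₁.le_iff, h₁.le_iff]
    exact ⟨fun h => h.2.2, fun h => ⟨(h₀.mem_dom _).2 ⟨p, rfl⟩, (h₁.mem_dom _).2 ⟨q, rfl⟩, h⟩⟩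
  have mS : ∀ p' q' p q, ![π₀ p', π₁ q', π₀ p, π₁ q] ∈ Step ↔ a ≤ p' ∧ b ≤ q' ∧ p' ⋖ p ∧ q' ⋖ q := by
    intro p' q' p q
    rw [h₀.le_iff, h₁.le_iff, ← h₀.mem_covSet, ← h₁.mem_covSet]
    exact Iff.rfl
  obtain ⟨F, hF, hiff⟩ := hfix Base hB Step hS
  have hdom : ∀ x y, ![x, y] ∈ F → ![x] ∈ D₀ ∧ ![y] ∈ D₁ := by
    intro x y h
    rcases (hiff x y).1 h with h | ⟨x', y', -, h⟩
    · exact ⟨h.1, h.2.1⟩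
    · exact ⟨h.2.2.1.2.1, h.2.2.2.2.1⟩
  have hF' : ∀ p q, ![π₀ p, π₁ q] ∈ F ↔ (p ≤ a ∧ a ≤ p ∧ q ≤ b ∧ b ≤ q) ∨
      ∃ p' q', ![π₀ p', π₁ q'] ∈ F ∧ a ≤ p' ∧ b ≤ q' ∧ p' ⋖ p ∧ q' ⋖ q := by
    intro p q
    rw [hiff, mB]
    refine or_congr_right ⟨?_, ?_⟩
    · rintro ⟨x', y', h, hs⟩
      obtain ⟨p', rfl⟩ := (h₀.mem_dom x').1 (hdom _ _ h).1
      obtain ⟨q', rfl⟩ := (h₁.mem_dom y').1 (hdom _ _ h).2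
      exact ⟨p', q', h, (mS _ _ _ _).1 hs⟩
    · rintro ⟨p', q', h, hs⟩
      exact ⟨_, _, h, (mS _ _ _ _).2 hs⟩
  have hle : ∀ p q, ![π₀ p, π₁ q] ∈ F → a ≤ p ∧ b ≤ q := by
    intro p q h
    rcases (hF' p q).1 h with h | ⟨p', q', -, h₁, h₂, h₃, h₄⟩
    · exact ⟨h.2.1, h.2.2.2⟩
    · exact ⟨h₁.trans h₃.lt.le, h₂.trans h₄.lt.le⟩
  refine ⟨F, hF, hdom, ?_, ?_, ?_, ?_⟩
  · exact (hF' a b).2 (Or.inl ⟨le_rfl, le_rfl, le_rfl, le_rfl⟩)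
  · intro p q p' q' h hp hq
    exact (hF' _ _).2 (Or.inr ⟨p, q, h, (hle p q h).1, (hle p q h).2, hp, hq⟩)
  · intro p q h
    refine ((hF' p q).1 h).imp_right ?_
    rintro ⟨p', q', h, h₁, h₂, h₃, h₄⟩
    exact ⟨p', q', h₁, h₂, h, h₃, h₄⟩
  · intro p q p' q' h k₁ k₂ k₃ k₄
    refine (hF' p' q').2 (((hF' p q).1 h).imp ?_ ?_)
    · rintro ⟨h₁, h₂, h₃, h₄⟩
      exact ⟨k₂.trans h₁, h₂.trans k₁, k₄.trans h₃, h₄.trans k₃⟩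
    · rintro ⟨p₁, q₁, h, h₁, h₂, h₃, h₄⟩
      refine ⟨p₁, q₁, h, h₁, h₂, ⟨h₃.lt.trans_le k₁, fun c hc hc' => h₃.2 hc (hc'.trans_le k₂)⟩,
        ⟨h₄.lt.trans_le k₃, fun c hc hc' => h₄.2 hc (hc'.trans_le k₄)⟩⟩

/-- The two predicates that require induction are first-order in `F` and the two orders, so they
belong to `X`, and they respect equivalence in the preorder. -/
theorem chainInd_of_mem (hX : FOClosed X) {π₀ : A → M} {π₁ : B → M}
    {D₀ D₁ : Set (Fin 1 → M)} {R₀ R₁ : Set (Fin 2 → M)} (h₀ : Named X π₀ D₀ R₀)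
    (h₁ : Named X π₁ D₁ R₁) {a : A} {b : B} {F : Set (Fin 2 → M)} (hF : F ∈ X 2)
    (hdom : ∀ x y, ![x, y] ∈ F → ![x] ∈ D₀ ∧ ![y] ∈ D₁)
    (hc : Chain a b fun p q => ![π₀ p, π₁ q] ∈ F)
    (hind : ∀ P : A → Prop, (∀ p q, p ≤ q → q ≤ p → P p → P q) →
      {v : Fin 1 → M | ∃ p, π₀ p = v 0 ∧ P p} ∈ X 1 → Ind a P) :
    ChainInd a b fun p q => ![π₀ p, π₁ q] ∈ F := by
  have hiff : ∀ (P : A → Prop) (Q : M → Prop), (∀ p, P p ↔ Q (π₀ p)) →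
      (∀ x, Q x → ![x] ∈ D₀) → {v : Fin 1 → M | Q (v 0)} ∈ X 1 →
      {v : Fin 1 → M | ∃ p, π₀ p = v 0 ∧ P p} ∈ X 1 := by
    intro P Q hPQ hQ hQX
    convert hQX using 3 with v
    constructor
    · rintro ⟨p, hp, h⟩
      rw [← hp]
      exact (hPQ p).1 h
    · intro h
      obtain ⟨p, hp⟩ := (h₀.mem_dom _).1 (hQ _ h)
      exact ⟨p, hp, (hPQ p).2 (hp ▸ h)⟩
  constructor
  · refine hind _ ?_ (hiff _ (fun x => ∃ y, ![x, y] ∈ F) ?_ ?_ ?_)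
    · rintro p q hpq hqp ⟨r, hr⟩
      exact ⟨r, hc.inv _ _ _ _ hr hpq hqp le_rfl le_rfl⟩
    · intro p
      constructor
      · rintro ⟨q, hq⟩
        exact ⟨_, hq⟩
      · rintro ⟨y, hy⟩
        obtain ⟨q, rfl⟩ := (h₁.mem_dom _).1 (hdom _ _ hy).2
        exact ⟨q, hy⟩
    · rintro x ⟨y, hy⟩
      exact (hdom _ _ hy).1
    · exact hX.ex (hX.atom₂ hF 1 0)
  · refine hind _ ?_ (hiff _ (fun x => ![x] ∈ D₀ ∧ ∀ x₁ y₁ y, ![x₁, x] ∈ R₀ → ![x₁, y₁] ∈ F →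
      ![x, y] ∈ F → ![y₁, y] ∈ R₁) ?_ ?_ ?_)
    · intro p q hpq hqp h p₁ q₁ r hp₁ hF₁ hr
      exact h p₁ q₁ r (hp₁.trans hqp) hF₁ (hc.inv _ _ _ _ hr hqp hpq le_rfl le_rfl)
    · intro p
      constructor
      · intro h
        refine ⟨(h₀.mem_dom _).2 ⟨p, rfl⟩, fun x₁ y₁ y hx h₂ h₃ => ?_⟩
        obtain ⟨p₁, rfl⟩ := (h₀.mem_dom _).1 (hdom _ _ h₂).1
        obtain ⟨q₁, rfl⟩ := (h₁.mem_dom _).1 (hdom _ _ h₂).2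
        obtain ⟨q, rfl⟩ := (h₁.mem_dom _).1 (hdom _ _ h₃).2
        exact (h₁.le_iff _ _).1 (h p₁ q₁ q ((h₀.le_iff _ _).2 hx) h₂ h₃)
      · rintro ⟨-, h⟩ p₁ q₁ q hp h₂ h₃
        exact (h₁.le_iff _ _).2 (h _ _ _ ((h₀.le_iff _ _).1 hp) h₂ h₃)
    · exact fun x h => h.1
    · refine hX.and (hX.atom₁ h₀.dom_mem _) (hX.all (hX.all (hX.all ?_)))
      exact hX.imp (hX.atom₂ h₀.rel_mem 2 3) (hX.imp (hX.atom₂ hF 2 1)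
        (hX.imp (hX.atom₂ hF 3 0) (hX.atom₂ h₁.rel_mem 1 0)))

end ChainExistence

/-! ### Internal discrete orders -/

section InternalOrder

variable {M : Type w} {X : SOPart M} {N : InternalStr FirstOrder.Language.order M}

theorem InternalStr.leR_toElem (a b : N.Dom) :
    leR (N.toElem a) (N.toElem b) ↔ ![a.1, b.1] ∈ N.rel orderRel.le := by
  have h := N.relMap_toElem (orderRel.le : FirstOrder.Language.order.Relations 2) ![a, b]
  have h₁ : (fun i => N.toElem (![a, b] i)) = ![N.toElem a, N.toElem b] := by
    funext i
    fin_cases i <;> rfl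
  have h₂ : (fun i => (![a, b] i).1) = ![a.1, b.1] := by
    funext i
    fin_cases i <;> rfl
  exact (iff_of_eq (congrArg (Structure.RelMap (L := FirstOrder.Language.order) orderRel.le)
    h₁.symm)).trans (h.trans (iff_of_eq (congrArg (fun v => v ∈ N.rel orderRel.le) h₂)))

theorem InternalStr.Strong.discreteOrder (hm : N.MemIn X) (hs : N.Strong X intScheme) :
    DiscreteOrder (leR (A := N.Elem)) := by
  -- The order axioms do not mention `P`, so one instance suffices; the full set qualifies because
  -- its pullback is the domain of `N`.
  refine ((intScheme_holds_iff _).1 (hs Set.univ ?_)).1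
  change N.pullback (k := 1) Set.univ ∈ X 1
  convert hm.1 using 1
  refine Set.ext fun v => ?_
  have hv : v = ![v 0] := List.ofFn_inj.1 rfl
  constructor
  · rintro ⟨h, -⟩
    rw [hv]
    exact h 0
  · intro h
    refine ⟨fun i => ?_, trivial⟩
    rw [hv] at h
    have : i = 0 := Subsingleton.elim (α := Fin 1) _ _
    rw [this]
    exact h

/-- The preorder on the domain of an internal discrete order. -/
noncomputable abbrev InternalStr.domPreorder (h : DiscreteOrder (leR (A := N.Elem))) :
    Preorder N.Dom :=
  letI := h.toLinearOrder
  Preorder.lift N.toElem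

theorem InternalStr.covBy_iff (h : DiscreteOrder (leR (A := N.Elem))) (a b : N.Dom) :
    letI := N.domPreorder h
    a ⋖ b ↔ Succ' leR (N.toElem a) (N.toElem b) := by
  let _ := N.domPreorder h
  rw [← succ'_iff_covBy]
  refine and_congr_right fun _ => ⟨fun k q => ?_, fun k c => k (N.toElem c)⟩
  obtain ⟨c, rfl⟩ := N.exists_toElem q
  exact k c

theorem InternalStr.named (h : DiscreteOrder (leR (A := N.Elem))) (hm : N.MemIn X) :
    letI := N.domPreorder h
    Named X (fun p : N.Dom => p.1) N.dom (N.rel orderRel.le) := by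
  let _ := N.domPreorder h
  exact ⟨hm.1, hm.2.2.1 2 orderRel.le, fun x => ⟨fun hx => ⟨⟨x, hx⟩, rfl⟩, by
    rintro ⟨p, rfl⟩
    exact p.2⟩, N.leR_toElem, Subtype.val_injective⟩

/-- With the reversed order also named in `X`, downward chains are upward chains of the dual. -/
theorem InternalStr.named_dual (hX : FOClosed X) (h : DiscreteOrder (leR (A := N.Elem)))
    (hm : N.MemIn X) :
    letI := N.domPreorder h
    Named X (fun p : N.Domᵒᵈ => (OrderDual.ofDual p).1) N.dom
      {v | ![v 1, v 0] ∈ N.rel orderRel.le} := by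
  let _ := N.domPreorder h
  exact ⟨hm.1, hX.atom₂ (hm.2.2.1 2 orderRel.le) 1 0, fun x => ⟨fun hx => ⟨⟨x, hx⟩, rfl⟩, by
    rintro ⟨p, rfl⟩
    exact p.2⟩, fun p q => N.leR_toElem q p, Subtype.val_injective⟩

theorem InternalStr.Strong.induction (h : DiscreteOrder (leR (A := N.Elem)))
    (hs : N.Strong X intScheme) {P : N.Dom → Prop}
    (hP : ∀ p q, N.toElem p = N.toElem q → P p → P q)
    (hPX : {v : Fin 1 → M | ∃ p : N.Dom, p.1 = v 0 ∧ P p} ∈ X 1) :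
    letI := N.domPreorder h
    (∀ a : N.Dom, Ind a P) ∧ ∀ a : N.Dom, Ind (A := N.Domᵒᵈ) (OrderDual.toDual a) P := by
  let _ := N.domPreorder h
  let Q : N.Elem → Prop := fun q => ∃ a, N.toElem a = q ∧ P a
  have hQ : ∀ a, Q (N.toElem a) ↔ P a := fun a =>
    ⟨fun ⟨b, hb, h⟩ => hP b a hb h, fun h => ⟨a, rfl, h⟩⟩
  have key := (intScheme_holds_iff _).1 (hs {q | Q (q (0 : Fin 1))} ?_)
  · obtain ⟨-, hu, hd⟩ := key
    constructor
    · intro a ha hstep z haz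
      refine (hQ z).1 (hu _ ((hQ a).2 ha) ?_ _ haz)
      intro z haz hz w hw
      obtain ⟨z, rfl⟩ := N.exists_toElem z
      obtain ⟨w, rfl⟩ := N.exists_toElem w
      exact (hQ w).2 (hstep z haz ((hQ z).1 hz) w ((N.covBy_iff h _ _).2 hw))
    · intro a ha hstep z haz
      refine (hQ z).1 (hd _ ((hQ a).2 ha) ?_ _ haz)
      intro z haz hz w hw
      obtain ⟨z, rfl⟩ := N.exists_toElem z
      obtain ⟨w, rfl⟩ := N.exists_toElem w
      exact (hQ w).2 (hstep z haz ((hQ z).1 hz) w ((N.covBy_iff h w z).2 hw).toDual)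
  · change N.pullback (k := 1) {q | Q (q 0)} ∈ X 1
    convert hPX using 1
    refine Set.ext fun v => ?_
    constructor
    · rintro ⟨k, hk⟩
      exact ⟨⟨v 0, k 0⟩, rfl, (hQ _).1 hk⟩
    · rintro ⟨p, hp, hPp⟩
      have hd : ∀ i : Fin 1, ![v i] ∈ N.dom := by
        intro i
        have : i = 0 := Subsingleton.elim _ _
        rw [this, ← hp]
        exact p.2
      refine ⟨hd, (hQ _).2 ?_⟩
      have : (⟨v 0, hd 0⟩ : N.Dom) = p := Subtype.ext hp.symm
      exact this ▸ hPp

end InternalOrder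

/-! ### The isomorphism between two strong models -/

section Categoricity

variable {M : Type w} {X : SOPart M}

/-- The upward and the downward chain through an arbitrary pair `(a, b)` together exhaust both
orders, and their union is the isomorphism. Induction in `N₀` makes it total and induction in `N₁`
makes it surjective; each also gives one direction of the comparison of orders. -/
theorem exists_iso_of_strong (hX : FOClosed X) (hfix : HasFix X)
    {N₀ N₁ : InternalStr FirstOrder.Language.order M} (m₀ : N₀.MemIn X) (m₁ : N₁.MemIn X)
    (s₀ : N₀.Strong X intScheme) (s₁ : N₁.Strong X intScheme) : ∃ F ∈ X 2, N₀.IsIso N₁ F := by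
  have h₀ := s₀.discreteOrder m₀
  have h₁ := s₁.discreteOrder m₁
  let _ := N₀.domPreorder h₀
  let _ := N₁.domPreorder h₁
  obtain ⟨a₀, ha⟩ := N₀.nonempty
  obtain ⟨b₀, hb⟩ := N₁.nonempty
  let a : N₀.Dom := ⟨a₀, ha⟩
  let b : N₁.Dom := ⟨b₀, hb⟩
  have e : ∀ {N : InternalStr FirstOrder.Language.order M}, DiscreteOrder (leR (A := N.Elem)) →
      ∀ {p q : N.Dom}, N.toElem p = N.toElem q → leR (N.toElem p) (N.toElem q) := by
    intro N h p q hpq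
    rw [hpq]
    exact h.refl _
  have n₀ := N₀.named h₀ m₀
  have n₁ := N₁.named h₁ m₁
  have d₀ := N₀.named_dual hX h₀ m₀
  have d₁ := N₁.named_dual hX h₁ m₁
  have i₀ : ∀ P : N₀.Dom → Prop, (∀ p q : N₀.Dom, p ≤ q → q ≤ p → P p → P q) →
      {v : Fin 1 → M | ∃ p : N₀.Dom, p.1 = v 0 ∧ P p} ∈ X 1 →
      Ind a P ∧ Ind (A := N₀.Domᵒᵈ) (OrderDual.toDual a) P := by
    intro P hP hPX
    have := s₀.induction h₀ (fun p q hpq => hP p q (e h₀ hpq) (e h₀ hpq.symm)) hPX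
    exact ⟨this.1 a, this.2 a⟩
  have i₁ : ∀ P : N₁.Dom → Prop, (∀ p q : N₁.Dom, p ≤ q → q ≤ p → P p → P q) →
      {v : Fin 1 → M | ∃ p : N₁.Dom, p.1 = v 0 ∧ P p} ∈ X 1 →
      Ind b P ∧ Ind (A := N₁.Domᵒᵈ) (OrderDual.toDual b) P := by
    intro P hP hPX
    have := s₁.induction h₁ (fun p q hpq => hP p q (e h₁ hpq) (e h₁ hpq.symm)) hPX
    exact ⟨this.1 b, this.2 b⟩
  obtain ⟨F, hF, Fdom, cF⟩ := exists_chain hX hfix n₀ n₁ a b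
  obtain ⟨G, hG, Gdom, cG⟩ := exists_chain hX hfix d₀ d₁ (OrderDual.toDual a) (OrderDual.toDual b)
  have iF := chainInd_of_mem hX n₀ n₁ hF Fdom cF fun P hP hPX => (i₀ P hP hPX).1
  have iG := chainInd_of_mem hX d₀ d₁ hG Gdom cG
    fun P hP hPX => (i₀ P (fun p q h h' => hP p q h' h) hPX).2
  have iF' := chainInd_of_mem hX n₁ n₀ (F := {v | ![v 1, v 0] ∈ F}) (hX.atom₂ hF 1 0)
    (fun x y h => (Fdom y x h).symm) cF.swap fun P hP hPX => (i₁ P hP hPX).1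
  have iG' := chainInd_of_mem hX d₁ d₀ (F := {v | ![v 1, v 0] ∈ G}) (hX.atom₂ hG 1 0)
    (fun x y h => (Gdom y x h).symm) cG.swap
    fun P hP hPX => (i₁ P (fun p q h h' => hP p q h' h) hPX).2
  have tot : ∀ {N : InternalStr FirstOrder.Language.order M} (h : DiscreteOrder (leR (A := N.Elem))),
      letI := N.domPreorder h
      (∀ p q : N.Dom, p ≤ q ∨ q ≤ p) ∧ (∀ p : N.Dom, ∃ q, p ⋖ q) ∧ ∀ p : N.Dom, ∃ q, q ⋖ p := by
    intro N h
    let _ := N.domPreorder h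
    refine ⟨fun p q => h.total _ _, fun p => ?_, fun p => ?_⟩
    · obtain ⟨q, hq⟩ := h.exists_succ (N.toElem p)
      obtain ⟨q, rfl⟩ := N.exists_toElem q
      exact ⟨q, (N.covBy_iff h _ _).2 hq⟩
    · obtain ⟨q, hq⟩ := h.exists_pred (N.toElem p)
      obtain ⟨q, rfl⟩ := N.exists_toElem q
      exact ⟨q, (N.covBy_iff h _ _).2 hq⟩
  obtain ⟨htot, hsurj, hle⟩ := glue_chains (tot h₀).1 (tot h₁).1 (tot h₀).2.1 (tot h₁).2.1
    (tot h₀).2.2 (tot h₁).2.2 cF cG iF iF' iG iG'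
  have hdom : ∀ x y, ![x, y] ∈ F ∪ G → ![x] ∈ N₀.dom ∧ ![y] ∈ N₁.dom := fun x y h =>
    h.elim (Fdom x y) (Gdom x y)
  have hrel : ∀ x y x' y', ![x, y] ∈ F ∪ G → ![x', y'] ∈ F ∪ G →
      (![x, x'] ∈ N₀.rel orderRel.le ↔ ![y, y'] ∈ N₁.rel orderRel.le) := by
    intro x y x' y' h h'
    have := hle ⟨x, (hdom _ _ h).1⟩ ⟨x', (hdom _ _ h').1⟩ ⟨y, (hdom _ _ h).2⟩ ⟨y', (hdom _ _ h').2⟩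
      h h'
    exact (N₀.leR_toElem _ _).symm.trans (this.trans (N₁.leR_toElem _ _))
  -- By antisymmetry, internal equality is determined by `≤`, so it is enough that `F ∪ G` respects
  -- the order.
  have heq : ∀ {N : InternalStr FirstOrder.Language.order M}, DiscreteOrder (leR (A := N.Elem)) →
      ∀ x x', ![x] ∈ N.dom → ![x'] ∈ N.dom → (![x, x'] ∈ N.eq ↔
        ![x, x'] ∈ N.rel orderRel.le ∧ ![x', x] ∈ N.rel orderRel.le) := by
    intro N h x x' hx hx'
    rw [← N.leR_toElem ⟨x, hx⟩ ⟨x', hx'⟩, ← N.leR_toElem ⟨x', hx'⟩ ⟨x, hx⟩]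
    refine (N.toElem_eq (a := ⟨x, hx⟩) (b := ⟨x', hx'⟩)).symm.trans
      ⟨fun e => ?_, fun e => h.antisymm _ _ e.1 e.2⟩
    rw [e]
    exact ⟨h.refl _, h.refl _⟩
  refine ⟨F ∪ G, hX.union hF hG, InternalStr.isIso_iff.2 ⟨hdom, ?_, ?_, ?_, ?_, ?_, ?_⟩⟩
  · intro x hx
    obtain ⟨q, hq⟩ := htot ⟨x, hx⟩
    exact ⟨q.1, hq⟩
  · intro y hy
    obtain ⟨q, hq⟩ := hsurj ⟨y, hy⟩
    exact ⟨q.1, hq⟩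
  · intro x y x' y' h h'
    rw [heq h₀ _ _ (hdom _ _ h).1 (hdom _ _ h').1, heq h₁ _ _ (hdom _ _ h).2 (hdom _ _ h').2,
      hrel _ _ _ _ h h', hrel _ _ _ _ h' h]
  · intro x y x' y' h hx' hy' hx hy
    rw [heq h₀ _ _ (hdom _ _ h).1 hx'] at hx
    rw [heq h₁ _ _ (hdom _ _ h).2 hy'] at hy
    let p : N₀.Dom := ⟨x, (hdom _ _ h).1⟩
    let p' : N₀.Dom := ⟨x', hx'⟩
    let q : N₁.Dom := ⟨y, (hdom _ _ h).2⟩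
    let q' : N₁.Dom := ⟨y', hy'⟩
    have e₁ : p ≤ p' := (N₀.leR_toElem p p').2 hx.1
    have e₂ : p' ≤ p := (N₀.leR_toElem p' p).2 hx.2
    have e₃ : q ≤ q' := (N₁.leR_toElem q q').2 hy.1
    have e₄ : q' ≤ q := (N₁.leR_toElem q' q).2 hy.2
    rcases h with h | h
    · exact Or.inl (cF.inv p q p' q' h e₁ e₂ e₃ e₄)
    · exact Or.inr (cG.inv (OrderDual.toDual p) (OrderDual.toDual q) (OrderDual.toDual p')
        (OrderDual.toDual q') h e₂ e₁ e₄ e₃)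
  · intro n R x y h
    cases R
    have hx : ∀ z : Fin 2 → M, z = ![z 0, z 1] := fun z => List.ofFn_inj.1 rfl
    rw [hx x, hx y]
    exact hrel _ _ _ _ (h 0) (h 1)
  · intro n f
    exact isEmptyElim f

end Categoricity

/-! ### Predicative comprehension -/

section Predicative

variable {B : FirstOrder.Language.{u, v}} {M : Type w} [B.Structure M] {X : SOPart M}

/-- Each member of `X` has its own symbol, so `X` consists of exactly the parametrically definable
relations and inherits their closure properties. -/
theorem PredComp.mem_iff (h : PredComp B X) {n : ℕ} {S : Set (Fin n → M)} :
    S ∈ X n ↔ (Set.univ : Set M).Definable (B.sum (paramLang X)) S := by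
  refine ⟨fun hS => ?_, h n S⟩
  refine (Set.Definable.mono (Set.empty_definable_iff.2 ⟨(Relations.formula
    (L := B.sum (paramLang X)) (Sum.inr ⟨S, hS⟩) fun i => Term.var i), ?_⟩) (Set.empty_subset _))
  ext v
  exact Iff.symm (Iff.trans Formula.realize_rel Iff.rfl)

theorem PredComp.foClosed (h : PredComp B X) : FOClosed X where
  empty n := h.mem_iff.2 Set.definable_empty
  atom hS t := h.mem_iff.2 ((h.mem_iff.1 hS).preimage_comp t)
  imp {n P Q} hP hQ := by
    rw [h.mem_iff] at *
    convert hP.compl.union hQ using 1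
    ext v
    exact imp_iff_not_or
  all {n P} hP := by
    rw [h.mem_iff] at *
    convert (hP.compl.image_comp Fin.succ).compl using 1
    ext v
    simp only [Set.mem_compl_iff, Set.mem_image, not_exists, not_and, Set.mem_ofPred_eq]
    constructor
    · rintro hv w hw rfl
      exact hw (hv _)
    · intro hv a
      by_contra hn
      exact hv (Fin.cons a v) hn rfl
  inst {n P} a hP := by
    rw [h.mem_iff] at *
    have ha : (Set.univ : Set M).Definable (B.sum (paramLang X)) {v : Fin (n + 1) → M | v 0 = a} := by
      refine ⟨Term.equal (Term.var 0) (Constants.term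
        (Sum.inr ⟨a, trivial⟩ : ((B.sum (paramLang X))[[(Set.univ : Set M)]]).Constants)), ?_⟩
      ext v
      exact Iff.symm (Iff.trans Formula.realize_equal Iff.rfl)
    -- Fixing the first argument at `a` is the projection of the slice `v 0 = a`.
    convert (hP.inter ha).image_comp Fin.succ using 1
    ext v
    constructor
    · exact fun hv => ⟨Fin.cons a v, ⟨hv, rfl⟩, rfl⟩
    · rintro ⟨v, ⟨hv, rfl⟩, rfl⟩
      exact hv

theorem PredComp.eq_mem (h : PredComp B X) : {v : Fin 2 → M | v 0 = v 1} ∈ X 2 := by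
  rw [h.mem_iff]
  refine Set.Definable.mono (Set.empty_definable_iff.2 ⟨Term.equal (Term.var 0) (Term.var 1), ?_⟩)
    (Set.empty_subset _)
  ext v
  simp [Formula.realize_equal]

end Predicative

/-! ### Coding in adjunctive set theory -/

section Adjunctive

variable {M : Type w}

/-- `u` is an unordered pair of `x` and `y` for a membership relation. -/
def IsUPair (mem : M → M → Prop) (u x y : M) : Prop := ∀ w, mem w u ↔ w = x ∨ w = y

/-- `z` is a Kuratowski pair of `x` and `y` for a membership relation. -/
def IsOPair (mem : M → M → Prop) (z x y : M) : Prop :=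
  ∃ u v, IsUPair mem z u v ∧ IsUPair mem u x x ∧ IsUPair mem v x y

/-- Kuratowski's argument compares only members. It does not need extensionality, without which a
pair of elements may have many codes. -/
theorem IsOPair.inj {mem : M → M → Prop} {z x y x' y' : M} (h : IsOPair mem z x y)
    (h' : IsOPair mem z x' y') : x = x' ∧ y = y' := by
  obtain ⟨u, v, hz, hu, hv⟩ := h
  obtain ⟨u', v', hz', hu', hv'⟩ := h'
  simp only [IsUPair, or_self] at *
  have hx : x = x' := by
    rcases (hz u').1 ((hz' u').2 (Or.inl rfl)) with rfl | rfl
    · exact (hu' x).1 ((hu x).2 rfl)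
    · exact (hu' x).1 ((hv x).2 (Or.inl rfl))
  subst hx
  refine ⟨rfl, ?_⟩
  have k₁ := (hz v').1 ((hz' v').2 (Or.inr rfl))
  have k₂ := (hz' v).1 ((hz v).2 (Or.inr rfl))
  have a₁ := hv y
  have a₂ := hv y'
  have b₁ := hv' y
  have b₂ := hv' y'
  have c₁ := hu y
  have c₂ := hu y'
  have d₁ := hu' y
  have d₂ := hu' y'
  grind

/-- Closure of the universe under the operations of adjunctive set theory. -/
structure Adjunctive (mem : M → M → Prop) : Prop where
  empty : ∃ x, ∀ y, ¬ mem y x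
  adjoin : ∀ x y, ∃ z, ∀ w, mem w z ↔ mem w x ∨ w = y

theorem Adjunctive.exists_uPair {mem : M → M → Prop} (h : Adjunctive mem) (x y : M) :
    ∃ u, IsUPair mem u x y := by
  obtain ⟨e, he⟩ := h.empty
  obtain ⟨s, hs⟩ := h.adjoin e x
  obtain ⟨u, hu⟩ := h.adjoin s y
  refine ⟨u, fun w => ?_⟩
  rw [hu, hs]
  simp [he]

theorem Adjunctive.exists_oPair {mem : M → M → Prop} (h : Adjunctive mem) (x y : M) :
    ∃ z, IsOPair mem z x y := by
  obtain ⟨u, hu⟩ := h.exists_uPair x x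
  obtain ⟨v, hv⟩ := h.exists_uPair x y
  obtain ⟨z, hz⟩ := h.exists_uPair u v
  exact ⟨z, u, v, hz, hu, hv⟩

theorem FOClosed.iff {X : SOPart M} (h : FOClosed X) {n : ℕ} {P Q : (Fin n → M) → Prop}
    (hP : {v | P v} ∈ X n) (hQ : {v | Q v} ∈ X n) : {v | P v ↔ Q v} ∈ X n := by
  convert h.and (h.imp hP hQ) (h.imp hQ hP) using 3
  exact iff_iff_implies_and_implies

theorem FOClosed.eq₂ {X : SOPart M} (h : FOClosed X) (he : {v : Fin 2 → M | v 0 = v 1} ∈ X 2)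
    {n : ℕ} (i j : Fin n) : {v | v i = v j} ∈ X n :=
  h.atom₂ he i j

theorem isUPair_mem {X : SOPart M} (h : FOClosed X) (he : {v : Fin 2 → M | v 0 = v 1} ∈ X 2)
    {mem : M → M → Prop} (hm : {v : Fin 2 → M | mem (v 0) (v 1)} ∈ X 2) {n : ℕ} (i j k : Fin n) :
    {v | IsUPair mem (v i) (v j) (v k)} ∈ X n :=
  h.all (h.iff (h.atom₂ hm 0 i.succ) (h.or (h.eq₂ he 0 j.succ) (h.eq₂ he 0 k.succ)))

theorem isOPair_mem {X : SOPart M} (h : FOClosed X) (he : {v : Fin 2 → M | v 0 = v 1} ∈ X 2)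
    {mem : M → M → Prop} (hm : {v : Fin 2 → M | mem (v 0) (v 1)} ∈ X 2) {n : ℕ} (i j k : Fin n) :
    {v | IsOPair mem (v i) (v j) (v k)} ∈ X n :=
  h.ex (h.ex (h.and (isUPair_mem h he hm i.succ.succ 1 0)
    (h.and (isUPair_mem h he hm 1 j.succ.succ j.succ.succ)
      (isUPair_mem h he hm 0 j.succ.succ k.succ.succ))))

/-- A set `s` codes the relation `C s` of all pairs with some Kuratowski code in `s`, and adjunction
adds one pair to a coded relation. As codes are elements of `M`, the union of the justified coded
relations is defined without second-order quantifiers. -/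
theorem Adjunctive.hasFix {X : SOPart M} (h : FOClosed X)
    (he : {v : Fin 2 → M | v 0 = v 1} ∈ X 2) {mem : M → M → Prop}
    (hm : {v : Fin 2 → M | mem (v 0) (v 1)} ∈ X 2) (ha : Adjunctive mem) : HasFix X := by
  intro Base hB Step hS
  let C : M → M → M → Prop := fun s x y => ∃ z, mem z s ∧ IsOPair mem z x y
  have hC : ∀ {n : ℕ} (i j k : Fin n), {v | C (v i) (v j) (v k)} ∈ X n := fun i j k =>
    h.ex (h.and (h.atom₂ hm 0 i.succ) (isOPair_mem h he hm 0 j.succ k.succ))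
  have hv : ∀ v : Fin 2 → M, v = ![v 0, v 1] := fun v => List.ofFn_inj.1 rfl
  let F : Set (Fin 2 → M) := {v | ∃ s, (∀ x y, C s x y → ![x, y] ∈ Base ∨
    ∃ x' y', C s x' y' ∧ ![x', y', x, y] ∈ Step) ∧ C s (v 0) (v 1)}
  have hF : F ∈ X 2 :=
    h.ex (h.and (h.all (h.all (h.imp (hC 2 1 0) (h.or (h.atom₂ hB 1 0)
      (h.ex (h.ex (h.and (hC 4 1 0) (h.atom₄ hS 1 0 3 2)))))))) (hC 0 1 2))
  refine ⟨F, hF, FOClosed.fix_of_family {E | ∃ s, E = {v | C s (v 0) (v 1)}} ?_ ?_ Base Step ?_⟩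
  · obtain ⟨e, he⟩ := ha.empty
    refine ⟨e, (Set.eq_empty_iff_forall_notMem.2 ?_).symm⟩
    rintro v ⟨z, hz, -⟩
    exact he z hz
  · rintro E ⟨s, rfl⟩ p
    obtain ⟨z, hz⟩ := ha.exists_oPair (p 0) (p 1)
    obtain ⟨s', hs'⟩ := ha.adjoin s z
    refine ⟨s', Set.ext fun v => ?_⟩
    constructor
    · rintro (rfl | ⟨z', hz', hp⟩)
      · exact ⟨z, (hs' z).2 (Or.inr rfl), hz⟩
      · exact ⟨z', (hs' z').2 (Or.inl hz'), hp⟩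
    · rintro ⟨z', hz', hp⟩
      rcases (hs' z').1 hz' with hz' | rfl
      · exact Or.inr ⟨z', hz', hp⟩
      · obtain ⟨h₁, h₂⟩ := hp.inj hz
        refine Or.inl ?_
        rw [hv v, hv p, h₁, h₂]
  · intro z
    constructor
    · rintro ⟨s, hs, hz⟩
      exact ⟨_, ⟨s, rfl⟩, hs, hz⟩
    · rintro ⟨E, ⟨s, rfl⟩, hs, hz⟩
      exact ⟨s, hs, hz⟩

theorem adjunctive_of_models [setLang.Structure M] (h : M ⊨ AS) :
    Adjunctive fun x y : M => Structure.RelMap (L := setLang) MemSym.mem ![x, y] := by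
  have hm : ∀ {n : ℕ} (x y : Fin n) (v : Empty → M) (xs : Fin n → M),
      (memF x y).Realize v xs ↔
        Structure.RelMap (L := setLang) MemSym.mem ![xs x, xs y] := by
    intro n x y v xs
    exact BoundedFormula.realize_rel₂.trans Iff.rfl
  have heq : ∀ (v : Empty → M) (xs : Fin 4 → M),
      ((&3 =' &1) : setLang.BoundedFormula Empty 4).Realize v xs ↔ xs 3 = xs 1 := by
    intro v xs
    rw [BoundedFormula.realize_bdEqual]
    rfl
  have h₁ := h.realize_of_mem _ (Or.inl rfl : _ ∈ AS)
  have h₂ := h.realize_of_mem _ (Or.inr rfl : _ ∈ AS)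
  simp only [Sentence.Realize, Formula.Realize, BoundedFormula.realize_all,
    BoundedFormula.realize_ex, BoundedFormula.realize_not, BoundedFormula.realize_iff,
    BoundedFormula.realize_sup, hm, heq] at h₁ h₂
  exact ⟨h₁, h₂⟩

theorem intScheme_categoricalIn_AS :
    Scheme.CategoricalIn.{0, 0, 0, 0, w} intScheme AS := by
  intro M _ X hM hX N₀ N₁ m₀ m₁ s₀ s₁
  have hc := hX.foClosed
  refine exists_iso_of_strong hc (Adjunctive.hasFix hc hX.eq_mem ?_ (adjunctive_of_models hM))
    m₀ m₁ s₀ s₁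
  refine hX.mem_iff.2 (Set.Definable.mono (Set.empty_definable_iff.2 ⟨Relations.formula₂
    (L := setLang.sum (paramLang X)) (Sum.inl MemSym.mem) (Term.var 0) (Term.var 1), ?_⟩)
    (Set.empty_subset _))
  ext v
  exact Iff.symm (Iff.trans Formula.realize_rel₂ Iff.rfl)

end Adjunctive

/-! ### Henkin models of second-order logic -/

section Henkin

variable {M : Type w} {X : SOPart M}

theorem IsHenkin.exists_assignment (h : IsHenkin X) : ∃ V : ∀ n : ℕ, ℕ → Set (Fin n → M),
    ∀ n i, V n i ∈ X n := by
  choose d hd using h.1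
  exact ⟨fun n _ => d n, fun n _ => hd n⟩

theorem update_assignment_mem {V : ∀ n : ℕ, ℕ → Set (Fin n → M)} (hV : ∀ n i, V n i ∈ X n)
    {m : ℕ} {W : ℕ → Set (Fin m → M)} (hW : ∀ i, W i ∈ X m) (n i : ℕ) :
    Function.update V m W n i ∈ X n := by
  by_cases h : n = m
  · subst h
    rw [Function.update_self]
    exact hW i
  · rw [Function.update_of_ne h]
    exact hV n i

/-- The variables of an atomic formula with a new variable in front. -/
def consVars (n : ℕ) : Fin (n + 1) → ℕ := Fin.cases n fun i => i

theorem consVars_apply (n : ℕ) (x : Fin n → M) (w : ℕ → M) :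
    (fun i => (if h : consVars n i < n then x ⟨consVars n i, h⟩ else w (consVars n i))) =
      (Fin.cons (w n) x : Fin (n + 1) → M) := by
  funext i
  refine Fin.cases ?_ (fun i => ?_) i
  · simp [consVars]
  · simp [consVars]

theorem IsHenkin.foClosed [Nonempty M] (h : IsHenkin X) : FOClosed X := by
  obtain ⟨D, hD⟩ := h.exists_assignment
  obtain ⟨c⟩ := ‹Nonempty M›
  refine ⟨fun n => ?_, fun {m n S} hS t => ?_, fun {n P Q} hP hQ => ?_, fun {n P} hP => ?_,
    fun {n P} a hP => ?_⟩
  · exact h.2 .falsum (fun _ => c) D hD n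
  · have := h.2 (.app m 0 fun i => t i) (fun _ => c) (Function.update D m fun _ => S)
      (update_assignment_mem hD fun _ => hS) n
    simpa [SOFormula.Realize] using this
  · have := h.2 (.imp (.app n 0 fun i => i) (.app n 1 fun i => i)) (fun _ => c)
      (Function.update D n fun i => if i = 0 then {v | P v} else {v | Q v})
      (update_assignment_mem hD fun i => by split_ifs <;> assumption) n
    simpa [SOFormula.Realize] using this
  · have := h.2 (.all n (.app (n + 1) 0 (consVars n))) (fun _ => c) (Function.update D (n + 1) fun _ =>
      {v | P (Fin.tail v) (v 0)}) (update_assignment_mem hD fun _ => hP) n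
    convert this using 3 with v
    refine forall_congr' fun a => ?_
    rw [SOFormula.Realize, Function.update_self]
    have e : (fun i => Function.update (fun i => if h : i < n then v ⟨i, h⟩ else c) n a
        (consVars n i)) = Fin.cons a v := by
      funext i
      refine Fin.cases ?_ (fun i => ?_) i
      · simp [consVars]
      · simp [consVars, i.2.ne]
    rw [e]
    rfl
  -- Variable `n` is the first one not among the arguments, so its value is taken from the
  -- assignment, here `a`; in the universal case above it is the bound variable.
  · have := h.2 (.app (n + 1) 0 (consVars n)) (fun _ => a) (Function.update D (n + 1) fun _ =>
      {v | P (Fin.tail v) (v 0)}) (update_assignment_mem hD fun _ => hP) n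
    convert this using 3 with v
    rw [SOFormula.Realize, Function.update_self, consVars_apply n v fun _ => a]
    rfl

theorem IsHenkin.eq_mem [Nonempty M] (h : IsHenkin X) : {v : Fin 2 → M | v 0 = v 1} ∈ X 2 := by
  obtain ⟨D, hD⟩ := h.exists_assignment
  obtain ⟨c⟩ := ‹Nonempty M›
  have := h.2 (.equal 0 1) (fun _ => c) D hD 2
  simpa [SOFormula.Realize] using this

/-- `X` contains the union of the relations in `X` that are supported by `Base` and `Step`. -/
theorem IsHenkin.union_mem [Nonempty M] (h : IsHenkin X) {Base : Set (Fin 2 → M)}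
    (hB : Base ∈ X 2) {Step : Set (Fin 4 → M)} (hS : Step ∈ X 4) :
    {z : Fin 2 → M | ∃ E ∈ X 2, (∀ x y, ![x, y] ∈ E → ![x, y] ∈ Base ∨
      ∃ x' y', ![x', y'] ∈ E ∧ ![x', y', x, y] ∈ Step) ∧ z ∈ E} ∈ X 2 := by
  obtain ⟨D, hD⟩ := h.exists_assignment
  obtain ⟨c⟩ := ‹Nonempty M›
  let neg : SOFormula → SOFormula := fun φ => .imp φ .falsum
  -- Binary relation variable `0` is `E` and `1` is `Base`; the quaternary variable `0` is `Step`.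
  -- Object variables `0, 1` hold `z`, `2, 3` hold `x, y`, and `4, 5` hold `x', y'`. Existential
  -- quantifiers are negated universal ones.
  have := h.2 (neg (.allRel 2 0 (.imp (.all 2 (.all 3 (.imp (.app 2 0 ![2, 3]) (.imp
    (neg (.app 2 1 ![2, 3])) (neg (.all 4 (.all 5 (.imp (.app 2 0 ![4, 5])
    (neg (.app 4 0 ![4, 5, 2, 3]))))))))))  (neg (.app 2 0 ![0, 1]))))) (fun _ => c)
    (Function.update (Function.update D 2 fun _ => Base) 4 fun _ => Step)
    (update_assignment_mem (update_assignment_mem hD fun _ => hB) fun _ => hS) 2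
  have v₂ : ∀ (f : ℕ → M) (i j : ℕ), (fun k => f (![i, j] k)) = ![f i, f j] :=
    fun f i j => comp_vec₂ f i j
  have v₄ : ∀ (f : ℕ → M) (i j k l : ℕ), (fun m => f (![i, j, k, l] m)) = ![f i, f j, f k, f l] := by
    intro f i j k l
    funext m
    fin_cases m <;> rfl
  have hv : ∀ v : Fin 2 → M, ![v 0, v 1] = v := fun v => List.ofFn_inj.1 rfl
  convert this using 3 with z
  have f0 : (fun i => if h : i < 2 then z ⟨i, h⟩ else c) 0 = z 0 := rfl
  have f1 : (fun i => if h : i < 2 then z ⟨i, h⟩ else c) 1 = z 1 := rfl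
  generalize (fun i => if h : i < 2 then z ⟨i, h⟩ else c) = f at f0 f1
  simp only [neg, SOFormula.Realize, v₂, v₄]
  simp only [f0, f1, hv]
  simp
  grind

/-- Here the justified collections are the relations in `X` themselves; full comprehension permits
the second-order quantifier needed for their union. -/
theorem IsHenkin.hasFix [Nonempty M] (h : IsHenkin X) : HasFix X := by
  intro Base hB Step hS
  have hc := h.foClosed
  have he := h.eq_mem
  refine ⟨_, h.union_mem hB hS, FOClosed.fix_of_family (X 2) (hc.empty 2) ?_ Base Step
    fun z => Iff.rfl⟩
  intro E hE z
  have := hc.or (P := fun v => v 0 = z 0 ∧ v 1 = z 1) (Q := fun v => v ∈ E)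
    (hc.and (hc.inst (P := fun v c => v 0 = c) (z 0) (hc.atom₂ he 1 0))
      (hc.inst (P := fun v c => v 1 = c) (z 1) (hc.atom₂ he 2 0))) hE
  convert this using 1
  refine Set.ext fun v => or_congr_left ⟨fun h => ⟨congrFun h 0, congrFun h 1⟩, fun h => ?_⟩
  funext i
  fin_cases i
  · exact h.1
  · exact h.2

theorem intScheme_secondOrderInternallyCategorical :
    Scheme.SecondOrderInternallyCategorical.{0, 0, w} intScheme := by
  intro M X hX N₀ N₁ m₀ m₁ s₀ s₁
  have : Nonempty M := N₀.nonempty.nonempty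
  exact exists_iso_of_strong hX.foClosed hX.hasFix m₀ m₁ s₀ s₁

end Henkin

end SchemeCat

theorem mainTheorem3 :
    (∀ (L : FirstOrder.Language.{u, v}) (τ : SchemeCat.Scheme L),
      SchemeCat.Scheme.StronglyInternallyCategorical.{u, v, max u v} τ →
        SchemeCat.Scheme.CategoricalIn.{u, v, u, v, max u v} τ τ.instances) ∧
    (SchemeCat.Scheme.CategoricalIn.{0, 0, 0, 0, w} SchemeCat.intScheme SchemeCat.AS ∧
      SchemeCat.Scheme.SecondOrderInternallyCategorical.{0, 0, w} SchemeCat.intScheme ∧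
      ¬ SchemeCat.Scheme.StronglyInternallyCategorical.{0, 0, w} SchemeCat.intScheme) ∧
    (∀ (L : FirstOrder.Language.{u, v}) (τ : SchemeCat.Scheme L),
      SchemeCat.Scheme.StandaloneCategoricalIn.{u, v, u, v, max u v} τ τ.instances →
        SchemeCat.Scheme.StronglyInternallyCategorical.{u, v, max u v} τ) := by
  exact ⟨fun L τ h => SchemeCat.Scheme.StronglyInternallyCategorical.categoricalIn h,
    ⟨SchemeCat.intScheme_categoricalIn_AS, SchemeCat.intScheme_secondOrderInternallyCategorical,
      SchemeCat.intScheme_not_stronglyInternallyCategorical⟩,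
    fun L τ h => SchemeCat.Scheme.StandaloneCategoricalIn.stronglyInternallyCategorical h⟩
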